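/- Let $G$ be a Lie group and let $(\tilde X,\varpi)$ be a prequantum $G$-space: $\tilde X$ is a (Hausdorff, finite-dimensional) smooth manifold with a smooth action of $G$, and $\varpi$ is a $G$-invariant contact $1$-form on $\tilde X$ whose Reeb vector field generates a free action of the circle group $\mathbb T=\mathrm U_1$. Let $\Phi:\tilde X\to\mathfrak g^*$ be its moment map, $\langle\Phi(\tilde x),Z\rangle=\varpi(Z_{\tilde X}(\tilde x))$ for $Z\in\mathfrak g$, where $Z_{\tilde X}(\tilde x)=\frac{d}{dt}e^{tZ}(\tilde x)\big|_{t=0}$. Let $j:\Phi^{-1}(0)\hookrightarrow\tilde X$ be the inclusion, let $\tilde X/\!\!/G:=\Phi^{-1}(0)/G$ be the reduced space with its subquotient diffeology, and let $\pi:\Phi^{-1}(0)\to\tilde X/\!\!/G$ be the projection. Assume that $G$ acts freely and properly on $\Phi^{-1}(0)$. Then $\tilde X/\!\!/G$ is a Hausdorff smooth manifold (second countable if $\tilde X$ is), i.e. its quotient topology underlies a manifold structure whose smooth maps from open subsets of the spaces $\mathbb R^m$ are the plots of the subquotient diffeology; and it carries a reduced $1$-form, i.e. a smooth $1$-form $\varpi_{\tilde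 X/\!\!/G}$ with $\pi^*\varpi_{\tilde X/\!\!/G}=j^*\varpi$, which is a contact form. Moreover, for this structure, $M\mapsto L=\pi^{-1}(M)$ defines a bijection from the set of Legendrian submanifolds $M$ of $\tilde X/\!\!/G$ onto the set of $G$-invariant Legendrian submanifolds $L$ of $\tilde X$. Here a Legendrian submanifold of a manifold with contact form $\alpha$ is an embedded submanifold (possibly empty, not necessarily closed) on which $\alpha$ vanishes and whose dimension $d$ satisfies $2d+1=\dim$ of the ambient manifold. -/

import Mathlib

open Set Filter Topology
open scoped Manifold ContDiff

noncomputable section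

namespace PrequantumReduction

section Forms

variable {E : Type*} [NormedAddCommGroup E] [NormedSpace ℝ E]
  {X : Type*} [TopologicalSpace X] [ChartedSpace E X]

/-- A (not necessarily smooth) `1`-form on a manifold `X` modelled on `E`. -/
abbrev OneForm (E : Type*) [NormedAddCommGroup E] [NormedSpace ℝ E]
    (X : Type*) [TopologicalSpace X] [ChartedSpace E X] : Type _ :=
  ∀ x : X, TangentSpace 𝓘(ℝ, E) x →L[ℝ] ℝ

/-- A `1`-form is smooth if it is smooth as a function on the tangent bundle. -/
def OneForm.IsSmooth [IsManifold 𝓘(ℝ, E) ∞ X] (α : OneForm E X) : Prop :=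
  ContMDiff 𝓘(ℝ, E).tangent 𝓘(ℝ, ℝ) ∞ (fun v : TangentBundle 𝓘(ℝ, E) X => α v.1 v.2)

/-- The expression of a `1`-form in the preferred chart at `x`, that is, its pull-back to the
model space by the inverse of that chart. -/
def OneForm.inChart (α : OneForm E X) (x : X) (y : E) : E →L[ℝ] ℝ :=
  (α ((extChartAt 𝓘(ℝ, E) x).symm y)).comp
    (mfderiv 𝓘(ℝ, E) 𝓘(ℝ, E) (extChartAt 𝓘(ℝ, E) x).symm y)

/-- The exterior derivative `dα` at `x`, computed in the preferred chart at `x`: the tangent space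
at `x` is by definition the model space `E`, through that chart. -/
def OneForm.d (α : OneForm E X) (x : X) (v w : TangentSpace 𝓘(ℝ, E) x) : ℝ :=
  fderiv ℝ (α.inChart x) (extChartAt 𝓘(ℝ, E) x x) v w
    - fderiv ℝ (α.inChart x) (extChartAt 𝓘(ℝ, E) x x) w v

/-- A contact form: a smooth `1`-form `α`, nowhere zero, such that `dα` is nondegenerate on the
hyperplanes `ker α` (equivalently `α ∧ (dα)ⁿ` is a volume form, the dimension being `2n + 1`). -/
structure OneForm.IsContact [IsManifold 𝓘(ℝ, E) ∞ X] (α : OneForm E X) : Prop where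
  smooth : α.IsSmooth
  ne_zero : ∀ x, α x ≠ 0
  nondegenerate : ∀ x, ∀ v : TangentSpace 𝓘(ℝ, E) x, α x v = 0 →
    (∀ w : TangentSpace 𝓘(ℝ, E) x, α x w = 0 → α.d x v w = 0) → v = 0

/-- `S` is, near its point `x`, an embedded submanifold of dimension `d`: some smooth chart `e`
of the ambient manifold around `x` maps `S` to (an open part of) a `d`-dimensional linear
subspace `V` of the model space. -/
def IsSubmanifoldAt (E : Type*) [NormedAddCommGroup E] [NormedSpace ℝ E]
    {X : Type*} [TopologicalSpace X] [ChartedSpace E X] (d : ℕ) (S : Set X) (x : X) : Prop :=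
  ∃ e ∈ IsManifold.maximalAtlas 𝓘(ℝ, E) ∞ X, x ∈ e.source ∧
    ∃ V : Submodule ℝ E, Module.finrank ℝ V = d ∧ ∀ y ∈ e.source, y ∈ S ↔ e y ∈ V

/-- A Legendrian submanifold for the `1`-form `α`: an embedded submanifold `S` (possibly empty, and
not necessarily closed) whose dimension `d` satisfies `2 d + 1 = dim X`, on which `α` vanishes.
The vanishing of `α` on vectors tangent to `S` is expressed through the velocities of the smooth
curves in `S`. -/
structure OneForm.IsLegendrian (α : OneForm E X) (S : Set X) : Prop where
  submanifold : ∀ x ∈ S, ∃ d : ℕ, 2 * d + 1 = Module.finrank ℝ E ∧ IsSubmanifoldAt E d S x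
  vanishes : ∀ (γ : ℝ → X) (U : Set ℝ), IsOpen U → ContMDiffOn 𝓘(ℝ, ℝ) 𝓘(ℝ, E) ∞ γ U →
    MapsTo γ U S → ∀ t ∈ U, α (γ t) (mfderiv 𝓘(ℝ, ℝ) 𝓘(ℝ, E) γ t (1 : ℝ)) = 0

end Forms

section Prequantum

variable {E F : Type*} [NormedAddCommGroup E] [NormedSpace ℝ E]
  [NormedAddCommGroup F] [NormedSpace ℝ F]
  (G : Type*) [Group G] [TopologicalSpace G] [ChartedSpace F G]
  {X : Type*} [TopologicalSpace X] [ChartedSpace E X] [MulAction G X]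

/-- The Reeb field of `α` generates a free smooth action of the circle group: there is such an
action for which the vector field `x ↦ d/dt (e^{it} • x)` at `t = 0` is the Reeb field `R` of `α`,
characterized by `α(R) = 1` and `dα(R, ·) = 0`. -/
def OneForm.ReebGeneratesFreeCircleAction (α : OneForm E X) : Prop :=
  ∃ _ : MulAction Circle X, ContMDiffSMul (𝓡 1) 𝓘(ℝ, E) ∞ Circle X ∧
    (∀ (z : Circle) (x : X), z • x = x → z = 1) ∧
    ∀ x : X,
      α _ (mfderiv 𝓘(ℝ, ℝ) 𝓘(ℝ, E) (fun t : ℝ => Circle.exp t • x) 0 (1 : ℝ)) = 1 ∧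
      ∀ w, α.d _ (mfderiv 𝓘(ℝ, ℝ) 𝓘(ℝ, E) (fun t : ℝ => Circle.exp t • x) 0 (1 : ℝ)) w = 0

/-- `(X, α)` is a prequantum `G`-space: the Lie group `G` acts smoothly on `X`, and `α` is a
`G`-invariant contact form whose Reeb field generates a free action of the circle group. -/
structure IsPrequantumSpace [IsManifold 𝓘(ℝ, E) ∞ X] (α : OneForm E X) : Prop where
  smooth_action : ContMDiffSMul 𝓘(ℝ, F) 𝓘(ℝ, E) ∞ G X
  contact : α.IsContact
  invariant : ∀ (g : G) (x : X) (v : TangentSpace 𝓘(ℝ, E) x),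
    α (g • x) (mfderiv 𝓘(ℝ, E) 𝓘(ℝ, E) (fun y : X => g • y) x v) = α x v
  reeb : α.ReebGeneratesFreeCircleAction

/-- The prequantum moment map `⟨Φ(x), Z⟩ = α(Z_X(x))`, where the infinitesimal action
`Z_X(x) = d/dt (e^{tZ} • x)` at `t = 0` is the image of `Z` under the derivative at `1` of the orbit
map `g ↦ g • x`. (The latter takes values in the tangent space at `1 • x = x`.) -/
def momentMap (α : OneForm E X) (x : X) : GroupLieAlgebra 𝓘(ℝ, F) G →L[ℝ] ℝ :=
  (α ((1 : G) • x)).comp (mfderiv 𝓘(ℝ, F) 𝓘(ℝ, E) (fun g : G => g • x) (1 : G))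

/-- The zero level `Φ⁻¹(0)` of the moment map. -/
def zeroLevel (α : OneForm E X) : Set X := {x | momentMap (F := F) G α x = 0}

/-- `G` acts freely on the zero level. -/
def ActsFreelyOnZeroLevel (α : OneForm E X) : Prop :=
  ∀ x ∈ zeroLevel (F := F) G α, ∀ g : G, g • x = x → g = 1

/-- `G` acts properly on the zero level `C`: the map `(g, x) ↦ (x, g • x)` from `G × C` to `C × C`
has compact preimages of compact sets. -/
def ActsProperlyOnZeroLevel (α : OneForm E X) : Prop :=
  ∀ K : Set (X × X), K ⊆ zeroLevel (F := F) G α ×ˢ zeroLevel (F := F) G α → IsCompact K →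
    IsCompact {p : G × X | (p.2, p.1 • p.2) ∈ K}

/-- Two points of the zero level are equivalent if they are in the same `G`-orbit. -/
abbrev orbitSetoid (α : OneForm E X) : Setoid (zeroLevel (F := F) G α) :=
  (MulAction.orbitRel G X).comap Subtype.val

/-- The reduced space `X // G = Φ⁻¹(0) / G`, with its quotient topology. -/
abbrev ReducedSpace (α : OneForm E X) : Type _ := Quotient (orbitSetoid (F := F) G α)

/-- The projection `π : Φ⁻¹(0) → X // G`. -/
def proj (α : OneForm E X) (x : zeroLevel (F := F) G α) : ReducedSpace (F := F) G α :=
  Quotient.mk _ x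

/-- `P`, on the open subset `U` of `ℝᵐ`, is a plot of the subset diffeology of `Φ⁻¹(0)`, that is,
a smooth map to `X` with values in `Φ⁻¹(0)`. -/
def IsLevelPlotOn (α : OneForm E X) {m : ℕ}
    (P : EuclideanSpace ℝ (Fin m) → zeroLevel (F := F) G α)
    (U : Set (EuclideanSpace ℝ (Fin m))) : Prop :=
  ContMDiffOn 𝓘(ℝ, EuclideanSpace ℝ (Fin m)) 𝓘(ℝ, E) ∞ (fun u => (P u : X)) U

/-- `P`, on the open subset `U` of `ℝᵐ`, is a plot of the subquotient diffeology of the reduced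
space, that is, it lifts locally to plots of `Φ⁻¹(0)`. -/
def IsReducedPlotOn (α : OneForm E X) {m : ℕ}
    (P : EuclideanSpace ℝ (Fin m) → ReducedSpace (F := F) G α)
    (U : Set (EuclideanSpace ℝ (Fin m))) : Prop :=
  ∀ u ∈ U, ∃ V : Set (EuclideanSpace ℝ (Fin m)), IsOpen V ∧ u ∈ V ∧ V ⊆ U ∧
    ∃ Q : EuclideanSpace ℝ (Fin m) → zeroLevel (F := F) G α,
      IsLevelPlotOn G α Q V ∧ ∀ v ∈ V, proj G α (Q v) = P v

/-- A manifold structure on the reduced space, of dimension `k`, together with a `1`-form `β`: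
the smooth maps from open subsets of the spaces `ℝᵐ` are exactly the plots of the subquotient
diffeology, and `β` is the reduced `1`-form, that is, `π^*β = j^*α`, where `j` is the inclusion
of the zero level (an equality of forms on `Φ⁻¹(0)`, tested on its plots). -/
structure IsReduction (α : OneForm E X) (k : ℕ)
    [ChartedSpace (EuclideanSpace ℝ (Fin k)) (ReducedSpace (F := F) G α)]
    [IsManifold 𝓘(ℝ, EuclideanSpace ℝ (Fin k)) ∞ (ReducedSpace (F := F) G α)]
    (β : OneForm (EuclideanSpace ℝ (Fin k)) (ReducedSpace (F := F) G α)) : Prop where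
  smooth_iff_plot : ∀ (m : ℕ) (P : EuclideanSpace ℝ (Fin m) → ReducedSpace (F := F) G α)
    (U : Set (EuclideanSpace ℝ (Fin m))), IsOpen U →
      (ContMDiffOn 𝓘(ℝ, EuclideanSpace ℝ (Fin m)) 𝓘(ℝ, EuclideanSpace ℝ (Fin k)) ∞ P U ↔
        IsReducedPlotOn G α P U)
  smooth_form : β.IsSmooth
  pullback_eq : ∀ (m : ℕ) (P : EuclideanSpace ℝ (Fin m) → zeroLevel (F := F) G α)
    (U : Set (EuclideanSpace ℝ (Fin m))), IsOpen U → IsLevelPlotOn G α P U →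
      ∀ u ∈ U, ∀ v : EuclideanSpace ℝ (Fin m),
        β (proj G α (P u)) (mfderiv 𝓘(ℝ, EuclideanSpace ℝ (Fin m))
            𝓘(ℝ, EuclideanSpace ℝ (Fin k)) (fun u' => proj G α (P u')) u v) =
          α (P u : X) (mfderiv 𝓘(ℝ, EuclideanSpace ℝ (Fin m)) 𝓘(ℝ, E)
            (fun u' => (P u' : X)) u v)

/-- The preimage `π⁻¹(M)`, as a subset of `X`. -/
def liftSet (α : OneForm E X) (M : Set (ReducedSpace (F := F) G α)) : Set X :=
  Subtype.val '' (proj G α ⁻¹' M)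

end Prequantum

end PrequantumReduction

end

set_option linter.unusedSectionVars false

/-! Let `x` lie in the zero level of the moment map `Φ`, and let `ζ` be the infinitesimal action at
`x`. Invariance of `α` gives `dα(ζ Z, w) = -⟨DΦ(w), Z⟩` (`OneForm.d_vel_orbit`). Freeness makes `ζ`
injective (`vel_orbit_injective`), and `α ∘ ζ = 0` on the level, so nondegeneracy of `dα` on `ker α`
makes `DΦ` surjective. The kernel of `DΦ` contains the orbit directions and the Reeb vector; by the
same identity, the vectors of `ker DΦ ∩ ker α` that are `dα`-orthogonal to this space are exactly
the orbit directions. A complement of them in `ker DΦ` is therefore a linear contact space, of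
dimension `dim X - 2 dim G` (`exists_linear_reduction`).

Flowing out a transversal by the group and straightening `Φ` gives a chart with coordinates (orbit,
reduced, moment) (`exists_preslice`). Properness and freeness ensure that on the zero level the
reduced coordinate separates whole orbits, and not only local pieces of them
(`nonempty_sliceChart`). The reduced coordinates are then charts of the quotient, in which the
projection `π` has smooth local sections; this identifies smooth maps with plots. On the level `α`
is invariant and kills orbit directions, so it descends (`ev_vel_eq_of_proj_eq`), and the linear
algebra at each point makes the reduced form contact.

The plots determine the smooth structure and `π^*β = j^*α` determines `β`, so if the level is
nonempty every reduction is this one (`IsReduction.eq_redForm`). In a slice chart `π⁻¹(M)` is the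
product of an orbit piece, `M` and `0`, whence it is a submanifold whose dimension exceeds that of
`M` by `dim G`. Conversely, on an invariant Legendrian `L` the form kills orbit directions, so `L`
lies in the zero level (`OneForm.IsLegendrian.subset_zeroLevel`) and equals `π⁻¹(π(L))`. That `π(L)`
is a submanifold follows by slicing `L` transversally to the orbits (`exists_straightening`).
Vanishing of the forms passes both ways by projecting and lifting curves. -/

noncomputable section

namespace PrequantumReduction

/-! ### Calculus of `1`-forms in charts. -/

section Toolkit

variable {E : Type*} [NormedAddCommGroup E] [NormedSpace ℝ E]
  {X : Type*} [TopologicalSpace X] [ChartedSpace E X]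
  {Y : Type*} [NormedAddCommGroup Y] [NormedSpace ℝ Y]

/-- Evaluation of a `1`-form, the tangent spaces being identified with the model space. -/
def OneForm.ev (α : OneForm E X) (x : X) (v : E) : ℝ := α x v

/-- The derivative of a map from a normed space to a manifold, as a map to the model space. -/
def vel (P : Y → X) (u v : Y) : E := mfderiv 𝓘(ℝ, Y) 𝓘(ℝ, E) P u v

theorem vel_congr {P Q : Y → X} {u : Y} (h : P =ᶠ[𝓝 u] Q) (v : Y) :
    vel (E := E) P u v = vel Q u v := by
  exact DFunLike.congr_fun (h.mfderiv_eq (I := 𝓘(ℝ, Y)) (I' := 𝓘(ℝ, E))) v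

theorem vel_comp {Z : Type*} [NormedAddCommGroup Z] [NormedSpace ℝ Z] {P : Y → X} {f : Z → Y}
    {z : Z} (hP : MDifferentiableAt 𝓘(ℝ, Y) 𝓘(ℝ, E) P (f z)) (hf : DifferentiableAt ℝ f z) (v : Z) :
    vel (E := E) (P ∘ f) z v = vel P (f z) (fderiv ℝ f z v) := by
  unfold vel
  rw [mfderiv_comp z hP hf.mdifferentiableAt, mfderiv_eq_fderiv]
  rfl

/-- The chain rule for `P = φ⁻¹ ∘ (φ ∘ P)`, where `φ` is the preferred chart at `x`. It moves values
of the form on velocities to the model space, where they can be differentiated. -/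
theorem OneForm.ev_vel (α : OneForm E X) [IsManifold 𝓘(ℝ, E) ∞ X] (x : X) {P : Y → X} {u : Y}
    (hP : MDifferentiableAt 𝓘(ℝ, Y) 𝓘(ℝ, E) P u) (hu : P u ∈ (chartAt E x).source) (v : Y) :
    α.ev (P u) (vel P u v) = α.inChart x (extChartAt 𝓘(ℝ, E) x (P u))
      (fderiv ℝ (fun u => extChartAt 𝓘(ℝ, E) x (P u)) u v) := by
  have h1 : IsManifold 𝓘(ℝ, E) 1 X := IsManifold.of_le (n := ∞) (by simp)
  have hs : extChartAt 𝓘(ℝ, E) x (P u) ∈ (extChartAt 𝓘(ℝ, E) x).target :=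
    (extChartAt 𝓘(ℝ, E) x).map_source (by simpa using hu)
  have hc : MDifferentiableAt 𝓘(ℝ, Y) 𝓘(ℝ, E) (fun u => extChartAt 𝓘(ℝ, E) x (P u)) u :=
    (mdifferentiableAt_extChartAt (I := 𝓘(ℝ, E)) hu).comp u hP
  have he : P =ᶠ[𝓝 u] (extChartAt 𝓘(ℝ, E) x).symm ∘ (fun u => extChartAt 𝓘(ℝ, E) x (P u)) := by
    have : (chartAt E x).source ∈ 𝓝 (P u) := (chartAt E x).open_source.mem_nhds hu
    filter_upwards [hP.continuousAt this] with w hw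
    simpa using ((chartAt E x).left_inv hw).symm
  have hsy : MDifferentiableAt 𝓘(ℝ, E) 𝓘(ℝ, E) (extChartAt 𝓘(ℝ, E) x).symm
      (extChartAt 𝓘(ℝ, E) x (P u)) := by
    have := mdifferentiableWithinAt_extChartAt_symm (I := 𝓘(ℝ, E)) hs
    rwa [ModelWithCorners.range_eq_univ, mdifferentiableWithinAt_univ] at this
  rw [vel_congr he, vel_comp (f := fun u => extChartAt 𝓘(ℝ, E) x (P u)) hsy hc.differentiableAt]
  have hp : P u = (extChartAt 𝓘(ℝ, E) x).symm (extChartAt 𝓘(ℝ, E) x (P u)) := he.self_of_nhds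
  exact (congrArg (fun z => α.ev z _) hp).trans rfl

/-- In finite dimension smoothness can be tested on each constant vector `v`; there the coefficient
is `α`, as a function on the tangent bundle, composed with the tangent map of the inverse chart. -/
theorem OneForm.contDiffOn_inChart [FiniteDimensional ℝ E] [IsManifold 𝓘(ℝ, E) ∞ X]
    {α : OneForm E X} (hα : α.IsSmooth) (x : X) :
    ContDiffOn ℝ ∞ (α.inChart x) (extChartAt 𝓘(ℝ, E) x).target := by
  rw [contDiffOn_clm_apply]
  intro v
  have ho : IsOpen (extChartAt 𝓘(ℝ, E) x).target := isOpen_extChartAt_target x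
  have h1 := contMDiffOn_extChartAt_symm (I := 𝓘(ℝ, E)) (n := ∞) x
  have h2 := h1.contMDiffOn_tangentMapWithin (m := ∞) (by simp) ho.uniqueMDiffOn
  have h3 : ContMDiffOn 𝓘(ℝ, E) 𝓘(ℝ, E).tangent ∞
      (fun y : E => (⟨y, v⟩ : TangentBundle 𝓘(ℝ, E) E)) (extChartAt 𝓘(ℝ, E) x).target :=
    (contMDiff_vectorSpace_iff_contDiff (V := fun _ : E => v)).2 contDiff_const |>.contMDiffOn
  have h4 := hα.comp_contMDiffOn (h2.comp h3 (fun y hy => hy))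
  rw [← contMDiffOn_iff_contDiffOn]
  refine h4.congr fun y hy => ?_
  simp only [OneForm.inChart, tangentMapWithin, Function.comp_apply]
  rw [mfderivWithin_of_isOpen ho hy]
  rfl

/-- A smooth map of vector spaces whose derivative at a point is invertible is a local
diffeomorphism near that point. -/
theorem exists_localDiffeo [CompleteSpace E] {f : E → Y} {U : Set E} {a : E} (hU : IsOpen U)
    (ha : a ∈ U) (hf : ContDiffOn ℝ ∞ f U) {f' : E ≃L[ℝ] Y}
    (hf' : HasFDerivAt f (f' : E →L[ℝ] Y) a) :
    ∃ e : OpenPartialHomeomorph E Y, a ∈ e.source ∧ e.source ⊆ U ∧ (∀ x, e x = f x) ∧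
      ContDiffOn ℝ ∞ e e.source ∧ ContDiffOn ℝ ∞ e.symm e.target := by
  have hfa : ContDiffAt ℝ ∞ f a := hf.contDiffAt (hU.mem_nhds ha)
  set e0 := hfa.toOpenPartialHomeomorph f hf' (by simp) with he0
  have hcf : ContinuousOn (fderiv ℝ f) U := hf.continuousOn_fderiv_of_isOpen hU (by simp)
  -- For the inverse to be smooth on the whole target, the source is cut down to the points where
  -- the derivative is invertible; they form an open set because isomorphisms are open among
  -- continuous linear maps.
  have hop : IsOpen (U ∩ fderiv ℝ f ⁻¹' (range ((↑) : (E ≃L[ℝ] Y) → E →L[ℝ] Y))) :=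
    hcf.isOpen_inter_preimage hU ContinuousLinearEquiv.isOpen
  set e := e0.restrOpen _ hop with he
  have hs : e.source ⊆ U ∩ fderiv ℝ f ⁻¹' (range ((↑) : (E ≃L[ℝ] Y) → E →L[ℝ] Y)) := by
    intro x hx
    simp only [he, OpenPartialHomeomorph.restrOpen_source] at hx
    exact hx.2
  refine ⟨e, ?_, fun x hx => (hs hx).1, fun x => rfl, hf.mono fun x hx => (hs hx).1, ?_⟩
  · simp only [he, OpenPartialHomeomorph.restrOpen_source]
    exact ⟨hfa.mem_toOpenPartialHomeomorph_source hf' (by simp), ha, f', hf'.fderiv.symm⟩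
  · intro y hy
    obtain ⟨h1, f1, h2⟩ := hs (e.map_target hy)
    have hd : HasFDerivAt f (f1 : E →L[ℝ] Y) (e.symm y) := by
      rw [h2]
      exact ((hf.contDiffAt (hU.mem_nhds h1)).differentiableAt (by simp)).hasFDerivAt
    exact (e.contDiffAt_symm hy hd (hf.contDiffAt (hU.mem_nhds h1))).contDiffWithinAt

/-- Naturality of the exterior derivative of `1`-forms on vector spaces. -/
theorem fderiv_pullback_antisymm {θ : E → E →L[ℝ] ℝ} {h : Y → E} {u : Y}
    (hθ : DifferentiableAt ℝ θ (h u)) (hh : ContDiffAt ℝ 2 h u) (v w : Y) :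
    fderiv ℝ (fun u => (θ (h u)).comp (fderiv ℝ h u)) u v w -
      fderiv ℝ (fun u => (θ (h u)).comp (fderiv ℝ h u)) u w v =
    fderiv ℝ θ (h u) (fderiv ℝ h u v) (fderiv ℝ h u w) -
      fderiv ℝ θ (h u) (fderiv ℝ h u w) (fderiv ℝ h u v) := by
  have h1 : DifferentiableAt ℝ h u := hh.differentiableAt (by simp)
  have h2 : DifferentiableAt ℝ (fderiv ℝ h) u :=
    (hh.fderiv_right (m := 1) (by norm_num)).differentiableAt (by simp)
  have h3 : DifferentiableAt ℝ (fun u => θ (h u)) u := hθ.comp u h1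
  -- The second derivative of `h` enters both terms and cancels by symmetry.
  have hsym : fderiv ℝ (fderiv ℝ h) u v w = fderiv ℝ (fderiv ℝ h) u w v :=
    (hh.isSymmSndFDerivAt (by simp)).eq v w
  have hc : fderiv ℝ (fun u => θ (h u)) u = (fderiv ℝ θ (h u)).comp (fderiv ℝ h u) :=
    fderiv_comp u hθ h1
  rw [fderiv_clm_comp h3 h2, hc]
  simp [hsym]

end Toolkit

/-! ### Invariant forms and the moment map. -/

section Action

variable {E F : Type*} [NormedAddCommGroup E] [NormedSpace ℝ E]
  [NormedAddCommGroup F] [NormedSpace ℝ F]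
  {G : Type*} [Group G] [TopologicalSpace G] [ChartedSpace F G]
  {X : Type*} [TopologicalSpace X] [ChartedSpace E X] [MulAction G X]
  {Y : Type*} [NormedAddCommGroup Y] [NormedSpace ℝ Y]

variable (G) in
/-- The inverse of the preferred chart of the Lie group `G` at `1`, centred at `0`. -/
def groupParam (f : F) : G :=
  (extChartAt 𝓘(ℝ, F) (1 : G)).symm (extChartAt 𝓘(ℝ, F) (1 : G) 1 + f)

variable (F G) in
/-- The domain of `groupParam`. -/
def groupParamDomain : Set F :=
  (fun f => extChartAt 𝓘(ℝ, F) (1 : G) 1 + f) ⁻¹' (extChartAt 𝓘(ℝ, F) (1 : G)).target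

theorem isOpen_groupParamDomain : IsOpen (groupParamDomain F G) :=
  (isOpen_extChartAt_target (I := 𝓘(ℝ, F)) (1 : G)).preimage (by fun_prop)

theorem zero_mem_groupParamDomain : (0 : F) ∈ groupParamDomain F G := by
  simp [groupParamDomain]

@[simp] theorem groupParam_zero : groupParam G (0 : F) = 1 := by
  simp [groupParam]

theorem contMDiffOn_groupParam [IsManifold 𝓘(ℝ, F) ∞ G] :
    ContMDiffOn 𝓘(ℝ, F) 𝓘(ℝ, F) ∞ (groupParam G : F → G) (groupParamDomain F G) := by
  refine (contMDiffOn_extChartAt_symm (I := 𝓘(ℝ, F)) (n := ∞) (1 : G)).comp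
    (t := (extChartAt 𝓘(ℝ, F) (1 : G)).target) ?_ (fun _ h => h)
  exact ContDiff.contMDiff (by fun_prop) |>.contMDiffOn

theorem mdifferentiableAt_groupParam [IsManifold 𝓘(ℝ, F) ∞ G] {f : F}
    (hf : f ∈ groupParamDomain F G) :
    MDifferentiableAt 𝓘(ℝ, F) 𝓘(ℝ, F) (groupParam G : F → G) f :=
  (contMDiffOn_groupParam.contMDiffAt (isOpen_groupParamDomain.mem_nhds hf)).mdifferentiableAt
    (by simp)

/-- The centred inverse chart is tangent to the identity at `0`, like the exponential map. Only
first-order behaviour at `1` enters the infinitesimal action, so it can play the role of `exp`. -/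
theorem vel_groupParam_zero [IsManifold 𝓘(ℝ, F) ∞ G] (Z : F) :
    vel (E := F) (groupParam G : F → G) 0 Z = Z := by
  have h1 : IsManifold 𝓘(ℝ, F) 1 G := IsManifold.of_le (n := ∞) (by simp)
  have h2 : MDifferentiableAt 𝓘(ℝ, F) 𝓘(ℝ, F) (extChartAt 𝓘(ℝ, F) (1 : G)).symm
      (extChartAt 𝓘(ℝ, F) (1 : G) 1 + 0) := by
    have := mdifferentiableWithinAt_extChartAt_symm (I := 𝓘(ℝ, F)) (x := (1 : G))
      (z := extChartAt 𝓘(ℝ, F) (1 : G) 1 + 0) (by simp)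
    rwa [ModelWithCorners.range_eq_univ, mdifferentiableWithinAt_univ] at this
  have h3 := mfderivWithin_range_extChartAt_symm (I := 𝓘(ℝ, F)) (x := (1 : G))
  rw [ModelWithCorners.range_eq_univ, mfderivWithin_univ] at h3
  have h4 := vel_comp (f := fun f : F => extChartAt 𝓘(ℝ, F) (1 : G) 1 + f) (z := 0) h2
    (by fun_prop) Z
  rw [fderiv_const_add, fderiv_fun_id, add_zero] at h4
  exact h4.trans (DFunLike.congr_fun h3 Z)

theorem mdifferentiableAt_smul_const [h : ContMDiffSMul 𝓘(ℝ, F) 𝓘(ℝ, E) ∞ G X] {c : Y → G} {u : Y}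
    (hc : MDifferentiableAt 𝓘(ℝ, Y) 𝓘(ℝ, F) c u) (x : X) :
    MDifferentiableAt 𝓘(ℝ, Y) 𝓘(ℝ, E) (fun y => c y • x) u :=
  (h.contMDiff_smul.mdifferentiableAt (x := (c u, x)) (by simp)).comp u
    (f := fun y => (c y, x)) (hc.prodMk mdifferentiableAt_const)

variable (G X) in
theorem contMDiff_orbitMap [h : ContMDiffSMul 𝓘(ℝ, F) 𝓘(ℝ, E) ∞ G X] (x : X) :
    ContMDiff 𝓘(ℝ, F) 𝓘(ℝ, E) ∞ (fun g : G => g • x) :=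
  h.contMDiff_smul.comp (contMDiff_id.prodMk contMDiff_const)

variable (F) in
theorem contMDiff_smul_left [h : ContMDiffSMul 𝓘(ℝ, F) 𝓘(ℝ, E) ∞ G X] (g : G) :
    ContMDiff 𝓘(ℝ, E) 𝓘(ℝ, E) ∞ (fun x : X => g • x) :=
  h.contMDiff_smul.comp (contMDiff_const.prodMk contMDiff_id)

/-- By the chain rule, every family in `G` through `1` computes the moment map. The cases needed are
`groupParam` and its conjugates. -/
theorem OneForm.ev_vel_smul_const (α : OneForm E X) [ContMDiffSMul 𝓘(ℝ, F) 𝓘(ℝ, E) ∞ G X]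
    {c : Y → G} {u : Y} (hc : MDifferentiableAt 𝓘(ℝ, Y) 𝓘(ℝ, F) c u) (hu : c u = 1) (x : X) (v : Y) :
    α.ev (c u • x) (vel (fun y => c y • x) u v) = momentMap (F := F) G α x (vel c u v : F) := by
  have h1 : MDifferentiableAt 𝓘(ℝ, F) 𝓘(ℝ, E) (fun g : G => g • x) (c u) :=
    (contMDiff_orbitMap G X x).mdifferentiableAt (by simp)
  have h2 := mfderiv_comp u h1 hc
  have h3 : vel (E := E) (fun y => c y • x) u v =
    mfderiv 𝓘(ℝ, F) 𝓘(ℝ, E) (fun g : G => g • x) (c u) (mfderiv 𝓘(ℝ, Y) 𝓘(ℝ, F) c u v) :=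
    DFunLike.congr_fun h2 v
  rw [h3]
  have h4 : ∀ g : G, g = 1 → ∀ w : F, α.ev (g • x)
      (mfderiv 𝓘(ℝ, F) 𝓘(ℝ, E) (fun g : G => g • x) g w : E) = momentMap (F := F) G α x w := by
    rintro g rfl w
    rfl
  exact h4 _ hu _

theorem momentMap_eq (α : OneForm E X) [IsManifold 𝓘(ℝ, F) ∞ G]
    [ContMDiffSMul 𝓘(ℝ, F) 𝓘(ℝ, E) ∞ G X] (x : X) (Z : F) :
    momentMap (F := F) G α x Z = α.ev x (vel (fun f : F => groupParam G f • x) 0 Z) := by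
  have := α.ev_vel_smul_const (mdifferentiableAt_groupParam zero_mem_groupParamDomain)
    (groupParam_zero (F := F) (G := G)) x Z
  rw [vel_groupParam_zero, groupParam_zero, one_smul] at this
  exact this.symm

variable (G) in
/-- Invariance of a `1`-form under the action of `G`. -/
def OneForm.IsInvariant (α : OneForm E X) : Prop :=
  ∀ (g : G) (x : X) (v : TangentSpace 𝓘(ℝ, E) x),
    α (g • x) (mfderiv 𝓘(ℝ, E) 𝓘(ℝ, E) (fun y : X => g • y) x v) = α x v

variable {α : OneForm E X}

variable (F) in
theorem OneForm.IsInvariant.ev_vel_smul [ContMDiffSMul 𝓘(ℝ, F) 𝓘(ℝ, E) ∞ G X]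
    (hα : α.IsInvariant G) (g : G) {P : Y → X} {u : Y}
    (hP : MDifferentiableAt 𝓘(ℝ, Y) 𝓘(ℝ, E) P u) (v : Y) :
    α.ev (g • P u) (vel (fun y => g • P y) u v) = α.ev (P u) (vel P u v) := by
  have h1 : MDifferentiableAt 𝓘(ℝ, E) 𝓘(ℝ, E) (fun y : X => g • y) (P u) :=
    (contMDiff_smul_left F g).mdifferentiableAt (by simp)
  have h2 := mfderiv_comp u h1 hP
  have h3 : vel (E := E) (fun y => g • P y) u v =
    mfderiv 𝓘(ℝ, E) 𝓘(ℝ, E) (fun y : X => g • y) (P u) (mfderiv 𝓘(ℝ, Y) 𝓘(ℝ, E) P u v) :=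
    DFunLike.congr_fun h2 v
  rw [h3]
  exact hα g (P u) _

/-- Equivariance of the moment map: `h • (g • x) = g • ((g⁻¹ h g) • x)`, and translation by `g`
preserves the form. So the value at `g • x` is a value at `x`, taken along the conjugated family
`g⁻¹ h g`. -/
theorem OneForm.IsInvariant.smul_mem_zeroLevel [LieGroup 𝓘(ℝ, F) ∞ G]
    [ContMDiffSMul 𝓘(ℝ, F) 𝓘(ℝ, E) ∞ G X]
    (hα : α.IsInvariant G) (g : G) {x : X} (hx : x ∈ zeroLevel (F := F) G α) :
    g • x ∈ zeroLevel (F := F) G α := by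
  have hx' : momentMap (F := F) G α x = 0 := hx
  suffices H : ∀ Z : F, momentMap (F := F) G α (g • x) Z = 0 from ContinuousLinearMap.ext H
  intro Z
  have hc : MDifferentiableAt 𝓘(ℝ, F) 𝓘(ℝ, F) (fun f : F => g⁻¹ * groupParam G f * g) 0 :=
    ((contMDiff_mul_right (I := 𝓘(ℝ, F)) (n := ∞) (a := g)).comp
      (contMDiff_mul_left (I := 𝓘(ℝ, F)) (n := ∞) (a := g⁻¹))).mdifferentiableAt
      (by simp) |>.comp 0 (mdifferentiableAt_groupParam zero_mem_groupParamDomain)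
  have h1 := α.ev_vel_smul_const hc (by simp) x Z
  rw [← hα.ev_vel_smul F g (mdifferentiableAt_smul_const hc x), hx'] at h1
  refine (momentMap_eq α (g • x) Z).trans ?_
  simp only [smul_smul, ← mul_assoc, mul_inv_cancel, one_mul, groupParam_zero] at h1 ⊢
  exact h1

theorem OneForm.IsInvariant.smul_mem_zeroLevel_iff [LieGroup 𝓘(ℝ, F) ∞ G]
    [ContMDiffSMul 𝓘(ℝ, F) 𝓘(ℝ, E) ∞ G X]
    (hα : α.IsInvariant G) (g : G) {x : X} :
    g • x ∈ zeroLevel (F := F) G α ↔ x ∈ zeroLevel (F := F) G α :=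
  ⟨fun h => by simpa using hα.smul_mem_zeroLevel g⁻¹ h, hα.smul_mem_zeroLevel g⟩

end Action

/-! ### Injectivity of the infinitesimal action. -/

section MomentMap

variable {E F : Type*} [NormedAddCommGroup E] [NormedSpace ℝ E]
  [NormedAddCommGroup F] [NormedSpace ℝ F]
  {G : Type*} [Group G] [TopologicalSpace G] [ChartedSpace F G]
  {X : Type*} [TopologicalSpace X] [ChartedSpace E X] [MulAction G X]
  {Y : Type*} [NormedAddCommGroup Y] [NormedSpace ℝ Y]

/-- A curve in a manifold whose velocity vanishes near a point is constant near that point. -/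
theorem eventually_eq_of_vel_eq_zero [IsManifold 𝓘(ℝ, E) ∞ X] {c : ℝ → X} {t : ℝ}
    (hc : ∀ᶠ s in 𝓝 t, MDifferentiableAt 𝓘(ℝ, ℝ) 𝓘(ℝ, E) c s ∧ vel (E := E) c s 1 = 0) :
    ∀ᶠ s in 𝓝 t, c s = c t := by
  have h1 : IsManifold 𝓘(ℝ, E) 1 X := IsManifold.of_le (n := ∞) (by simp)
  have hcont : ContinuousAt c t := hc.self_of_nhds.1.continuousAt
  have hsrc : ∀ᶠ s in 𝓝 t, c s ∈ (chartAt E (c t)).source :=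
    hcont ((chartAt E (c t)).open_source.mem_nhds (mem_chart_source E (c t)))
  obtain ⟨ε, hε, hball⟩ := Metric.eventually_nhds_iff_ball.1 (hc.and hsrc)
  have hd : ∀ s ∈ Metric.ball t ε,
      HasFDerivAt (fun s => extChartAt 𝓘(ℝ, E) (c t) (c s)) (0 : ℝ →L[ℝ] E) s := by
    intro s hs
    obtain ⟨⟨h2, h3⟩, h4⟩ := hball s hs
    have h5 := ((mdifferentiableAt_extChartAt (I := 𝓘(ℝ, E)) h4).hasMFDerivAt).comp s
      h2.hasMFDerivAt
    have h6 := h5.hasFDerivAt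
    refine h6.congr_fderiv (ContinuousLinearMap.ext_ring ?_)
    have h7 : (mfderiv 𝓘(ℝ, ℝ) 𝓘(ℝ, E) c s (1 : ℝ)) = 0 := h3
    refine (congrArg (mfderiv 𝓘(ℝ, E) 𝓘(ℝ, E) (extChartAt 𝓘(ℝ, E) (c t)) (c s)) h7).trans ?_
    exact map_zero _
  have hball_nhds : Metric.ball t ε ∈ 𝓝 t := Metric.ball_mem_nhds t hε
  filter_upwards [hball_nhds] with s hs
  have h8 := Metric.isOpen_ball.is_const_of_fderiv_eq_zero (𝕜 := ℝ)
    (convex_ball t ε).isPreconnected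
    (fun s hs => (hd s hs).differentiableAt.differentiableWithinAt)
    (fun s hs => (hd s hs).fderiv) hs (Metric.mem_ball_self hε)
  have h9 := (extChartAt 𝓘(ℝ, E) (c t)).injOn (by simpa using (hball s hs).2) (by simp) h8
  exact h9

theorem vel_comp_left {E' : Type*} [NormedAddCommGroup E'] [NormedSpace ℝ E'] {X' : Type*}
    [TopologicalSpace X'] [ChartedSpace E' X'] {h : X → X'} {P : Y → X} {u : Y} {x : X}
    (hu : P u = x) (hh : MDifferentiableAt 𝓘(ℝ, E) 𝓘(ℝ, E') h x)
    (hP : MDifferentiableAt 𝓘(ℝ, Y) 𝓘(ℝ, E) P u) (v : Y) :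
    vel (E := E') (fun y => h (P y)) u v =
      (mfderiv 𝓘(ℝ, E) 𝓘(ℝ, E') h x (vel P u v : E) : E') := by
  subst hu
  exact DFunLike.congr_fun (mfderiv_comp u hh hP) v

/-- The infinitesimal action at a point with trivial stabilizer is injective. -/
theorem vel_orbit_injective [CompleteSpace F] [LieGroup 𝓘(ℝ, F) ∞ G] [IsManifold 𝓘(ℝ, E) ∞ X]
    [ContMDiffSMul 𝓘(ℝ, F) 𝓘(ℝ, E) ∞ G X] {x : X} (hx : ∀ g : G, g • x = x → g = 1) {Z : F}
    (hZ : vel (E := E) (fun f : F => groupParam G f • x) 0 Z = 0) : Z = 0 := by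
  have hG3 : LieGroup 𝓘(ℝ, F) (minSmoothness ℝ 3) G :=
    LieGroup.of_le (n := ∞) (by rw [minSmoothness_of_isRCLikeNormedField]; exact WithTop.coe_le_coe.2 le_top)
  have h1 : IsManifold 𝓘(ℝ, F) 1 G := IsManifold.of_le (n := ∞) (by simp)
  have hparam := mdifferentiableAt_groupParam (G := G) (zero_mem_groupParamDomain (F := F))
  have hinv : ∀ g : G, vel (E := F) (fun f : F => g * groupParam G f) 0 Z =
      mulInvariantVectorField (I := 𝓘(ℝ, F)) Z g := fun g =>
    (vel_comp_left groupParam_zero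
      ((contMDiff_mul_left (I := 𝓘(ℝ, F)) (n := ∞) (a := g)).mdifferentiableAt (by simp))
      hparam Z).trans (congrArg _ (vel_groupParam_zero Z))
  -- The orbit map kills the left-invariant field of `Z`: differentiating `(g h) • x = g • (h • x)`
  -- in `h` at `1` gives the translate by `g` of the infinitesimal action of `Z` at `x`, which is
  -- zero.
  have hker : ∀ g : G, (mfderiv 𝓘(ℝ, F) 𝓘(ℝ, E) (fun h : G => h • x) g
      (mulInvariantVectorField (I := 𝓘(ℝ, F)) Z g) : E) = 0 := by
    intro g
    have h2 := vel_comp_left (h := fun h : G => h • x) (P := fun f : F => g * groupParam G f)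
      (u := 0) (x := g) (by simp) ((contMDiff_orbitMap (E := E) G X x).mdifferentiableAt (by simp))
      ((contMDiff_mul_left (I := 𝓘(ℝ, F)) (n := ∞) (a := g)).mdifferentiableAt (by simp)
        |>.comp 0 hparam) Z
    have h3 := vel_comp_left (h := fun y : X => g • y) (P := fun f : F => groupParam G f • x)
      (u := 0) rfl ((contMDiff_smul_left (E := E) F g).mdifferentiableAt (by simp))
      (mdifferentiableAt_smul_const hparam x) Z
    rw [hZ] at h3
    replace h3 := h3.trans (map_zero _)
    simp only [mul_smul] at h2
    rw [hinv, h3] at h2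
    exact h2.symm
  have hV := contMDiff_mulInvariantVectorField (I := 𝓘(ℝ, F)) (G := G) Z
  -- The integral curve through `1` stands for `t ↦ e^{tZ}`. Since `γ t • x` has zero velocity it is
  -- constant, so `γ t` fixes `x` and equals `1` near `0`; thus `Z`, its velocity at `0`, vanishes.
  obtain ⟨γ, hγ0, hγ⟩ := exists_isMIntegralCurveAt_of_contMDiffAt_boundaryless (t₀ := 0)
    ((hV.contMDiffAt (x := 1)).of_le (m := 1)
      (by rw [minSmoothness_of_isRCLikeNormedField]; norm_num))
  have hvel : ∀ᶠ t in 𝓝 (0 : ℝ),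
      MDifferentiableAt 𝓘(ℝ, ℝ) 𝓘(ℝ, E) (fun t => γ t • x) t ∧
        vel (E := E) (fun t => γ t • x) t 1 = 0 := by
    filter_upwards [hγ] with t ht
    refine ⟨mdifferentiableAt_smul_const ht.mdifferentiableAt x, ?_⟩
    refine (vel_comp_left (h := fun h : G => h • x) (P := γ) rfl
      ((contMDiff_orbitMap (E := E) G X x).mdifferentiableAt (by simp)) ht.mdifferentiableAt 1).trans ?_
    have h4 : (vel γ t 1 : F) = mulInvariantVectorField (I := 𝓘(ℝ, F)) Z (γ t) :=
      (DFunLike.congr_fun ht.mfderiv 1).trans (one_smul ℝ (_ : F))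
    rw [h4]
    exact hker (γ t)
  have hconst := eventually_eq_of_vel_eq_zero hvel
  have hone : γ =ᶠ[𝓝 0] fun _ => 1 := by
    filter_upwards [hconst] with t ht
    refine hx _ ?_
    simpa [hγ0] using ht
  have h5 : vel γ 0 1 = Z := by
    refine (DFunLike.congr_fun hγ.self_of_nhds.mfderiv 1).trans ((one_smul ℝ (_ : F)).trans ?_)
    rw [hγ0, ← hinv]
    simpa using vel_groupParam_zero (G := G) Z
  rw [← h5, vel_congr hone]
  exact DFunLike.congr_fun (mfderiv_const (I := 𝓘(ℝ, ℝ)) (I' := 𝓘(ℝ, F)) (c := (1 : G))) 1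

end MomentMap

/-! ### The action in a chart, and the derivative of the moment map. -/

section LocalAction

variable {E F : Type*} [NormedAddCommGroup E] [NormedSpace ℝ E]
  [NormedAddCommGroup F] [NormedSpace ℝ F]
  {G : Type*} [Group G] [TopologicalSpace G] [ChartedSpace F G]
  {X : Type*} [TopologicalSpace X] [ChartedSpace E X] [MulAction G X]

variable (F G) in
/-- The action of `G`, parametrized by `groupParam` and by the preferred chart of `X` at `x`. -/
def paramAction (x : X) (p : F × E) : X :=
  groupParam G p.1 • (extChartAt 𝓘(ℝ, E) x).symm p.2

variable (F G) in
/-- The domain on which `paramAction` takes values in the domain of the preferred chart at `x`. -/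
def paramActionDomain (x : X) : Set (F × E) :=
  (groupParamDomain F G ×ˢ (extChartAt 𝓘(ℝ, E) x).target) ∩
    paramAction F G x ⁻¹' (chartAt E x).source

variable (F G) in
/-- The expression of `paramAction` in the preferred chart of `X` at `x`. -/
def localAction (x : X) (p : F × E) : E :=
  extChartAt 𝓘(ℝ, E) x (paramAction F G x p)

theorem mk_zero_mem_paramActionDomain {x : X} {y : E} (hy : y ∈ (extChartAt 𝓘(ℝ, E) x).target) :
    ((0 : F), y) ∈ paramActionDomain F G x := by
  refine ⟨⟨zero_mem_groupParamDomain, hy⟩, ?_⟩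
  have := (extChartAt 𝓘(ℝ, E) x).map_target hy
  simpa [paramAction] using this

theorem localAction_zero {x : X} {y : E} (hy : y ∈ (extChartAt 𝓘(ℝ, E) x).target) :
    localAction F G x (0, y) = y := by
  simpa [localAction, paramAction] using (extChartAt 𝓘(ℝ, E) x).right_inv hy

variable [IsManifold 𝓘(ℝ, F) ∞ G] [IsManifold 𝓘(ℝ, E) ∞ X]
  [hGX : ContMDiffSMul 𝓘(ℝ, F) 𝓘(ℝ, E) ∞ G X]

theorem contMDiffOn_paramAction (x : X) :
    ContMDiffOn 𝓘(ℝ, F × E) 𝓘(ℝ, E) ∞ (paramAction F G x)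
      (groupParamDomain F G ×ˢ (extChartAt 𝓘(ℝ, E) x).target) := by
  refine hGX.contMDiff_smul.comp_contMDiffOn (ContMDiffOn.prodMk ?_ ?_)
  · exact contMDiffOn_groupParam.comp contDiff_fst.contMDiff.contMDiffOn fun p hp => hp.1
  · exact (contMDiffOn_extChartAt_symm (I := 𝓘(ℝ, E)) (n := ∞) x).comp
      contDiff_snd.contMDiff.contMDiffOn fun p hp => hp.2

theorem isOpen_paramActionDomain (x : X) : IsOpen (paramActionDomain (E := E) F G x) :=
  (contMDiffOn_paramAction x).continuousOn.isOpen_inter_preimage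
    (isOpen_groupParamDomain.prod (isOpen_extChartAt_target x)) (chartAt E x).open_source

theorem contDiffOn_localAction (x : X) :
    ContDiffOn ℝ ∞ (localAction (E := E) F G x) (paramActionDomain F G x) := by
  rw [← contMDiffOn_iff_contDiffOn]
  exact (contMDiffOn_extChartAt (I := 𝓘(ℝ, E)) (n := ∞)).comp
    ((contMDiffOn_paramAction x).mono inter_subset_left) fun p hp => hp.2

theorem mdifferentiableAt_paramAction {x : X} {p : F × E} (hp : p ∈ paramActionDomain F G x) :
    MDifferentiableAt 𝓘(ℝ, F × E) 𝓘(ℝ, E) (paramAction F G x) p :=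
  (((contMDiffOn_paramAction x).mono inter_subset_left).contMDiffAt
    ((isOpen_paramActionDomain x).mem_nhds hp)).mdifferentiableAt (by simp)

theorem mdifferentiableAt_extChartAt_symm {x : X} {y : E} (hy : y ∈ (extChartAt 𝓘(ℝ, E) x).target) :
    MDifferentiableAt 𝓘(ℝ, E) 𝓘(ℝ, E) (extChartAt 𝓘(ℝ, E) x).symm y :=
  ((contMDiffOn_extChartAt_symm (I := 𝓘(ℝ, E)) (n := ∞) x).contMDiffAt
    ((isOpen_extChartAt_target x).mem_nhds hy)).mdifferentiableAt (by simp)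

theorem vel_eq_fderiv {Y : Type*} [NormedAddCommGroup Y] [NormedSpace ℝ Y] {P : Y → X} {u : Y}
    {x : X} (hu : P u = x) (hP : MDifferentiableAt 𝓘(ℝ, Y) 𝓘(ℝ, E) P u) (v : Y) :
    vel P u v = fderiv ℝ (fun y => extChartAt 𝓘(ℝ, E) x (P y)) u v := by
  have h1 : IsManifold 𝓘(ℝ, E) 1 X := IsManifold.of_le (n := ∞) (by simp)
  have h2 := vel_comp_left hu (mdifferentiableAt_extChartAt (I := 𝓘(ℝ, E)) (mem_chart_source E x))
    hP v
  rw [mfderiv_extChartAt_self] at h2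
  rw [← mfderiv_eq_fderiv]
  exact h2.symm

variable {α : OneForm E X}

variable (F G) in
/-- The pull-back of a `1`-form by `paramAction`. -/
def OneForm.actionPullback (α : OneForm E X) (x : X) (p : F × E) : F × E →L[ℝ] ℝ :=
  (α.inChart x (localAction F G x p)).comp (fderiv ℝ (localAction F G x) p)

theorem OneForm.actionPullback_apply {x : X} {p : F × E} (hp : p ∈ paramActionDomain F G x)
    (v : F × E) :
    α.actionPullback F G x p v = α.ev (paramAction F G x p) (vel (paramAction F G x) p v) :=
  (α.ev_vel x (mdifferentiableAt_paramAction hp) hp.2 v).symm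

/-- With the group parameter frozen, `paramAction` is translation by one group element, which
preserves the form; so these components do not depend on `p.1`. -/
theorem OneForm.IsInvariant.actionPullback_snd (hα : α.IsInvariant G) {x : X} {p : F × E}
    (hp : p ∈ paramActionDomain F G x) (w : E) :
    α.actionPullback F G x p (0, w) = α.inChart x p.2 w := by
  obtain ⟨f, y⟩ := p
  have h2 := vel_comp (P := paramAction F G x) (f := fun z : E => (f, z)) (z := y)
    (mdifferentiableAt_paramAction hp) (by fun_prop) w
  have h3 : fderiv ℝ (fun z : E => (f, z)) y w = (0, w) := by
    rw [(hasFDerivAt_prodMk_right f y).fderiv]; rfl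
  rw [h3] at h2
  rw [actionPullback_apply hp, ← h2]
  exact (hα.ev_vel_smul F (groupParam G f) (mdifferentiableAt_extChartAt_symm hp.1.2) w).trans rfl

/-- At parameter `0` the first factor sweeps out the orbit, so the component along it is the moment
map. -/
theorem OneForm.actionPullback_zero_fst {x : X} {y : E}
    (hy : y ∈ (extChartAt 𝓘(ℝ, E) x).target) (Z : F) :
    α.actionPullback F G x (0, y) (Z, 0) =
      momentMap (F := F) G α ((extChartAt 𝓘(ℝ, E) x).symm y) Z := by
  have hp := mk_zero_mem_paramActionDomain (F := F) (G := G) hy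
  have h2 := vel_comp (P := paramAction F G x) (f := fun f : F => (f, y)) (z := 0)
    (mdifferentiableAt_paramAction hp) (by fun_prop) Z
  have h3 : fderiv ℝ (fun f : F => (f, y)) 0 Z = (Z, 0) := by
    rw [(hasFDerivAt_prodMk_left (𝕜 := ℝ) (0 : F) y).fderiv]; rfl
  rw [h3] at h2
  rw [actionPullback_apply hp, ← h2, momentMap_eq]
  simp only [paramAction, groupParam_zero, one_smul]
  rfl

variable (F G) in
/-- The moment map in the preferred chart at `x`. -/
def OneForm.localMoment (α : OneForm E X) (x : X) (y : E) : F →L[ℝ] ℝ :=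
  momentMap (F := F) G α ((extChartAt 𝓘(ℝ, E) x).symm y)

theorem OneForm.contDiffOn_actionPullback [FiniteDimensional ℝ E] (hα : α.IsSmooth) (x : X) :
    ContDiffOn ℝ ∞ (α.actionPullback F G x) (paramActionDomain F G x) := by
  refine ContDiffOn.clm_comp ?_ ?_
  · refine (α.contDiffOn_inChart hα x).comp (contDiffOn_localAction x) fun p hp => ?_
    exact (extChartAt 𝓘(ℝ, E) x).map_source (by simpa using hp.2)
  · exact (contDiffOn_localAction x).fderiv_of_isOpen (isOpen_paramActionDomain x) (by simp)

/-- The moment map is the orbit component of the pulled-back form at parameter `0`, and inherits its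
smoothness. -/
theorem OneForm.contDiffOn_localMoment [FiniteDimensional ℝ E] (hα : α.IsSmooth) (x : X) :
    ContDiffOn ℝ ∞ (α.localMoment F G x) (extChartAt 𝓘(ℝ, E) x).target := by
  have h1 : ContDiffOn ℝ ∞ (fun y => (α.actionPullback F G x (0, y)).comp
      (ContinuousLinearMap.inl ℝ F E)) (extChartAt 𝓘(ℝ, E) x).target := by
    refine ContDiffOn.clm_comp ?_ contDiffOn_const
    exact (α.contDiffOn_actionPullback hα x).comp (f := fun y => ((0 : F), y))
      (by fun_prop) fun y hy => mk_zero_mem_paramActionDomain hy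
  refine h1.congr fun y hy => ContinuousLinearMap.ext fun Z => ?_
  exact (α.actionPullback_zero_fst hy Z).symm

theorem isClosed_zeroLevel [FiniteDimensional ℝ E] (hα : α.IsSmooth) :
    IsClosed (zeroLevel (F := F) G α) := by
  rw [← isOpen_compl_iff, isOpen_iff_mem_nhds]
  intro x hx
  have h1 : ContinuousOn (fun y => α.localMoment F G x (extChartAt 𝓘(ℝ, E) x y))
      (extChartAt 𝓘(ℝ, E) x).source :=
    (α.contDiffOn_localMoment hα x).continuousOn.comp (continuousOn_extChartAt x)
      (extChartAt 𝓘(ℝ, E) x).mapsTo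
  have h2 := h1.isOpen_inter_preimage (isOpen_extChartAt_source x)
    (isOpen_compl_singleton (x := (0 : F →L[ℝ] ℝ)))
  have h3 : ∀ y ∈ (extChartAt 𝓘(ℝ, E) x).source,
      α.localMoment F G x (extChartAt 𝓘(ℝ, E) x y) = momentMap (F := F) G α y := fun y hy => by
    rw [OneForm.localMoment, (extChartAt 𝓘(ℝ, E) x).left_inv hy]
  have h4 : x ∈ (extChartAt 𝓘(ℝ, E) x).source := mem_extChartAt_source x
  refine Filter.mem_of_superset (h2.mem_nhds ⟨h4, fun h => hx ((h3 x h4).symm.trans h)⟩) ?_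
  exact fun y hy h => hy.2 ((h3 y hy.1).trans h)

theorem differentiableAt_localAction (x : X) :
    DifferentiableAt ℝ (localAction (E := E) F G x) ((0 : F), extChartAt 𝓘(ℝ, E) x x) :=
  ((contDiffOn_localAction (E := E) (F := F) (G := G) x).contDiffAt ((isOpen_paramActionDomain (E := E) (F := F) (G := G) x).mem_nhds
    (mk_zero_mem_paramActionDomain (mem_extChartAt_target x)))).differentiableAt (by simp)

theorem fderiv_localAction_fst (x : X) (Z : F) :
    fderiv ℝ (localAction F G x) ((0 : F), extChartAt 𝓘(ℝ, E) x x) (Z, 0) =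
      vel (E := E) (fun f : F => groupParam G f • x) 0 Z := by
  rw [vel_eq_fderiv (x := x) (by simp)
    (mdifferentiableAt_smul_const (mdifferentiableAt_groupParam zero_mem_groupParamDomain) x)]
  have := (differentiableAt_localAction (E := E) (F := F) (G := G) x).hasFDerivAt.comp (0 : F)
    (hasFDerivAt_prodMk_left (𝕜 := ℝ) (0 : F) (extChartAt 𝓘(ℝ, E) x x))
  have h3 : (localAction F G x ∘ fun f : F => (f, extChartAt 𝓘(ℝ, E) x x)) =
      fun f => extChartAt 𝓘(ℝ, E) x (groupParam G f • x) := by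
    funext f
    simp [localAction, paramAction]
  rw [← h3, this.fderiv]
  rfl

theorem fderiv_localAction_snd (x : X) (w : E) :
    fderiv ℝ (localAction F G x) ((0 : F), extChartAt 𝓘(ℝ, E) x x) (0, w) = w := by
  have h4 := (differentiableAt_localAction (E := E) (F := F) (G := G) x).hasFDerivAt.comp _
    (hasFDerivAt_prodMk_right (𝕜 := ℝ) (0 : F) (extChartAt 𝓘(ℝ, E) x x))
  have h5 : (localAction F G x ∘ fun z : E => ((0 : F), z))
      =ᶠ[𝓝 (extChartAt 𝓘(ℝ, E) x x)] id := by
    filter_upwards [(isOpen_extChartAt_target (I := 𝓘(ℝ, E)) x).mem_nhds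
      (mem_extChartAt_target x)] with z hz
    exact localAction_zero hz
  have h6 := h4.unique ((hasFDerivAt_id _).congr_of_eventuallyEq h5)
  exact DFunLike.congr_fun h6 w

/-- The derivative of the moment map is the contraction of `-dα` with the infinitesimal action. -/
theorem OneForm.d_vel_orbit [FiniteDimensional ℝ E] (hα : α.IsSmooth) (hinv : α.IsInvariant G)
    (x : X) (Z : F) (w : E) :
    α.d x (vel (E := E) (fun f : F => groupParam G f • x) 0 Z) w =
      - fderiv ℝ (α.localMoment F G x) (extChartAt 𝓘(ℝ, E) x x) w Z := by
  set y := extChartAt 𝓘(ℝ, E) x x with hy0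
  have hy : y ∈ (extChartAt 𝓘(ℝ, E) x).target := mem_extChartAt_target x
  have hp : ((0 : F), y) ∈ paramActionDomain F G x := mk_zero_mem_paramActionDomain hy
  have hN := (isOpen_paramActionDomain (E := E) (F := F) (G := G) x).mem_nhds hp
  have hm : ContDiffAt ℝ ∞ (localAction F G x) ((0 : F), y) :=
    (contDiffOn_localAction x).contDiffAt hN
  have hω : ContDiffAt ℝ ∞ (α.inChart x) (localAction F G x ((0 : F), y)) := by
    rw [localAction_zero hy]
    exact (α.contDiffOn_inChart hα x).contDiffAt ((isOpen_extChartAt_target x).mem_nhds hy)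
  have hθ : DifferentiableAt ℝ (α.actionPullback F G x) ((0 : F), y) :=
    ((α.contDiffOn_actionPullback hα x).contDiffAt hN).differentiableAt (by simp)
  have hμ : DifferentiableAt ℝ (α.localMoment F G x) y :=
    ((α.contDiffOn_localMoment hα x).contDiffAt
      ((isOpen_extChartAt_target x).mem_nhds hy)).differentiableAt (by simp)
  have h1 := fderiv_pullback_antisymm (hω.differentiableAt (by simp))
    (hm.of_le (by exact WithTop.coe_le_coe.2 le_top)) (Z, 0) (0, w)
  have h2 := fderiv_localAction_fst (E := E) (G := G) x Z
  have h3 := fderiv_localAction_snd (F := F) (G := G) x w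
  rw [← hy0] at h2 h3
  -- First half of `dθ((Z, 0), (0, w))`, with `θ` the pulled-back form: the component of `θ` along
  -- `w` does not depend on the group parameter, so its derivative along `Z` is zero.
  have h4 : fderiv ℝ (α.actionPullback F G x) ((0 : F), y) (Z, 0) (0, w) = 0 := by
    have h5 : (fun p => α.actionPullback F G x p (0, w)) =ᶠ[𝓝 ((0 : F), y)]
        fun p => α.inChart x p.2 w := by
      filter_upwards [hN] with p hp
      exact hinv.actionPullback_snd hp w
    have hω' : DifferentiableAt ℝ (α.inChart x) y := by
      have := hω.differentiableAt (by simp)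
      rwa [localAction_zero hy] at this
    have h9 : HasFDerivAt (fun p : F × E => α.inChart x p.2)
        ((fderiv ℝ (α.inChart x) y).comp (ContinuousLinearMap.snd ℝ F E)) ((0 : F), y) :=
      HasFDerivAt.comp (g := α.inChart x) ((0 : F), y) hω'.hasFDerivAt hasFDerivAt_snd
    have h6 := h9.clm_apply (hasFDerivAt_const w _)
    have h7 := (hθ.hasFDerivAt.clm_apply (hasFDerivAt_const ((0 : F), w) _)).unique
      (h6.congr_of_eventuallyEq h5)
    have h8 := DFunLike.congr_fun h7 (Z, 0)
    simpa using h8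
  -- Second half: the component along `Z` at parameter `0` is the moment map, here differentiated
  -- along `w`. Naturality of `d` (`h1`) converts the difference into a value of `dα`.
  have h5 : fderiv ℝ (α.actionPullback F G x) ((0 : F), y) (0, w) (Z, 0) =
      fderiv ℝ (α.localMoment F G x) y w Z := by
    have h6 : ((fun p => α.actionPullback F G x p (Z, 0)) ∘ fun z : E => ((0 : F), z))
        =ᶠ[𝓝 y] fun z => α.localMoment F G x z Z := by
      filter_upwards [(isOpen_extChartAt_target (I := 𝓘(ℝ, E)) x).mem_nhds hy] with z hz
      exact α.actionPullback_zero_fst hz Z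
    have h7 := ((hθ.hasFDerivAt.clm_apply (hasFDerivAt_const (Z, (0 : E)) _)).comp y
      (hasFDerivAt_prodMk_right (𝕜 := ℝ) (0 : F) y)).unique
      ((hμ.hasFDerivAt.clm_apply (hasFDerivAt_const Z y)).congr_of_eventuallyEq h6)
    have h8 := DFunLike.congr_fun h7 w
    simpa using h8
  rw [h2, h3, localAction_zero hy] at h1
  change fderiv ℝ (α.actionPullback F G x) ((0 : F), y) (Z, 0) (0, w) -
    fderiv ℝ (α.actionPullback F G x) ((0 : F), y) (0, w) (Z, 0) = _ at h1
  rw [h4, h5, zero_sub] at h1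
  exact h1.symm

end LocalAction

/-! ### Linear contact reduction. -/

section LinearReduction

variable {E F : Type*} [NormedAddCommGroup E] [NormedSpace ℝ E] [FiniteDimensional ℝ E]
  [NormedAddCommGroup F] [NormedSpace ℝ F] [FiniteDimensional ℝ F]

theorem finrank_strongDual : Module.finrank ℝ (F →L[ℝ] ℝ) = Module.finrank ℝ F := by
  rw [← Subspace.dual_finrank_eq (K := ℝ) (V := F)]
  exact (LinearMap.toContinuousLinearMap (𝕜 := ℝ) (E := F) (F' := ℝ)).finrank_eq.symm

theorem exists_eq_eval (f : (F →L[ℝ] ℝ) →ₗ[ℝ] ℝ) : ∃ Z : F, ∀ ξ : F →L[ℝ] ℝ, f ξ = ξ Z := by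
  let ev : F →ₗ[ℝ] Module.Dual ℝ (F →L[ℝ] ℝ) :=
    LinearMap.mk₂ ℝ (fun Z (ξ : F →L[ℝ] ℝ) => ξ Z) (by simp) (by simp) (by simp) (by simp)
  have hinj : Function.Injective ev := by
    rw [injective_iff_map_eq_zero]
    intro Z hZ
    by_contra h
    obtain ⟨ξ, hξ⟩ := SeparatingDual.exists_ne_zero (R := ℝ) h
    exact hξ (DFunLike.congr_fun hZ ξ)
  have hsurj : Function.Surjective ev :=
    (LinearMap.injective_iff_surjective_of_finrank_eq_finrank
      (by rw [Subspace.dual_finrank_eq, finrank_strongDual])).1 hinj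
  obtain ⟨Z, hZ⟩ := hsurj f
  exact ⟨Z, fun ξ => (DFunLike.congr_fun hZ ξ).symm⟩

/-- Linear contact reduction: a splitting of the ambient tangent space into the directions of the
orbit, a complement of these in the kernel of the derivative `D` of the moment map, on which the
form `a` is again a linear contact form, and a complement of this kernel. -/
theorem exists_linear_reduction {a : E →L[ℝ] ℝ} {b : E →L[ℝ] E →L[ℝ] ℝ}
    (hb : ∀ v w, b v w = - b w v)
    (hnd : ∀ v, a v = 0 → (∀ w, a w = 0 → b v w = 0) → v = 0)
    {R : E} (haR : a R = 1) (hbR : ∀ w, b R w = 0)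
    {ζ : F →L[ℝ] E} (hζ : ∀ Z, ζ Z = 0 → Z = 0) (haζ : ∀ Z, a (ζ Z) = 0)
    {D : E →L[ℝ] F →L[ℝ] ℝ} (hD : ∀ Z w, b (ζ Z) w = - D w Z) (hDζ : ∀ Z, D (ζ Z) = 0) :
    Module.finrank ℝ E = 2 * Module.finrank ℝ F + (Module.finrank ℝ E - 2 * Module.finrank ℝ F) ∧
    ∃ Λ : (F × EuclideanSpace ℝ (Fin (Module.finrank ℝ E - 2 * Module.finrank ℝ F)) ×
        (F →L[ℝ] ℝ)) ≃L[ℝ] E,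
      (∀ Z, Λ (Z, 0, 0) = ζ Z) ∧ (∀ p, D (Λ p) = p.2.2) ∧
      (∀ v, a (Λ (0, v, 0)) = 0 →
        (∀ w, a (Λ (0, w, 0)) = 0 → b (Λ (0, v, 0)) (Λ (0, w, 0)) = 0) → v = 0) ∧
      ∃ v, a (Λ (0, v, 0)) ≠ 0 := by
  -- If the range were proper, a nonzero functional would vanish on it. It is evaluation at some
  -- `Z`, so `b (ζ Z) = 0` and `a (ζ Z) = 0`; nondegeneracy gives `ζ Z = 0`, hence `Z = 0`.
  have hsurj : LinearMap.range D.toLinearMap = ⊤ := by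
    by_contra h
    obtain ⟨f, hf, hle⟩ := Submodule.exists_le_ker_of_lt_top _ (lt_top_iff_ne_top.2 h)
    obtain ⟨Z, hZ⟩ := exists_eq_eval f
    refine hf (LinearMap.ext fun ξ => ?_)
    have h1 : ζ Z = 0 := hnd _ (haζ Z) fun w _ => by
      rw [hD, ← hZ]
      have : D.toLinearMap w ∈ LinearMap.ker f := hle ⟨w, rfl⟩
      simpa using this
    rw [hZ, hζ Z h1]
    simp
  obtain ⟨τ, hτ⟩ := LinearMap.exists_rightInverse_of_surjective D.toLinearMap hsurj
  have hτ' : ∀ ξ, D (τ ξ) = ξ := fun ξ => DFunLike.congr_fun hτ ξ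
  set T := LinearMap.ker D.toLinearMap with hT
  let ζT : F →ₗ[ℝ] T := ζ.toLinearMap.codRestrict T fun Z => hDζ Z
  have hζT : Function.Injective ζT := by
    rw [injective_iff_map_eq_zero]
    exact fun Z hZ => hζ Z (congrArg Subtype.val hZ)
  -- `K'` models the tangent space of the quotient: the kernel of `D` modulo orbit directions. One
  -- copy of `dim F` is lost to `D`, the other to the orbit.
  obtain ⟨K', hK'⟩ := (LinearMap.range ζT).exists_isCompl
  have hd1 : Module.finrank ℝ F + Module.finrank ℝ T = Module.finrank ℝ E := by
    rw [← LinearMap.finrank_range_add_finrank_ker D.toLinearMap, hsurj, finrank_top,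
      finrank_strongDual]
  have hd2 : Module.finrank ℝ F + Module.finrank ℝ K' = Module.finrank ℝ T := by
    rw [← Submodule.finrank_add_eq_of_isCompl hK', LinearMap.finrank_range_of_inj hζT]
  have hdim : Module.finrank ℝ E =
    2 * Module.finrank ℝ F + (Module.finrank ℝ E - 2 * Module.finrank ℝ F) := by omega
  refine ⟨hdim, ?_⟩
  generalize hκ : Module.finrank ℝ E - 2 * Module.finrank ℝ F = κ at hdim
  let j0 : EuclideanSpace ℝ (Fin κ) ≃ₗ[ℝ] K' :=
    LinearEquiv.ofFinrankEq _ _ (by rw [finrank_euclideanSpace_fin]; omega)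
  let j : EuclideanSpace ℝ (Fin κ) →ₗ[ℝ] E := T.subtype ∘ₗ K'.subtype ∘ₗ j0.toLinearMap
  have hDj : ∀ k, D (j k) = 0 := fun k => (j0 k : T).2
  let Λ0 : (F × EuclideanSpace ℝ (Fin κ) × (F →L[ℝ] ℝ)) →ₗ[ℝ] E :=
    ζ.toLinearMap.coprod (j.coprod τ)
  have hΛ0 : ∀ p, Λ0 p = ζ p.1 + (j p.2.1 + τ p.2.2) := fun p => rfl
  have hDΛ : ∀ p, D (Λ0 p) = p.2.2 := fun p => by
    rw [hΛ0, map_add, map_add, hDζ, hDj, hτ', zero_add, zero_add]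
  have hinj : Function.Injective Λ0 := by
    rw [injective_iff_map_eq_zero]
    rintro ⟨Z, k, ξ⟩ h
    have h1 : ξ = 0 := by simpa [h] using (hDΛ (Z, k, ξ)).symm
    subst h1
    have h2 : ζT Z + (j0 k : T) = 0 := by
      have h' : ζ Z + j k = 0 := by simpa [hΛ0] using h
      exact Subtype.ext h'
    have h3 : (j0 k : T) = 0 := by
      refine (Submodule.disjoint_def.1 hK'.disjoint) _ ?_ (j0 k).2
      rw [← neg_eq_of_add_eq_zero_right h2]
      exact Submodule.neg_mem _ ⟨Z, rfl⟩
    have h4 : k = 0 := by simpa using h3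
    have h5 : Z = 0 := hζT (by rw [map_zero]; simpa [h3] using h2)
    rw [h4, h5]; rfl
  let Λ := (LinearMap.linearEquivOfInjective Λ0 hinj (by
    rw [Module.finrank_prod, Module.finrank_prod, finrank_strongDual, finrank_euclideanSpace_fin]
    omega)).toContinuousLinearEquiv
  have hΛ : ∀ p, Λ p = Λ0 p := fun p => rfl
  have hΛj : ∀ k, Λ (0, k, 0) = j k := fun k => by simp [hΛ, hΛ0]
  have hdecomp : ∀ u, D u = 0 → ∃ Z k, u = ζ Z + j k := fun u hu => by
    obtain ⟨⟨Z, k, ξ⟩, rfl⟩ := Λ.surjective u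
    rw [hΛ, hDΛ] at hu
    refine ⟨Z, k, ?_⟩
    simp only at hu
    simp [hΛ, hΛ0, hu]
  -- The Reeb vector is tangent to the level, so modulo orbit directions it gives a vector `k0` of
  -- the complement with `a (j k0) = 1`.
  have hDR : D R = 0 := ContinuousLinearMap.ext fun Z => by
    have := hD Z R
    rw [hb, hbR] at this
    simpa using this.symm
  obtain ⟨Z0, k0, hR⟩ := hdecomp R hDR
  have hak0 : a (j k0) = 1 := by
    rw [← haR, hR, map_add, haζ, zero_add]
  have hbζ : ∀ k Z, b (j k) (ζ Z) = 0 := fun k Z => by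
    rw [hb, hD, hDj]; simp
  refine ⟨Λ, fun Z => by simp [hΛ, hΛ0], fun p => hDΛ p, fun v hv hvw => ?_, k0, ?_⟩
  · simp only [hΛj] at hv hvw
    -- As `b` annihilates `R` and pairs `j v` trivially with orbit directions, orthogonality of `j
    -- v` to `ker a` in the complement extends along `k0` to the whole complement, and then to `ker
    -- D`.
    have h1 : b (j v) (j k0) = 0 := by
      have : b (j v) R = 0 := by rw [hb, hbR, neg_zero]
      rwa [hR, map_add, hbζ, zero_add] at this
    have h2 : ∀ k, b (j v) (j k) = 0 := fun k => by
      have h3 := hvw (k - a (j k) • k0) (by simp [hak0])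
      simpa [h1] using h3
    have h3 : ∀ u, D u = 0 → b (j v) u = 0 := fun u hu => by
      obtain ⟨Z, k, rfl⟩ := hdecomp u hu
      rw [map_add, hbζ, h2, add_zero]
    -- Vanishing on `ker D`, `b (j v)` factors through `D`, so it equals `w ↦ D w Z`, which is `-b
    -- (ζ Z)`. Then `j v + ζ Z` is in the kernel of both `a` and `b`, hence zero, and directness of
    -- the sum gives `v = 0`.
    obtain ⟨Z, hZ⟩ := exists_eq_eval ((b (j v)).toLinearMap ∘ₗ τ)
    have h4 : ∀ w, b (j v + ζ Z) w = 0 := fun w => by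
      have h5 := h3 (w - τ (D w)) (by rw [map_sub, hτ', sub_self])
      have h6 : b (j v) (τ (D w)) = D w Z := hZ (D w)
      rw [map_sub, h6, sub_eq_zero] at h5
      rw [map_add, add_apply, hD, h5, add_neg_cancel]
    have h5 : j v + ζ Z = 0 := hnd _ (by rw [map_add, hv, haζ, add_zero]) fun w _ => h4 w
    have h6 : Λ0 (Z, v, 0) = 0 := by
      rw [hΛ0, ← h5]; simp [add_comm]
    have h7 := hinj (h6.trans (map_zero Λ0).symm)
    exact congrArg (fun p => p.2.1) h7
  · rw [hΛj, hak0]; exact one_ne_zero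

end LinearReduction

/-! ### Consequences of properness. -/

section Proper

variable {E F : Type*} [NormedAddCommGroup E] [NormedSpace ℝ E] [FiniteDimensional ℝ E]
  [NormedAddCommGroup F] [NormedSpace ℝ F]
  {G : Type*} [Group G] [TopologicalSpace G] [ChartedSpace F G] [LieGroup 𝓘(ℝ, F) ∞ G]
  {X : Type*} [TopologicalSpace X] [ChartedSpace E X] [IsManifold 𝓘(ℝ, E) ∞ X] [MulAction G X]
  [hGX : ContMDiffSMul 𝓘(ℝ, F) 𝓘(ℝ, E) ∞ G X] {α : OneForm E X}

/-- The map `(g, c) ↦ (c, g • c)` on the zero level of the moment map. -/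
def shearMap (hinv : α.IsInvariant G) (p : G × zeroLevel (F := F) G α) :
    zeroLevel (F := F) G α × zeroLevel (F := F) G α :=
  (p.2, ⟨p.1 • (p.2 : X), hinv.smul_mem_zeroLevel p.1 p.2.2⟩)

/-- The level is closed in `X`, hence locally compact Hausdorff; for maps into such a space,
continuity and compact preimages of compact sets amount to properness. In particular the shear map
is closed. -/
theorem isProperMap_shearMap [T2Space X] (hα : α.IsSmooth) (hinv : α.IsInvariant G)
    (hproper : ActsProperlyOnZeroLevel (F := F) G α) :
    IsProperMap (shearMap (F := F) hinv) := by
  have hlc : LocallyCompactSpace X := ChartedSpace.locallyCompactSpace E X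
  have hC : IsClosed (zeroLevel (F := F) G α) := isClosed_zeroLevel hα
  have hlc' : LocallyCompactSpace (zeroLevel (F := F) G α) :=
    hC.isClosedEmbedding_subtypeVal.locallyCompactSpace
  rw [isProperMap_iff_isCompact_preimage]
  refine ⟨?_, fun K hK => ?_⟩
  · refine continuous_snd.prodMk (Continuous.subtype_mk ?_ _)
    exact hGX.contMDiff_smul.continuous.comp
      (continuous_fst.prodMk (continuous_subtype_val.comp continuous_snd))
  · have hind : IsInducing (Prod.map id Subtype.val : G × zeroLevel (F := F) G α → G × X) :=
      IsInducing.id.prodMap IsInducing.subtypeVal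
    rw [hind.isCompact_iff]
    have h1 := hproper (Prod.map Subtype.val Subtype.val '' K)
      (by rintro _ ⟨p, -, rfl⟩; exact ⟨p.1.2, p.2.2⟩)
      (hK.image (continuous_subtype_val.prodMap continuous_subtype_val))
    convert h1 using 1
    ext ⟨g, y⟩
    constructor
    · rintro ⟨⟨g, c⟩, h, rfl, rfl⟩
      exact ⟨_, h, rfl⟩
    · rintro ⟨⟨c, c'⟩, h, h2⟩
      simp only [Prod.map_apply, Prod.mk.injEq] at h2
      refine ⟨(g, c), ?_, by simp [h2.1]⟩
      have : shearMap hinv (g, c) = (c, c') :=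
        Prod.ext rfl (Subtype.ext (by simp [shearMap, h2.1, h2.2]))
      rwa [mem_preimage, this]

/-- The shear map sends the pairs `(g, c)` with `g` outside an open neighbourhood of `1` to a closed
set, which misses `(x, x)` because the stabilizer is trivial. Any `O` whose square over the level
avoids this set will do. -/
theorem exists_nhds_forall_smul_eq [T2Space X] (hα : α.IsSmooth) (hinv : α.IsInvariant G)
    (hproper : ActsProperlyOnZeroLevel (F := F) G α) {x : X} (hxC : x ∈ zeroLevel (F := F) G α)
    (hx : ∀ g : G, g • x = x → g = 1) {W : Set G} (hW : W ∈ 𝓝 (1 : G)) :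
    ∃ O : Set X, IsOpen O ∧ x ∈ O ∧ ∀ c ∈ O, c ∈ zeroLevel (F := F) G α → ∀ h : G, h • c ∈ O →
      h ∈ W := by
  obtain ⟨W', hW', hWo, h1⟩ := mem_nhds_iff.1 hW
  have hcl : IsClosed (shearMap (F := F) hinv '' (W'ᶜ ×ˢ univ)) :=
    (isProperMap_shearMap hα hinv hproper).isClosedMap _ (hWo.isClosed_compl.prod isClosed_univ)
  have hmem : ((⟨x, hxC⟩, ⟨x, hxC⟩) : zeroLevel (F := F) G α × zeroLevel (F := F) G α) ∈
      (shearMap (F := F) hinv '' (W'ᶜ ×ˢ univ))ᶜ := by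
    rintro ⟨⟨g, c⟩, ⟨hg, -⟩, h⟩
    obtain ⟨h2, h3⟩ := Prod.ext_iff.1 h
    have h4 : c = ⟨x, hxC⟩ := h2
    subst h4
    exact hg (by rw [hx g (congrArg Subtype.val h3)]; exact h1)
  obtain ⟨u, v, hu, hxu, hv, hxv, huv⟩ := mem_nhds_prod_iff'.1 (hcl.isOpen_compl.mem_nhds hmem)
  obtain ⟨O, hO, hOuv⟩ := isOpen_induced_iff.1 (hu.inter hv)
  refine ⟨O, hO, (show (⟨x, hxC⟩ : zeroLevel (F := F) G α) ∈ Subtype.val ⁻¹' O from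
    hOuv ▸ ⟨hxu, hxv⟩), fun c hc hcC h hhc => ?_⟩
  have h5 : (⟨c, hcC⟩ : zeroLevel (F := F) G α) ∈ u ∩ v := hOuv ▸ hc
  have h6 : (⟨h • c, hinv.smul_mem_zeroLevel h hcC⟩ : zeroLevel (F := F) G α) ∈ u ∩ v :=
    hOuv ▸ hhc
  by_contra hW2
  exact huv (mk_mem_prod h5.1 h6.2) ⟨(h, ⟨c, hcC⟩), ⟨fun h7 => hW2 (hW' h7), mem_univ _⟩, rfl⟩

end Proper

/-! ### Infinitesimal slices. -/

section Slice

variable {E F : Type*} [NormedAddCommGroup E] [NormedSpace ℝ E] [FiniteDimensional ℝ E]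
  [NormedAddCommGroup F] [NormedSpace ℝ F]
  {G : Type*} [Group G] [TopologicalSpace G] [ChartedSpace F G] [LieGroup 𝓘(ℝ, F) ∞ G]
  {X : Type*} [TopologicalSpace X] [ChartedSpace E X] [IsManifold 𝓘(ℝ, E) ∞ X] [MulAction G X]
  [hGX : ContMDiffSMul 𝓘(ℝ, F) 𝓘(ℝ, E) ∞ G X] {α : OneForm E X}

/-- The orbit of `x` stays in the zero level, so the moment map is constant along it. -/
theorem OneForm.fderiv_localMoment_vel_orbit (hα : α.IsSmooth) (hinv : α.IsInvariant G) {x : X}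
    (hxC : x ∈ zeroLevel (F := F) G α) (Z : F) :
    fderiv ℝ (α.localMoment F G x) (extChartAt 𝓘(ℝ, E) x x)
      (vel (E := E) (fun f : F => groupParam G f • x) 0 Z) = 0 := by
  have hmd := mdifferentiableAt_smul_const (E := E)
    (mdifferentiableAt_groupParam (G := G) (zero_mem_groupParamDomain (F := F))) x
  have h0 : extChartAt 𝓘(ℝ, E) x (groupParam G (0 : F) • x) = extChartAt 𝓘(ℝ, E) x x := by simp
  have h1 : IsManifold 𝓘(ℝ, E) 1 X := IsManifold.of_le (n := ∞) (by simp)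
  have hd : DifferentiableAt ℝ (fun f : F => extChartAt 𝓘(ℝ, E) x (groupParam G f • x)) 0 :=
    ((mdifferentiableAt_extChartAt (I := 𝓘(ℝ, E)) (x := x)
      (y := groupParam G (0 : F) • x) (by simp)).comp (0 : F) hmd).differentiableAt
  have hμ : DifferentiableAt ℝ (α.localMoment F G x)
      (extChartAt 𝓘(ℝ, E) x (groupParam G (0 : F) • x)) := by
    rw [h0]
    exact ((α.contDiffOn_localMoment hα x).contDiffAt ((isOpen_extChartAt_target x).mem_nhds
      (mem_extChartAt_target x))).differentiableAt (by simp)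
  have h2 : (fun f : F => α.localMoment F G x (extChartAt 𝓘(ℝ, E) x (groupParam G f • x)))
      =ᶠ[𝓝 0] fun _ => 0 := by
    have h3 : (chartAt E x).source ∈ 𝓝 (groupParam G (0 : F) • x) :=
      (chartAt E x).open_source.mem_nhds (by simp)
    filter_upwards [hmd.continuousAt h3] with f hf
    rw [OneForm.localMoment, (extChartAt 𝓘(ℝ, E) x).left_inv (by simpa using hf)]
    exact hinv.smul_mem_zeroLevel _ hxC
  have h5 := HasFDerivAt.comp (g := α.localMoment F G x) (0 : F) hμ.hasFDerivAt hd.hasFDerivAt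
  have h4 := h5.unique ((hasFDerivAt_const (0 : F →L[ℝ] ℝ) (0 : F)).congr_of_eventuallyEq h2)
  rw [vel_eq_fderiv (x := x) (by simp) hmd, ← h0]
  exact DFunLike.congr_fun h4 Z

variable [FiniteDimensional ℝ F]

variable (E F) in
/-- The dimension of the reduced space. -/
abbrev reducedDim : ℕ := Module.finrank ℝ E - 2 * Module.finrank ℝ F

variable (E F) in
/-- The model space of the reduced space. -/
abbrev ReducedModel : Type := EuclideanSpace ℝ (Fin (reducedDim E F))

/-- The linear data of the infinitesimal reduction at a point of the zero level. -/
theorem exists_linear_slice (hα : α.IsContact) (hinv : α.IsInvariant G)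
    (hR : ∀ x, ∃ R : E, α.ev x R = 1 ∧ ∀ w : E, α.d x R w = 0) {x : X}
    (hxC : x ∈ zeroLevel (F := F) G α) (hx : ∀ g : G, g • x = x → g = 1) :
    Module.finrank ℝ E = 2 * Module.finrank ℝ F + reducedDim E F ∧
    ∃ Λ : (F × ReducedModel E F × (F →L[ℝ] ℝ)) ≃L[ℝ] E,
      (∀ Z, Λ (Z, 0, 0) = vel (E := E) (fun f : F => groupParam G f • x) 0 Z) ∧
      (∀ Z, α.ev x (Λ (Z, 0, 0)) = 0) ∧
      (∀ p, fderiv ℝ (α.localMoment F G x) (extChartAt 𝓘(ℝ, E) x x) (Λ p) = p.2.2) ∧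
      (∀ v, α.ev x (Λ (0, v, 0)) = 0 →
        (∀ w, α.ev x (Λ (0, w, 0)) = 0 → α.d x (Λ (0, v, 0)) (Λ (0, w, 0)) = 0) → v = 0) ∧
      ∃ v, α.ev x (Λ (0, v, 0)) ≠ 0 := by
  obtain ⟨R, hR1, hR2⟩ := hR x
  set y := extChartAt 𝓘(ℝ, E) x x with hy
  let b : E →L[ℝ] E →L[ℝ] ℝ := fderiv ℝ (α.inChart x) y - (fderiv ℝ (α.inChart x) y).flip
  have hbd : ∀ v w : E, b v w = α.d x v w := fun v w => rfl
  let a : E →L[ℝ] ℝ := α x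
  have hmd := mdifferentiableAt_smul_const (E := E)
    (mdifferentiableAt_groupParam (G := G) (zero_mem_groupParamDomain (F := F))) x
  have hζ : ∀ Z : F, fderiv ℝ (fun f : F => extChartAt 𝓘(ℝ, E) x (groupParam G f • x)) 0 Z =
      vel (E := E) (fun f : F => groupParam G f • x) 0 Z := fun Z =>
    (vel_eq_fderiv (x := x) (by simp) hmd Z).symm
  have haζ : ∀ Z : F, α.ev x (vel (E := E) (fun f : F => groupParam G f • x) 0 Z) = 0 :=
    fun Z => by
      rw [← momentMap_eq]
      exact DFunLike.congr_fun hxC Z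
  obtain ⟨h1, Λ, h2, h3, h4, h5⟩ := exists_linear_reduction (a := a) (b := b)
    (fun v w => by simp [b])
    (fun v hv hvw => hα.nondegenerate x v hv hvw) hR1 hR2
    (ζ := fderiv ℝ (fun f : F => extChartAt 𝓘(ℝ, E) x (groupParam G f • x)) 0)
    (fun Z hZ => vel_orbit_injective hx (by rw [← hζ, hZ]))
    (fun Z => by rw [hζ]; exact haζ Z)
    (D := fderiv ℝ (α.localMoment F G x) y)
    (fun Z w => by rw [hζ, hbd]; exact OneForm.d_vel_orbit hα.smooth hinv x Z w)
    (fun Z => by rw [hζ]; exact OneForm.fderiv_localMoment_vel_orbit hα.smooth hinv hxC Z)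
  exact ⟨h1, Λ, fun Z => (h2 Z).trans (hζ Z), fun Z => by rw [h2, hζ]; exact haζ Z, h3, h4, h5⟩

end Slice

/-! ### Charts adapted to the action and to the moment map. -/

section Slice

variable {E F : Type*} [NormedAddCommGroup E] [NormedSpace ℝ E] [FiniteDimensional ℝ E]
  [NormedAddCommGroup F] [NormedSpace ℝ F] [FiniteDimensional ℝ F]
  {G : Type*} [Group G] [TopologicalSpace G] [ChartedSpace F G] [LieGroup 𝓘(ℝ, F) ∞ G]
  {X : Type*} [TopologicalSpace X] [ChartedSpace E X] [IsManifold 𝓘(ℝ, E) ∞ X] [MulAction G X]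
  [hGX : ContMDiffSMul 𝓘(ℝ, F) 𝓘(ℝ, E) ∞ G X] {α : OneForm E X}

variable (E F) in
/-- The target of a slice chart: orbit directions, directions of the reduced space, and values of
the moment map. -/
abbrev SliceModel : Type _ := F × ReducedModel E F × (F →L[ℝ] ℝ)

/-- A chart adapted to the action and to the zero level near a point of the zero level, before
restricting to a domain on which orbits are connected. -/
theorem exists_preslice (hα : α.IsSmooth) (hinv : α.IsInvariant G)
    {x : X} (hxC : x ∈ zeroLevel (F := F) G α)
    (Λ : SliceModel E F ≃L[ℝ] E)
    (hΛζ : ∀ Z, Λ (Z, 0, 0) = vel (E := E) (fun f : F => groupParam G f • x) 0 Z)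
    (hΛμ : ∀ p, fderiv ℝ (α.localMoment F G x) (extChartAt 𝓘(ℝ, E) x x) (Λ p) = p.2.2) :
    ∃ Θ : OpenPartialHomeomorph X (SliceModel E F), x ∈ Θ.source ∧ Θ x = 0 ∧
      ContMDiffOn 𝓘(ℝ, E) 𝓘(ℝ, SliceModel E F) ∞ Θ Θ.source ∧
      ContMDiffOn 𝓘(ℝ, SliceModel E F) 𝓘(ℝ, E) ∞ Θ.symm Θ.target ∧
      (∀ p ∈ Θ.target, p.1 ∈ groupParamDomain F G) ∧
      (∃ σ : ReducedModel E F × (F →L[ℝ] ℝ) → X,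
        ∀ p ∈ Θ.target, Θ.symm p = groupParam G p.1 • σ p.2) ∧
      (∀ p ∈ Θ.target, Θ.symm p ∈ zeroLevel (F := F) G α ↔ p.2.2 = 0) ∧
      ∀ v, vel (E := E) Θ.symm 0 v = Λ v := by
  set y := extChartAt 𝓘(ℝ, E) x x with hy
  have hyt : y ∈ (extChartAt 𝓘(ℝ, E) x).target := mem_extChartAt_target x
  -- the transversal affine slice
  let s : ReducedModel E F × (F →L[ℝ] ℝ) →L[ℝ] E :=
    (Λ : SliceModel E F →L[ℝ] E).comp (ContinuousLinearMap.inr ℝ F _)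
  have hs : ∀ q, s q = Λ (0, q) := fun q => rfl
  -- flowing out the slice
  let A : SliceModel E F → F × E := fun p => (p.1, y + s p.2)
  have hA : ContDiff ℝ ∞ A := by fun_prop
  have hA' : HasFDerivAt A ((ContinuousLinearMap.fst ℝ F _).prod
      (s.comp (ContinuousLinearMap.snd ℝ F _))) 0 := by
    refine hasFDerivAt_fst.prodMk ?_
    exact ((s.comp (ContinuousLinearMap.snd ℝ F _)).hasFDerivAt).const_add y
  have hA0 : A 0 = (0, y) := by simp [A]
  have hU : IsOpen (A ⁻¹' paramActionDomain F G x) :=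
    (isOpen_paramActionDomain x).preimage hA.continuous
  have hU0 : (0 : SliceModel E F) ∈ A ⁻¹' paramActionDomain F G x := by
    rw [mem_preimage, hA0]; exact mk_zero_mem_paramActionDomain hyt
  have hΨ : ContDiffOn ℝ ∞ (fun p => localAction F G x (A p)) (A ⁻¹' paramActionDomain F G x) :=
    (contDiffOn_localAction x).comp hA.contDiffOn fun p hp => hp
  -- At `(0, y)` the action has derivative `(Z, w) ↦ ζ Z + w`, with `ζ` the infinitesimal action. By
  -- `hΛζ` the first summand is `Λ` on orbit directions, and the slice was chosen to supply the rest
  -- of `Λ`.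
  have hΨ' : HasFDerivAt (fun p => localAction F G x (A p)) (Λ : SliceModel E F →L[ℝ] E) 0 := by
    have h1 : HasFDerivAt (localAction F G x) (fderiv ℝ (localAction F G x) (0, y)) (A 0) := by
      rw [hA0]; exact (differentiableAt_localAction x).hasFDerivAt
    refine (h1.comp (0 : SliceModel E F) hA').congr_fderiv (ContinuousLinearMap.ext fun p => ?_)
    have h2 : ((p.1, s p.2) : F × E) = (p.1, 0) + (0, s p.2) := by simp
    have h3 : p = (p.1, 0, 0) + (0, p.2) :=
      Prod.ext (add_zero p.1).symm (zero_add p.2).symm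
    change fderiv ℝ (localAction F G x) (0, y) (p.1, s p.2) = Λ p
    rw [h2, map_add, fderiv_localAction_fst, fderiv_localAction_snd, ← hΛζ, hs, ← map_add]
    exact congrArg Λ h3.symm
  obtain ⟨e1, he10, he1U, he1, he1s, he1s'⟩ := exists_localDiffeo hU hU0 hΨ hΨ'
  -- straightening the moment map
  let H : ReducedModel E F × (F →L[ℝ] ℝ) → ReducedModel E F × (F →L[ℝ] ℝ) :=
    fun q => (q.1, α.localMoment F G x (y + s q))
  have hV : IsOpen ((fun q => y + s q) ⁻¹' (extChartAt 𝓘(ℝ, E) x).target) :=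
    (isOpen_extChartAt_target x).preimage (by fun_prop)
  have hV0 : 0 ∈ (fun q => y + s q) ⁻¹' (extChartAt 𝓘(ℝ, E) x).target := by
    simp [hy]
  have hH : ContDiffOn ℝ ∞ H ((fun q => y + s q) ⁻¹' (extChartAt 𝓘(ℝ, E) x).target) := by
    refine contDiff_fst.contDiffOn.prodMk ?_
    refine (α.contDiffOn_localMoment hα x).comp (ContDiff.contDiffOn ?_) fun q hq => hq
    fun_prop
  -- By `hΛμ` the moment map along the slice has derivative `q ↦ q.2`, so `H` is tangent to the
  -- identity.
  have hH' : HasFDerivAt H ((ContinuousLinearEquiv.refl ℝ (ReducedModel E F × (F →L[ℝ] ℝ)) :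
      _ ≃L[ℝ] _) : _ →L[ℝ] _) 0 := by
    have h1 : HasFDerivAt (α.localMoment F G x) (fderiv ℝ (α.localMoment F G x) y) (y + s 0) := by
      rw [map_zero, add_zero]
      exact (((α.contDiffOn_localMoment hα x).contDiffAt
        ((isOpen_extChartAt_target x).mem_nhds hyt)).differentiableAt (by simp)).hasFDerivAt
    have h2 : HasFDerivAt (fun q => y + s q) s 0 := s.hasFDerivAt.const_add y
    refine (hasFDerivAt_fst.prodMk (HasFDerivAt.comp (g := α.localMoment F G x) 0 h1 h2)).congr_fderiv
      (ContinuousLinearMap.ext fun q => ?_)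
    exact Prod.ext rfl (hΛμ (0, q))
  obtain ⟨e2, he20, he2V, he2, he2s, he2s'⟩ := exists_localDiffeo hV hV0 hH hH'
  have he2H : ⇑e2 = H := funext he2
  have hH0 : H 0 = 0 := by
    refine Prod.ext rfl ?_
    simp only [H, map_zero, add_zero]
    rw [OneForm.localMoment, hy, extChartAt_to_inv]
    exact hxC
  have he20' : (0 : ReducedModel E F × (F →L[ℝ] ℝ)) ∈ e2.target := by
    have := e2.map_source he20
    rwa [he2, hH0] at this
  have he2symm0 : e2.symm 0 = 0 := by
    have := e2.left_inv he20
    rwa [he2, hH0] at this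
  have he1zero : e1 0 = y := by
    rw [he1, hA0, localAction_zero hyt]
  have he1y : y ∈ e1.target := by
    have := e1.map_source he10
    rwa [he1zero] at this
  have he1symm : e1.symm y = 0 := by
    rw [← he1zero, e1.left_inv he10]
  let Θ : OpenPartialHomeomorph X (SliceModel E F) :=
    (chartAt E x).trans (e1.symm.trans ((OpenPartialHomeomorph.refl F).prod e2))
  have hsource : ∀ z, z ∈ Θ.source ↔ z ∈ (chartAt E x).source ∧ chartAt E x z ∈ e1.target ∧
      (e1.symm (chartAt E x z)).2 ∈ e2.source := fun z => by
    simp [Θ]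
  have htarget : ∀ p, p ∈ Θ.target ↔ p.2 ∈ e2.target ∧ (p.1, e2.symm p.2) ∈ e1.source ∧
      e1 (p.1, e2.symm p.2) ∈ (chartAt E x).target := fun p => by
    simp [Θ, and_assoc]
  have hcoe : ∀ z, Θ z = ((e1.symm (chartAt E x z)).1, e2 (e1.symm (chartAt E x z)).2) :=
    fun z => rfl
  have hsymm : ∀ p, Θ.symm p = (chartAt E x).symm (e1 (p.1, e2.symm p.2)) := fun p => rfl
  have hxs : x ∈ Θ.source := (hsource x).2 ⟨mem_chart_source E x, he1y, by
    have : e1.symm (chartAt E x x) = 0 := he1symm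
    rw [this]; exact he20⟩
  have hΘx : Θ x = 0 := by
    have : e1.symm (chartAt E x x) = 0 := he1symm
    rw [hcoe, this]
    exact Prod.ext rfl ((he2 0).trans hH0)
  have hΘ0 : (0 : SliceModel E F) ∈ Θ.target := hΘx ▸ Θ.map_source hxs
  have hΘ0x : Θ.symm 0 = x := by rw [← hΘx, Θ.left_inv hxs]
  have hsmooth : ContMDiffOn 𝓘(ℝ, E) 𝓘(ℝ, SliceModel E F) ∞ Θ Θ.source := by
    have h1 : ContDiffOn ℝ ∞ (fun z => ((e1.symm z).1, e2 (e1.symm z).2))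
        (e1.target ∩ e1.symm ⁻¹' {q | q.2 ∈ e2.source}) := by
      have h2 := he1s'.mono (inter_subset_left (t := e1.symm ⁻¹' {q | q.2 ∈ e2.source}))
      exact (contDiff_fst.comp_contDiffOn h2).prodMk
        (he2s.comp (contDiff_snd.comp_contDiffOn h2) fun z hz => hz.2)
    rw [← contMDiffOn_iff_contDiffOn] at h1
    exact h1.comp ((contMDiffOn_chart (I := 𝓘(ℝ, E)) (x := x)).mono
      fun z hz => ((hsource z).1 hz).1) fun z hz => ((hsource z).1 hz).2
  have hsmooth' : ContMDiffOn 𝓘(ℝ, SliceModel E F) 𝓘(ℝ, E) ∞ Θ.symm Θ.target := by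
    have h1 : ContDiffOn ℝ ∞ (fun p : SliceModel E F => (p.1, e2.symm p.2)) Θ.target :=
      contDiff_fst.contDiffOn.prodMk
        (he2s'.comp contDiff_snd.contDiffOn fun p hp => ((htarget p).1 hp).1)
    have h2 := he1s.comp h1 fun p hp => ((htarget p).1 hp).2.1
    rw [← contMDiffOn_iff_contDiffOn] at h2
    exact (contMDiffOn_chart_symm (I := 𝓘(ℝ, E)) (x := x)).comp h2
      fun p hp => ((htarget p).1 hp).2.2
  have hσ : ∀ p ∈ Θ.target, Θ.symm p =
      groupParam G p.1 • (extChartAt 𝓘(ℝ, E) x).symm (y + s (e2.symm p.2)) := fun p hp => by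
    have h1 := he1U ((htarget p).1 hp).2.1
    rw [hsymm, he1]
    exact (chartAt E x).left_inv h1.2
  refine ⟨Θ, hxs, hΘx, hsmooth, hsmooth', fun p hp => (he1U ((htarget p).1 hp).2.1).1.1,
    ⟨fun q => (extChartAt 𝓘(ℝ, E) x).symm (y + s (e2.symm q)), hσ⟩, fun p hp => ?_, fun v => ?_⟩
  -- The level is invariant, so membership is decided on the transversal, where the second component
  -- of `H` is the moment map.
  · rw [hσ p hp, hinv.smul_mem_zeroLevel_iff]
    have h1 : (H (e2.symm p.2)).2 = p.2.2 := by
      rw [← he2, e2.right_inv ((htarget p).1 hp).1]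
    rw [← h1]
    rfl
  · have hmd : MDifferentiableAt 𝓘(ℝ, SliceModel E F) 𝓘(ℝ, E) Θ.symm 0 :=
      (hsmooth'.contMDiffAt (Θ.open_target.mem_nhds hΘ0)).mdifferentiableAt (by simp)
    rw [vel_eq_fderiv hΘ0x hmd]
    -- The straightening has identity derivative at `0`, so it leaves the derivative `Λ` unchanged.
    have h1 : HasFDerivAt e2.symm _ 0 := e2.hasFDerivAt_symm he20' (by
      rw [he2symm0, he2H]; exact hH')
    have h2 : HasFDerivAt (fun p : SliceModel E F => (p.1, e2.symm p.2)) _ 0 :=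
      hasFDerivAt_fst.prodMk (HasFDerivAt.comp (g := e2.symm) (0 : SliceModel E F) h1
        hasFDerivAt_snd)
    have h3 : HasFDerivAt e1 (Λ : SliceModel E F →L[ℝ] E) ((0 : SliceModel E F).1,
        e2.symm (0 : SliceModel E F).2) := by
      have : ((0 : SliceModel E F).1, e2.symm (0 : SliceModel E F).2) = 0 :=
        Prod.ext rfl he2symm0
      rw [this, funext he1]
      exact hΨ'
    have h4 := HasFDerivAt.comp (g := e1) (0 : SliceModel E F) h3 h2
    have h5 : (fun p => extChartAt 𝓘(ℝ, E) x (Θ.symm p)) =ᶠ[𝓝 0]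
        fun p => e1 (p.1, e2.symm p.2) := by
      filter_upwards [Θ.open_target.mem_nhds hΘ0] with p hp
      exact (chartAt E x).right_inv ((htarget p).1 hp).2.2
    rw [h5.fderiv_eq]
    refine (DFunLike.congr_fun h4.fderiv v).trans ?_
    rfl

end Slice

theorem groupParam_image_mem_nhds {F G : Type*} [NormedAddCommGroup F] [NormedSpace ℝ F] [Group G]
    [TopologicalSpace G] [ChartedSpace F G] {A : Set F} (hA : IsOpen A) (h0 : (0 : F) ∈ A) :
    groupParam G '' A ∈ 𝓝 (1 : G) := by
  have h1 : ContinuousOn (fun h : G => extChartAt 𝓘(ℝ, F) (1 : G) h - extChartAt 𝓘(ℝ, F) (1 : G) 1)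
      (extChartAt 𝓘(ℝ, F) (1 : G)).source :=
    (continuousOn_extChartAt (1 : G)).sub continuousOn_const
  have h2 := (h1.isOpen_inter_preimage (isOpen_extChartAt_source (1 : G)) hA).mem_nhds
    (x := 1) ⟨mem_extChartAt_source 1, by simpa using h0⟩
  refine Filter.mem_of_superset h2 fun h hh => ⟨_, hh.2, ?_⟩
  rw [groupParam, add_sub_cancel]
  exact (extChartAt 𝓘(ℝ, F) (1 : G)).left_inv hh.1

/-! ### Slice charts. -/

section SliceChart

variable {E F : Type*} [NormedAddCommGroup E] [NormedSpace ℝ E] [FiniteDimensional ℝ E]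
  [NormedAddCommGroup F] [NormedSpace ℝ F] [FiniteDimensional ℝ F]
  {G : Type*} [Group G] [TopologicalSpace G] [ChartedSpace F G]
  {X : Type*} [TopologicalSpace X] [ChartedSpace E X] [MulAction G X] {α : OneForm E X}

variable (F G) in
/-- A chart around a point `x` of the zero level of the moment map that straightens the zero level
and the orbits in it, together with the properties of the `1`-form in this chart at `x`. -/
structure SliceChart (α : OneForm E X) (x : X) where
  chart : OpenPartialHomeomorph X (SliceModel E F)
  fiber : Set F
  base : Set (ReducedModel E F)
  normal : Set (F →L[ℝ] ℝ)
  target_eq : chart.target = fiber ×ˢ base ×ˢ normal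
  isOpen_base : IsOpen base
  zero_mem_fiber : 0 ∈ fiber
  zero_mem_base : 0 ∈ base
  zero_mem_normal : 0 ∈ normal
  mem_source : x ∈ chart.source
  chart_self : chart x = 0
  contMDiffOn : ContMDiffOn 𝓘(ℝ, E) 𝓘(ℝ, SliceModel E F) ∞ chart chart.source
  contMDiffOn_symm : ContMDiffOn 𝓘(ℝ, SliceModel E F) 𝓘(ℝ, E) ∞ chart.symm chart.target
  mem_zeroLevel_iff : ∀ y ∈ chart.source, y ∈ zeroLevel (F := F) G α ↔ (chart y).2.2 = 0
  orbit_iff : ∀ y ∈ chart.source, ∀ z ∈ chart.source, y ∈ zeroLevel (F := F) G α →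
    z ∈ zeroLevel (F := F) G α → ((∃ g : G, g • y = z) ↔ (chart y).2.1 = (chart z).2.1)
  ev_fiber : ∀ Z : F, α.ev x (vel chart.symm 0 (Z, 0, 0)) = 0
  nondegenerate : ∀ v : ReducedModel E F, α.ev x (vel chart.symm 0 (0, v, 0)) = 0 →
    (∀ w : ReducedModel E F, α.ev x (vel chart.symm 0 (0, w, 0)) = 0 →
      α.d x (vel (E := E) chart.symm 0 (0, v, 0)) (vel (E := E) chart.symm 0 (0, w, 0)) = 0) → v = 0
  exists_ne_zero : ∃ v : ReducedModel E F, α.ev x (vel chart.symm 0 (0, v, 0)) ≠ 0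

variable [LieGroup 𝓘(ℝ, F) ∞ G] [IsManifold 𝓘(ℝ, E) ∞ X]
  [hGX : ContMDiffSMul 𝓘(ℝ, F) 𝓘(ℝ, E) ∞ G X]

theorem finrank_eq_of_zeroLevel (hα : α.IsContact) (hinv : α.IsInvariant G)
    (hR : ∀ x, ∃ R : E, α.ev x R = 1 ∧ ∀ w : E, α.d x R w = 0) {x : X}
    (hxC : x ∈ zeroLevel (F := F) G α) (hx : ∀ g : G, g • x = x → g = 1) :
    Module.finrank ℝ E = 2 * Module.finrank ℝ F + reducedDim E F :=
  (exists_linear_slice hα hinv hR hxC hx).1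

/-- The preslice only recognizes points related by group elements near `1`. Shrinking the
transversal into the set `O` of `exists_nhds_forall_smul_eq` makes this enough: elements relating
two of its points in the level are then automatically near `1`. -/
theorem nonempty_sliceChart [T2Space X] (hα : α.IsContact) (hinv : α.IsInvariant G)
    (hR : ∀ x, ∃ R : E, α.ev x R = 1 ∧ ∀ w : E, α.d x R w = 0)
    (hproper : ActsProperlyOnZeroLevel (F := F) G α) {x : X}
    (hxC : x ∈ zeroLevel (F := F) G α) (hx : ∀ g : G, g • x = x → g = 1) :
    Nonempty (SliceChart F G α x) := by
  obtain ⟨-, Λ, hΛζ, hΛ0, hΛμ, hnd, hne⟩ := exists_linear_slice hα hinv hR hxC hx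
  obtain ⟨Θ, hxs, hΘx, hsm, hsm', -, ⟨σ, hσ⟩, hlevel, hvel⟩ :=
    exists_preslice hα.smooth hinv hxC Λ hΛζ hΛμ
  have h0T : (0 : SliceModel E F) ∈ Θ.target := hΘx ▸ Θ.map_source hxs
  obtain ⟨A, N, hA, h0A, hN, h0N, hAN⟩ := mem_nhds_prod_iff'.1 (Θ.open_target.mem_nhds h0T)
  obtain ⟨O, hO, hxO, hOW⟩ := exists_nhds_forall_smul_eq hα.smooth hinv hproper hxC hx
    (groupParam_image_mem_nhds (G := G) hA h0A)
  have hσ0 : ∀ q ∈ N, Θ.symm (0, q) = σ q := fun q hq => by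
    rw [hσ _ (hAN (mk_mem_prod h0A hq)), groupParam_zero, one_smul]
  have hO' : N ∩ (fun q => Θ.symm ((0 : F), q)) ⁻¹' O ∈
      𝓝 (0 : ReducedModel E F × (F →L[ℝ] ℝ)) := by
    have h1 : ContinuousOn (fun q => Θ.symm ((0 : F), q)) N :=
      Θ.continuousOn_symm.comp (by fun_prop) fun q hq => hAN (mk_mem_prod h0A hq)
    refine (h1.isOpen_inter_preimage hN hO).mem_nhds ⟨h0N, ?_⟩
    have : Θ.symm ((0 : F), (0 : ReducedModel E F × (F →L[ℝ] ℝ))) = x := by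
      rw [← Θ.left_inv hxs, hΘx]; rfl
    rwa [mem_preimage, this]
  obtain ⟨B, D, hB, h0B, hD, h0D, hBD⟩ := mem_nhds_prod_iff'.1 hO'
  have hS : IsOpen (A ×ˢ B ×ˢ D) := hA.prod (hB.prod hD)
  have hST : A ×ˢ B ×ˢ D ⊆ Θ.target := fun p hp => hAN ⟨hp.1, (hBD hp.2).1⟩
  -- Restricting the inverse makes the target exactly a box, so that coordinates can be changed
  -- independently.
  let Θ' := (Θ.symm.restrOpen _ hS).symm
  have htarget : Θ'.target = A ×ˢ B ×ˢ D := by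
    change (Θ.symm.restrOpen _ hS).source = _
    rw [OpenPartialHomeomorph.restrOpen_source]
    exact inter_eq_right.2 hST
  have hsymm : ⇑Θ'.symm = ⇑Θ.symm := rfl
  have hcoe : ⇑Θ' = ⇑Θ := rfl
  have hΘ'S : ∀ y ∈ Θ'.source, Θ y ∈ A ×ˢ B ×ˢ D := fun y hy => htarget ▸ Θ'.map_source hy
  have hinv' : ∀ y ∈ Θ'.source, Θ.symm (Θ y) = y := fun y hy => Θ'.left_inv hy
  have hsource : Θ'.source ⊆ Θ.source := fun y hy => by
    rw [← hinv' y hy]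
    exact Θ.map_target (hST (hΘ'S y hy))
  have hxs' : x ∈ Θ'.source := by
    have h1 : (0 : SliceModel E F) ∈ Θ'.target := htarget ▸ ⟨h0A, h0B, h0D⟩
    have h2 := Θ'.map_target h1
    rwa [hsymm, ← hΘx, Θ.left_inv hxs] at h2
  have hlevel' : ∀ y ∈ Θ'.source, y ∈ zeroLevel (F := F) G α ↔ (Θ' y).2.2 = 0 := fun y hy => by
    rw [hcoe, ← hlevel _ (hST (hΘ'S y hy)), hinv' y hy]
  refine ⟨⟨Θ', A, B, D, htarget, hB, h0A, h0B, h0D, hxs', hΘx, hsm.mono hsource,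
    hsm'.mono (htarget ▸ hST), hlevel', fun y hy z hz hyC hzC => ⟨?_, fun h => ?_⟩, ?_, ?_, ?_⟩⟩
  · rintro ⟨g, hg⟩
    have hy' := hΘ'S y hy
    have hz' := hΘ'S z hz
    have hyσ : y = groupParam G (Θ y).1 • Θ.symm (0, (Θ y).2) := by
      rw [hσ0 _ (hBD hy'.2).1, ← hσ _ (hST hy'), hinv' y hy]
    have hzσ : z = groupParam G (Θ z).1 • Θ.symm (0, (Θ z).2) := by
      rw [hσ0 _ (hBD hz'.2).1, ← hσ _ (hST hz'), hinv' z hz]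
    -- Both points are moved along their orbits to the transversal, where the orbit coordinate is
    -- `0`.
    have hh : ((groupParam G (Θ z).1)⁻¹ * g * groupParam G (Θ y).1) • Θ.symm (0, (Θ y).2) =
        Θ.symm (0, (Θ z).2) := by
      rw [mul_smul, ← hyσ, mul_smul, hg, inv_smul_eq_iff]
      exact hzσ
    -- The relating element is `groupParam G f` with `f` still in the box, so injectivity of
    -- `Θ.symm` compares the transversal coordinates.
    obtain ⟨f, hf, hfh⟩ := hOW _ (hBD hy'.2).2
      ((hlevel (0, (Θ y).2) (hST ⟨h0A, hy'.2⟩)).2 ((hlevel' y hy).1 hyC)) _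
      (by rw [hh]; exact (hBD hz'.2).2)
    rw [← hfh, hσ0 _ (hBD hy'.2).1, ← hσ (f, (Θ y).2) (hST ⟨hf, hy'.2⟩)] at hh
    have h2 := Θ.symm.injOn (show (f, (Θ y).2) ∈ Θ.target from hST ⟨hf, hy'.2⟩)
      (show (0, (Θ z).2) ∈ Θ.target from hST ⟨h0A, hz'.2⟩) hh
    exact congrArg (fun p => p.2.1) h2
  · have h2 : (Θ y).2 = (Θ z).2 :=
      Prod.ext h (((hlevel' y hy).1 hyC).trans ((hlevel' z hz).1 hzC).symm)
    refine ⟨groupParam G (Θ z).1 * (groupParam G (Θ y).1)⁻¹, ?_⟩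
    have hyσ := hσ _ (hST (hΘ'S y hy))
    have hzσ := hσ _ (hST (hΘ'S z hz))
    rw [hinv' y hy] at hyσ
    rw [hinv' z hz] at hzσ
    have h3 : (groupParam G (Θ y).1)⁻¹ • y = σ (Θ y).2 := inv_smul_eq_iff.2 hyσ
    rw [mul_smul, h3, h2]
    exact hzσ.symm
  · intro Z
    rw [hsymm, hvel]
    exact hΛ0 Z
  · intro v hv hvw
    rw [hsymm, hvel] at hv
    refine hnd v hv fun w hw => ?_
    have := hvw w (by rw [hsymm, hvel]; exact hw)
    rwa [hsymm, hvel, hvel] at this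
  · obtain ⟨v, hv⟩ := hne
    exact ⟨v, by rw [hsymm, hvel]; exact hv⟩

end SliceChart

/-! ### Topology of the orbit space. -/

section ReducedTopology

variable {E F : Type*} [NormedAddCommGroup E] [NormedSpace ℝ E] [FiniteDimensional ℝ E]
  [NormedAddCommGroup F] [NormedSpace ℝ F]
  {G : Type*} [Group G] [TopologicalSpace G] [ChartedSpace F G]
  {X : Type*} [TopologicalSpace X] [ChartedSpace E X] [MulAction G X] {α : OneForm E X}

theorem proj_eq_iff {c d : zeroLevel (F := F) G α} :
    proj G α c = proj G α d ↔ ∃ g : G, g • (c : X) = d := by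
  rw [eq_comm]
  exact Quotient.eq (r := orbitSetoid (F := F) G α)

theorem proj_surjective : Function.Surjective (proj (F := F) G α) :=
  Quotient.mk_surjective

theorem continuous_proj : Continuous (proj (F := F) G α) := continuous_quotient_mk'

variable [LieGroup 𝓘(ℝ, F) ∞ G] [IsManifold 𝓘(ℝ, E) ∞ X]
  [hGX : ContMDiffSMul 𝓘(ℝ, F) 𝓘(ℝ, E) ∞ G X]

/-- The saturation of an open set is a union of its translates. -/
theorem isOpenMap_proj (hinv : α.IsInvariant G) : IsOpenMap (proj (F := F) G α) := by
  intro U hU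
  have hq : IsQuotientMap (proj (F := F) G α) := isQuotientMap_quotient_mk'
  rw [← hq.isOpen_preimage]
  have h1 : proj G α ⁻¹' (proj (F := F) G α '' U) =
      ⋃ g : G, (fun c : zeroLevel (F := F) G α =>
        (⟨g • (c : X), hinv.smul_mem_zeroLevel g c.2⟩ : zeroLevel (F := F) G α)) ⁻¹' U := by
    ext c
    simp only [mem_preimage, mem_image, mem_iUnion]
    constructor
    · rintro ⟨d, hd, h⟩
      obtain ⟨g, hg⟩ := proj_eq_iff.1 (h.symm)
      refine ⟨g, ?_⟩
      convert hd
    · rintro ⟨g, hg⟩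
      exact ⟨_, hg, (proj_eq_iff.2 ⟨g, rfl⟩).symm⟩
  rw [h1]
  refine isOpen_iUnion fun g => hU.preimage (Continuous.subtype_mk ?_ _)
  exact (contMDiff_smul_left (E := E) F g).continuous.comp continuous_subtype_val

/-- For an open quotient map, Hausdorffness means that the equivalence relation is closed. Here the
relation is the range of the shear map, a closed map. -/
theorem t2Space_reducedSpace [T2Space X] (hα : α.IsSmooth) (hinv : α.IsInvariant G)
    (hproper : ActsProperlyOnZeroLevel (F := F) G α) : T2Space (ReducedSpace (F := F) G α) := by
  rw [t2Space_iff_of_isOpenQuotientMap (π := proj (F := F) G α)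
    ⟨proj_surjective, continuous_proj, isOpenMap_proj hinv⟩]
  have h1 := (isProperMap_shearMap hα hinv hproper).isClosedMap.isClosed_range
  convert h1
  ext ⟨c, d⟩
  simp only [mem_ofPred_eq, mem_range, proj_eq_iff]
  constructor
  · rintro ⟨g, hg⟩
    exact ⟨(g, c), Prod.ext rfl (Subtype.ext hg)⟩
  · rintro ⟨⟨g, c'⟩, h⟩
    obtain ⟨h2, h3⟩ := Prod.ext_iff.1 h
    have h4 : c' = c := h2
    subst h4
    exact ⟨g, congrArg Subtype.val h3⟩

theorem secondCountableTopology_reducedSpace [SecondCountableTopology X]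
    (hinv : α.IsInvariant G) : SecondCountableTopology (ReducedSpace (F := F) G α) :=
  TopologicalSpace.Quotient.secondCountableTopology (isOpenMap_proj hinv)

end ReducedTopology

/-! ### Charts of the reduced space. -/

namespace SliceChart

variable {E F : Type*} [NormedAddCommGroup E] [NormedSpace ℝ E] [FiniteDimensional ℝ E]
  [NormedAddCommGroup F] [NormedSpace ℝ F] [FiniteDimensional ℝ F]
  {G : Type*} [Group G] [TopologicalSpace G] [ChartedSpace F G]
  {X : Type*} [TopologicalSpace X] [ChartedSpace E X] [MulAction G X] {α : OneForm E X}
  {x : zeroLevel (F := F) G α} (s : SliceChart F G α (x : X))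

theorem mem_target {k : ReducedModel E F} (hk : k ∈ s.base) :
    ((0 : F), k, (0 : F →L[ℝ] ℝ)) ∈ s.chart.target := by
  rw [s.target_eq]
  exact ⟨s.zero_mem_fiber, hk, s.zero_mem_normal⟩

theorem symm_mem_zeroLevel {p : SliceModel E F} (hp : p ∈ s.chart.target) (h : p.2.2 = 0) :
    s.chart.symm p ∈ zeroLevel (F := F) G α := by
  rw [s.mem_zeroLevel_iff _ (s.chart.map_target hp), s.chart.right_inv hp, h]

open Classical in
/-- The section of the projection to the reduced space defined by a slice chart. -/
def lift (k : ReducedModel E F) : zeroLevel (F := F) G α :=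
  if hk : k ∈ s.base then ⟨s.chart.symm (0, k, 0), s.symm_mem_zeroLevel (s.mem_target hk) rfl⟩
  -- A default off `base`, where nothing is claimed; it keeps the values in the zero level.
  else x

theorem coe_lift {k : ReducedModel E F} (hk : k ∈ s.base) :
    (s.lift k : X) = s.chart.symm (0, k, 0) := by
  simp [lift, hk]

theorem lift_mem_source {k : ReducedModel E F} (hk : k ∈ s.base) :
    (s.lift k : X) ∈ s.chart.source := by
  rw [s.coe_lift hk]; exact s.chart.map_target (s.mem_target hk)

theorem chart_lift {k : ReducedModel E F} (hk : k ∈ s.base) :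
    s.chart (s.lift k) = (0, k, 0) := by
  rw [s.coe_lift hk, s.chart.right_inv (s.mem_target hk)]

theorem lift_zero : s.lift 0 = x := by
  apply Subtype.ext
  rw [s.coe_lift s.zero_mem_base]
  change s.chart.symm 0 = _
  rw [← s.chart_self, s.chart.left_inv s.mem_source]

theorem contMDiffOn_lift :
    ContMDiffOn 𝓘(ℝ, ReducedModel E F) 𝓘(ℝ, E) ∞ (fun k => (s.lift k : X)) s.base := by
  have h1 : ContMDiffOn 𝓘(ℝ, ReducedModel E F) 𝓘(ℝ, SliceModel E F) ∞
      (fun k : ReducedModel E F => ((0 : F), k, (0 : F →L[ℝ] ℝ))) s.base :=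
    ContDiff.contMDiff (by fun_prop) |>.contMDiffOn
  exact (s.contMDiffOn_symm.comp h1 fun k hk => s.mem_target hk).congr fun k hk => s.coe_lift hk

theorem continuousOn_lift : ContinuousOn s.lift s.base :=
  IsInducing.subtypeVal.continuousOn_iff.2 s.contMDiffOn_lift.continuousOn

theorem mem_base {y : X} (hy : y ∈ s.chart.source) : (s.chart y).2.1 ∈ s.base := by
  have := s.chart.map_source hy
  rw [s.target_eq] at this
  exact this.2.1

theorem proj_lift {y : zeroLevel (F := F) G α} (hy : (y : X) ∈ s.chart.source) :
    proj G α (s.lift (s.chart y).2.1) = proj G α y := by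
  have hb := s.mem_base hy
  rw [proj_eq_iff]
  exact (s.orbit_iff _ (s.lift_mem_source hb) _ hy (s.lift _).2 y.2).2 (by rw [s.chart_lift hb])

theorem injOn_proj_lift : InjOn (fun k => proj G α (s.lift k)) s.base := by
  intro k hk l hl h
  have := (s.orbit_iff _ (s.lift_mem_source hk) _ (s.lift_mem_source hl) (s.lift _).2
    (s.lift _).2).1 (proj_eq_iff.1 h)
  rwa [s.chart_lift hk, s.chart_lift hl] at this

variable [LieGroup 𝓘(ℝ, F) ∞ G] [IsManifold 𝓘(ℝ, E) ∞ X]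
  [hGX : ContMDiffSMul 𝓘(ℝ, F) 𝓘(ℝ, E) ∞ G X]

/-- The image of `W` is also the projection of all points of the level with reduced coordinate in
`W`. These form an open set, and the projection is open. -/
theorem isOpen_image_proj_lift (hinv : α.IsInvariant G) {W : Set (ReducedModel E F)}
    (hW : IsOpen W) (hWb : W ⊆ s.base) : IsOpen ((fun k => proj G α (s.lift k)) '' W) := by
  have h1 : (fun k => proj G α (s.lift k)) '' W =
      proj G α '' (Subtype.val ⁻¹' (s.chart.source ∩ s.chart ⁻¹' {p | p.2.1 ∈ W})) := by
    ext q
    constructor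
    · rintro ⟨k, hk, rfl⟩
      refine ⟨s.lift k, ⟨s.lift_mem_source (hWb hk), ?_⟩, rfl⟩
      simp only [mem_preimage, mem_ofPred_eq]
      rwa [s.chart_lift (hWb hk)]
    · rintro ⟨y, ⟨hy, hyW⟩, rfl⟩
      exact ⟨_, hyW, s.proj_lift hy⟩
  rw [h1]
  refine isOpenMap_proj hinv _ (IsOpen.preimage continuous_subtype_val ?_)
  exact s.chart.isOpen_inter_preimage (hW.preimage (by fun_prop))

/-- The chart of the reduced space defined by a slice chart. -/
def redChart (hinv : α.IsInvariant G) :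
    OpenPartialHomeomorph (ReducedSpace (F := F) G α) (ReducedModel E F) :=
  (OpenPartialHomeomorph.ofContinuousOpenRestrict
    (s.injOn_proj_lift.toPartialEquiv (fun k => proj G α (s.lift k)) s.base)
    (continuous_proj.comp_continuousOn s.continuousOn_lift)
    (fun U hU => by
      have h1 : IsOpen (Subtype.val '' U : Set (ReducedModel E F)) :=
        s.isOpen_base.isOpenMap_subtype_val U hU
      have h2 := s.isOpen_image_proj_lift hinv h1 (by rintro _ ⟨k, -, rfl⟩; exact k.2)
      rw [image_image] at h2
      exact h2)
    s.isOpen_base).symm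

variable (hinv : α.IsInvariant G)

theorem redChart_symm_apply (k : ReducedModel E F) :
    (s.redChart hinv).symm k = proj G α (s.lift k) := rfl

theorem proj_mem_redChart_source {y : zeroLevel (F := F) G α} (hy : (y : X) ∈ s.chart.source) :
    proj G α y ∈ (s.redChart hinv).source := by
  rw [← s.proj_lift hy, ← s.redChart_symm_apply hinv]
  exact (s.redChart hinv).map_target (s.mem_base hy)

theorem redChart_proj {y : zeroLevel (F := F) G α} (hy : (y : X) ∈ s.chart.source) :
    s.redChart hinv (proj G α y) = (s.chart y).2.1 := by
  rw [← s.proj_lift hy, ← s.redChart_symm_apply hinv]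
  exact (s.redChart hinv).right_inv (s.mem_base hy)

theorem proj_lift_redChart {q : ReducedSpace (F := F) G α} (hq : q ∈ (s.redChart hinv).source) :
    proj G α (s.lift (s.redChart hinv q)) = q :=
  (s.redChart hinv).left_inv hq

theorem redChart_mem_base {q : ReducedSpace (F := F) G α} (hq : q ∈ (s.redChart hinv).source) :
    s.redChart hinv q ∈ s.base :=
  (s.redChart hinv).map_source hq

theorem proj_self_mem_source : proj G α x ∈ (s.redChart hinv).source :=
  s.proj_mem_redChart_source hinv s.mem_source

theorem redChart_proj_self : s.redChart hinv (proj G α x) = 0 := by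
  rw [s.redChart_proj hinv s.mem_source, s.chart_self]; rfl

/-- The expression of a smooth map to the zero level in a chart of the reduced space is smooth. -/
theorem contMDiffAt_redChart_proj {Y : Type*} [NormedAddCommGroup Y] [NormedSpace ℝ Y]
    {P : Y → zeroLevel (F := F) G α} {u : Y}
    (hP : ContMDiffAt 𝓘(ℝ, Y) 𝓘(ℝ, E) ∞ (fun u => (P u : X)) u)
    (hu : proj G α (P u) ∈ (s.redChart hinv).source) :
    ContDiffAt ℝ ∞ (fun u => s.redChart hinv (proj G α (P u))) u := by
  have hb := s.redChart_mem_base hinv hu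
  -- `P u` itself may lie outside the slice chart. Translation by a fixed `g` brings it inside and
  -- does not change projections.
  obtain ⟨g, hg⟩ := proj_eq_iff.1 (s.proj_lift_redChart hinv hu).symm
  have h1 : g • (P u : X) ∈ s.chart.source := hg ▸ s.lift_mem_source hb
  have h2 : ContMDiffAt 𝓘(ℝ, Y) 𝓘(ℝ, E) ∞ (fun u => g • (P u : X)) u :=
    (contMDiff_smul_left (E := E) F g).contMDiffAt.comp u hP
  have h3 : ContMDiffAt 𝓘(ℝ, E) 𝓘(ℝ, SliceModel E F) ∞ s.chart (g • (P u : X)) :=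
    s.contMDiffOn.contMDiffAt (s.chart.open_source.mem_nhds h1)
  have h4 : ContDiffAt ℝ ∞ (fun u => s.chart (g • (P u : X))) u :=
    contMDiffAt_iff_contDiffAt.1 (h3.comp u h2)
  refine (contDiff_fst.contDiffAt.comp u (contDiff_snd.contDiffAt.comp u h4)).congr_of_eventuallyEq
    ?_
  filter_upwards [h2.continuousAt (s.chart.open_source.mem_nhds h1)] with v hv
  have h5 : proj G α (P v) = proj G α ⟨g • (P v : X), hinv.smul_mem_zeroLevel g (P v).2⟩ :=
    proj_eq_iff.2 ⟨g, rfl⟩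
  rw [h5, s.redChart_proj hinv (y := ⟨g • (P v : X), hinv.smul_mem_zeroLevel g (P v).2⟩) hv]
  rfl

end SliceChart

/-! ### The restricted form is basic. -/

section Basic

variable {E F : Type*} [NormedAddCommGroup E] [NormedSpace ℝ E] [FiniteDimensional ℝ E]
  [NormedAddCommGroup F] [NormedSpace ℝ F] [FiniteDimensional ℝ F]
  {G : Type*} [Group G] [TopologicalSpace G] [ChartedSpace F G] [LieGroup 𝓘(ℝ, F) ∞ G]
  {X : Type*} [TopologicalSpace X] [ChartedSpace E X] [IsManifold 𝓘(ℝ, E) ∞ X] [MulAction G X]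
  [hGX : ContMDiffSMul 𝓘(ℝ, F) 𝓘(ℝ, E) ∞ G X] {α : OneForm E X}
  {Y : Type*} [NormedAddCommGroup Y] [NormedSpace ℝ Y]

/-- The restriction of the `1`-form to the zero level is basic: two maps to the zero level with the
same projection pull it back to the same form. -/
theorem ev_vel_eq_of_proj_eq (hinv : α.IsInvariant G)
    (S : ∀ x : zeroLevel (F := F) G α, SliceChart F G α (x : X))
    {P Q : Y → zeroLevel (F := F) G α} {u : Y}
    (hP : MDifferentiableAt 𝓘(ℝ, Y) 𝓘(ℝ, E) (fun u => (P u : X)) u)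
    (hQ : MDifferentiableAt 𝓘(ℝ, Y) 𝓘(ℝ, E) (fun u => (Q u : X)) u)
    (hPQ : ∀ᶠ v in 𝓝 u, proj G α (P v) = proj G α (Q v)) (v : Y) :
    α.ev (P u : X) (vel (fun u => (P u : X)) u v) = α.ev (Q u : X) (vel (fun u => (Q u : X)) u v) := by
  -- A constant `g` matching the two maps at `u` suffices: by invariance `P` may be replaced by `g •
  -- P`, and no smooth choice of group elements at nearby points is needed.
  obtain ⟨g, hg⟩ := proj_eq_iff.1 hPQ.self_of_nhds
  set s := S (Q u) with hs
  have hP' : MDifferentiableAt 𝓘(ℝ, Y) 𝓘(ℝ, E) (fun u => g • (P u : X)) u :=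
    ((contMDiff_smul_left (E := E) F g).mdifferentiableAt (by simp)).comp u hP
  have hchart : MDifferentiableAt 𝓘(ℝ, E) 𝓘(ℝ, SliceModel E F) s.chart (Q u) :=
    (s.contMDiffOn.contMDiffAt (s.chart.open_source.mem_nhds s.mem_source)).mdifferentiableAt
      (by simp)
  have h0 : (0 : SliceModel E F) ∈ s.chart.target := s.chart_self ▸ s.chart.map_source s.mem_source
  have hsymm : MDifferentiableAt 𝓘(ℝ, SliceModel E F) 𝓘(ℝ, E) s.chart.symm 0 :=
    (s.contMDiffOn_symm.contMDiffAt (s.chart.open_target.mem_nhds h0)).mdifferentiableAt (by simp)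
  have key : ∀ R : Y → X, R u = Q u → MDifferentiableAt 𝓘(ℝ, Y) 𝓘(ℝ, E) R u →
      DifferentiableAt ℝ (fun v => s.chart (R v)) u ∧ (∀ᶠ v in 𝓝 u, R v ∈ s.chart.source) ∧
      vel R u v = vel (E := E) s.chart.symm 0 (fderiv ℝ (fun v => s.chart (R v)) u v) := by
    intro R hRu hR
    have h1 : DifferentiableAt ℝ (fun v => s.chart (R v)) u :=
      (MDifferentiableAt.comp (g := s.chart) u (by rw [hRu]; exact hchart) hR).differentiableAt
    have h2 : ∀ᶠ v in 𝓝 u, R v ∈ s.chart.source :=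
      hR.continuousAt (s.chart.open_source.mem_nhds (by rw [hRu]; exact s.mem_source))
    have h3 : s.chart (R u) = 0 := by rw [hRu, s.chart_self]
    refine ⟨h1, h2, ?_⟩
    have h4 : R =ᶠ[𝓝 u] s.chart.symm ∘ fun v => s.chart (R v) := by
      filter_upwards [h2] with v hv
      exact (s.chart.left_inv hv).symm
    rw [vel_congr h4, vel_comp (f := fun v => s.chart (R v)) (by rw [h3]; exact hsymm) h1, h3]
  obtain ⟨hd1, hn1, hv1⟩ := key _ hg hP'
  obtain ⟨hd2, hn2, hv2⟩ := key _ rfl hQ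
  -- Near `u` the two maps share their reduced and moment coordinates. Their velocities therefore
  -- differ by an orbit direction, which the form kills.
  have hd : (fun v => ((s.chart (g • (P v : X)) - s.chart (Q v))).2) =ᶠ[𝓝 u] fun _ => 0 := by
    filter_upwards [hn1, hn2, hPQ] with v h1 h2 h3
    have h4 := hinv.smul_mem_zeroLevel g (P v).2
    refine Prod.ext (sub_eq_zero.2 ?_) (sub_eq_zero.2 ?_)
    · refine (s.orbit_iff _ h1 _ h2 h4 (Q v).2).1 (proj_eq_iff.1 (Eq.trans ?_ h3) :
        ∃ g' : G, g' • ((⟨g • (P v : X), h4⟩ : zeroLevel (F := F) G α) : X) = Q v)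
      exact (proj_eq_iff.2 ⟨g, rfl⟩).symm
    · rw [(s.mem_zeroLevel_iff _ h1).1 h4, (s.mem_zeroLevel_iff _ h2).1 (Q v).2]
  set w1 := fderiv ℝ (fun v => s.chart (g • (P v : X))) u v
  set w2 := fderiv ℝ (fun v => s.chart (Q v : X)) u v
  have hw : (w1 - w2).2 = 0 := by
    have h5 := ((hd1.hasFDerivAt.sub hd2.hasFDerivAt).snd).unique
      ((hasFDerivAt_const 0 u).congr_of_eventuallyEq hd)
    exact DFunLike.congr_fun h5 v
  have hw' : w1 = w2 + ((w1 - w2).1, 0, 0) := by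
    refine Prod.ext (by simp) ?_
    have : w1.2 = w2.2 := sub_eq_zero.1 hw
    rw [this]
    exact (add_zero _).symm
  rw [← hinv.ev_vel_smul F g hP v, hg, hv1, hv2, hw']
  have hlin : ∀ a b : SliceModel E F, vel (E := E) s.chart.symm 0 (a + b) =
      vel (E := E) s.chart.symm 0 a + vel (E := E) s.chart.symm 0 b := fun a b =>
    map_add (mfderiv 𝓘(ℝ, SliceModel E F) 𝓘(ℝ, E) s.chart.symm 0) a b
  have hev : ∀ a b : E, α.ev (Q u : X) (a + b) = α.ev (Q u : X) a + α.ev (Q u : X) b := fun a b =>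
    map_add (α (Q u : X)) a b
  rw [hlin, hev, s.ev_fiber, add_zero]

end Basic

/-! ### The reduced manifold and the reduced form. -/

section ReducedManifold

variable {E F : Type*} [NormedAddCommGroup E] [NormedSpace ℝ E] [FiniteDimensional ℝ E]
  [NormedAddCommGroup F] [NormedSpace ℝ F] [FiniteDimensional ℝ F]
  {G : Type*} [Group G] [TopologicalSpace G] [ChartedSpace F G] [LieGroup 𝓘(ℝ, F) ∞ G]
  {X : Type*} [TopologicalSpace X] [ChartedSpace E X] [IsManifold 𝓘(ℝ, E) ∞ X] [MulAction G X]
  [hGX : ContMDiffSMul 𝓘(ℝ, F) 𝓘(ℝ, E) ∞ G X] {α : OneForm E X}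

/-- The charted space structure of the reduced space given by a family of slice charts. -/
abbrev reducedChartedSpace (hinv : α.IsInvariant G)
    (S : ∀ x : zeroLevel (F := F) G α, SliceChart F G α (x : X)) :
    ChartedSpace (ReducedModel E F) (ReducedSpace (F := F) G α) where
  atlas := range fun x => (S x).redChart hinv
  chartAt q := (S q.out).redChart hinv
  mem_chart_source q := by
    have := (S q.out).proj_self_mem_source hinv
    rwa [show proj G α q.out = q from Quotient.out_eq q] at this
  chart_mem_atlas q := ⟨q.out, rfl⟩

/-- A transition map is a section `lift` followed by projection and another chart, so
`contMDiffAt_redChart_proj` applies. -/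
theorem isManifold_reducedChartedSpace (hinv : α.IsInvariant G)
    (S : ∀ x : zeroLevel (F := F) G α, SliceChart F G α (x : X)) :
    @IsManifold ℝ _ (ReducedModel E F) _ _ (ReducedModel E F) _ 𝓘(ℝ, ReducedModel E F) ∞
      (ReducedSpace (F := F) G α) _ (reducedChartedSpace hinv S) := by
  let _ := reducedChartedSpace hinv S
  refine isManifold_of_contDiffOn _ _ _ ?_
  rintro _ _ ⟨x, rfl⟩ ⟨y, rfl⟩ k hk
  have hk' : k ∈ (((S x).redChart hinv).symm.trans ((S y).redChart hinv)).source := by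
    simpa using hk
  rw [OpenPartialHomeomorph.trans_source] at hk'
  have hkb : k ∈ (S x).base := hk'.1
  exact ((S y).contMDiffAt_redChart_proj hinv ((S x).contMDiffOn_lift.contMDiffAt
    ((S x).isOpen_base.mem_nhds hkb)) hk'.2).contDiffWithinAt

variable [ChartedSpace (ReducedModel E F) (ReducedSpace (F := F) G α)]
  [IsManifold 𝓘(ℝ, ReducedModel E F) ∞ (ReducedSpace (F := F) G α)]
  (hinv : α.IsInvariant G) (S : ∀ x : zeroLevel (F := F) G α, SliceChart F G α (x : X))
  (hat : ∀ x, (S x).redChart hinv ∈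
    IsManifold.maximalAtlas 𝓘(ℝ, ReducedModel E F) ∞ (ReducedSpace (F := F) G α))
  {Y : Type*} [NormedAddCommGroup Y] [NormedSpace ℝ Y]

-- The manifold structure is any one for which the slice charts are smooth charts. This generality
-- lets the results serve both the constructed structure and an arbitrary reduction.
include hat in
theorem contMDiffAt_proj {P : Y → zeroLevel (F := F) G α} {u : Y}
    (hP : ContMDiffAt 𝓘(ℝ, Y) 𝓘(ℝ, E) ∞ (fun u => (P u : X)) u) :
    ContMDiffAt 𝓘(ℝ, Y) 𝓘(ℝ, ReducedModel E F) ∞ (fun u => proj G α (P u)) u := by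
  set κ := (S (P u)).redChart hinv with hκ
  have hs : proj G α (P u) ∈ κ.source := (S (P u)).proj_self_mem_source hinv
  have h1 : ContDiffAt ℝ ∞ (fun u => κ (proj G α (P u))) u :=
    (S (P u)).contMDiffAt_redChart_proj hinv hP hs
  have h2 : ContMDiffAt 𝓘(ℝ, ReducedModel E F) 𝓘(ℝ, ReducedModel E F) ∞ κ.symm
      (κ (proj G α (P u))) :=
    contMDiffAt_symm_of_mem_maximalAtlas (hat _) (κ.map_source hs)
  have hc : ContinuousAt (fun u => proj G α (P u)) u :=
    continuous_proj.continuousAt.comp (IsInducing.subtypeVal.continuousAt_iff.2 hP.continuousAt)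
  refine (h2.comp u h1.contMDiffAt).congr_of_eventuallyEq ?_
  filter_upwards [hc (κ.open_source.mem_nhds hs)] with v hv
  exact (κ.left_inv hv).symm

-- Smooth maps lift locally through the sections `lift`; conversely, plots of the level project to
-- smooth maps.
include hat in
theorem contMDiffOn_iff_isReducedPlotOn (m : ℕ)
    (P : EuclideanSpace ℝ (Fin m) → ReducedSpace (F := F) G α)
    (U : Set (EuclideanSpace ℝ (Fin m))) (hU : IsOpen U) :
    ContMDiffOn 𝓘(ℝ, EuclideanSpace ℝ (Fin m)) 𝓘(ℝ, ReducedModel E F) ∞ P U ↔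
      IsReducedPlotOn G α P U := by
  constructor
  · intro hP u hu
    obtain ⟨x, hx⟩ := proj_surjective (P u)
    set s := S x
    have hs : P u ∈ (s.redChart hinv).source := hx ▸ s.proj_self_mem_source hinv
    have hV : IsOpen (U ∩ P ⁻¹' (s.redChart hinv).source) :=
      hP.continuousOn.isOpen_inter_preimage hU (s.redChart hinv).open_source
    refine ⟨_, hV, ⟨hu, hs⟩, inter_subset_left, fun v => s.lift (s.redChart hinv (P v)), ?_,
      fun v hv => s.proj_lift_redChart hinv hv.2⟩
    exact s.contMDiffOn_lift.comp ((contMDiffOn_of_mem_maximalAtlas (hat x)).comp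
      (hP.mono inter_subset_left) fun v hv => hv.2) fun v hv => s.redChart_mem_base hinv hv.2
  · intro hP u hu
    obtain ⟨V, hV, huV, -, Q, hQ, hQP⟩ := hP u hu
    have h1 := contMDiffAt_proj hinv S hat (hQ.contMDiffAt (hV.mem_nhds huV))
    refine (h1.congr_of_eventuallyEq ?_).contMDiffWithinAt
    filter_upwards [hV.mem_nhds huV] with v hv
    exact (hQP v hv).symm

/-- The reduced `1`-form. -/
def redForm : OneForm (ReducedModel E F) (ReducedSpace (F := F) G α) := fun q =>
  (α ((S q.out).lift ((S q.out).redChart hinv q) : X)).comp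
    ((mfderiv 𝓘(ℝ, ReducedModel E F) 𝓘(ℝ, E) (fun k => ((S q.out).lift k : X))
      ((S q.out).redChart hinv q)).comp
    (mfderiv 𝓘(ℝ, ReducedModel E F) 𝓘(ℝ, ReducedModel E F) ((S q.out).redChart hinv) q))

omit [IsManifold 𝓘(ℝ, ReducedModel E F) ∞ (ReducedSpace (F := F) G α)] in
theorem redForm_ev (q : ReducedSpace (F := F) G α) (v : ReducedModel E F) :
    (redForm hinv S).ev q v = α.ev ((S q.out).lift ((S q.out).redChart hinv q) : X)
      (vel (fun k => ((S q.out).lift k : X)) ((S q.out).redChart hinv q)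
        (mfderiv 𝓘(ℝ, ReducedModel E F) 𝓘(ℝ, ReducedModel E F) ((S q.out).redChart hinv) q v :
          ReducedModel E F)) := rfl

theorem mem_redChart_out_source (q : ReducedSpace (F := F) G α) :
    q ∈ ((S q.out).redChart hinv).source := by
  have := (S q.out).proj_self_mem_source hinv
  rwa [show proj G α q.out = q from Quotient.out_eq q] at this

-- The form at `proj G α (P u)` is computed through `lift`, that is, along a second map to the level
-- with the same projection as `P`. Basicness (`ev_vel_eq_of_proj_eq`) makes the choice immaterial.
include hat in
theorem redForm_ev_proj {P : Y → zeroLevel (F := F) G α} {u : Y}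
    (hP : ContMDiffAt 𝓘(ℝ, Y) 𝓘(ℝ, E) ∞ (fun u => (P u : X)) u) (v : Y) :
    (redForm hinv S).ev (proj G α (P u)) (vel (fun u => proj G α (P u)) u v) =
      α.ev (P u : X) (vel (fun u => (P u : X)) u v) := by
  set q := proj G α (P u) with hq
  set s := S q.out with hs
  have hqs : q ∈ (s.redChart hinv).source := mem_redChart_out_source hinv S q
  have hb := s.redChart_mem_base hinv hqs
  have h1 := contMDiffAt_proj hinv S hat hP
  have h2 : ContMDiffAt 𝓘(ℝ, ReducedModel E F) 𝓘(ℝ, ReducedModel E F) ∞ (s.redChart hinv) q :=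
    contMDiffAt_of_mem_maximalAtlas (hat _) hqs
  have h3 := s.contMDiffOn_lift.contMDiffAt (s.isOpen_base.mem_nhds hb)
  have h4 := vel_comp_left (P := fun u => proj G α (P u)) hq.symm
    (h2.mdifferentiableAt (by simp)) (h1.mdifferentiableAt (by simp)) v
  have h5 : ContDiffAt ℝ ∞ (fun u => s.redChart hinv (proj G α (P u))) u :=
    s.contMDiffAt_redChart_proj hinv hP hqs
  have h6 := vel_comp (P := fun k => (s.lift k : X))
    (f := fun u => s.redChart hinv (proj G α (P u))) (z := u)
    (h3.mdifferentiableAt (by simp)) (h5.differentiableAt (by simp)) v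
  have h7 : vel (fun u => s.redChart hinv (proj G α (P u))) u v =
      fderiv ℝ (fun u => s.redChart hinv (proj G α (P u))) u v :=
    DFunLike.congr_fun mfderiv_eq_fderiv v
  rw [redForm_ev, ← h4, h7]
  refine Eq.trans (congrArg _ h6.symm) ?_
  refine ev_vel_eq_of_proj_eq hinv S (P := fun u => s.lift (s.redChart hinv (proj G α (P u))))
    ((h3.comp u h5.contMDiffAt).mdifferentiableAt (by simp))
    (hP.mdifferentiableAt (by simp)) ?_ v
  filter_upwards [h1.continuousAt ((s.redChart hinv).open_source.mem_nhds hqs)] with w hw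
  exact s.proj_lift_redChart hinv hw

-- The definition uses a different section at each point. Independence of the lift replaces it, near
-- `q0`, by the formula of a single slice chart, a composite of smooth maps.
include hat in
theorem redForm_isSmooth (hα : α.IsSmooth) : (redForm hinv S).IsSmooth := by
  intro v0
  obtain ⟨q0, w0⟩ := v0
  set s := S q0.out with hs
  set κ := s.redChart hinv with hκ
  have hq0 : q0 ∈ κ.source := mem_redChart_out_source hinv S q0
  have hκs : ContMDiffOn 𝓘(ℝ, ReducedModel E F) 𝓘(ℝ, ReducedModel E F) ∞ κ κ.source :=
    contMDiffOn_of_mem_maximalAtlas (hat _)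
  have hκs' : ContMDiffOn 𝓘(ℝ, ReducedModel E F) 𝓘(ℝ, ReducedModel E F) ∞ κ.symm κ.target :=
    contMDiffOn_symm_of_mem_maximalAtlas (hat _)
  have h1 := hκs.contMDiffOn_tangentMapWithin (m := ∞) (by simp) κ.open_source.uniqueMDiffOn
  have h2 := s.contMDiffOn_lift.contMDiffOn_tangentMapWithin (m := ∞) (by simp)
    s.isOpen_base.uniqueMDiffOn
  have h3 := hα.comp_contMDiffOn (h2.comp h1 fun v hv => s.redChart_mem_base hinv hv)
  have hopen : IsOpen (Bundle.TotalSpace.proj ⁻¹' κ.source :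
      Set (TangentBundle 𝓘(ℝ, ReducedModel E F) (ReducedSpace (F := F) G α))) :=
    κ.open_source.preimage (FiberBundle.continuous_proj _ _)
  refine (h3.congr fun v hv => ?_).contMDiffAt (hopen.mem_nhds hq0)
  obtain ⟨q, w⟩ := v
  have hq : q ∈ κ.source := hv
  have hb : κ q ∈ s.base := s.redChart_mem_base hinv hq
  have h4 := redForm_ev_proj hinv S hat (P := s.lift) (u := κ q)
    (s.contMDiffOn_lift.contMDiffAt (s.isOpen_base.mem_nhds hb))
    (mfderiv 𝓘(ℝ, ReducedModel E F) 𝓘(ℝ, ReducedModel E F) κ q w : ReducedModel E F)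
  have h5 : vel (E := ReducedModel E F) (fun k => proj G α (s.lift k)) (κ q)
      (mfderiv 𝓘(ℝ, ReducedModel E F) 𝓘(ℝ, ReducedModel E F) κ q w : ReducedModel E F) = w := by
    have hd : κ.MDifferentiable 𝓘(ℝ, ReducedModel E F) 𝓘(ℝ, ReducedModel E F) :=
      ⟨hκs.mdifferentiableOn (by simp), hκs'.mdifferentiableOn (by simp)⟩
    exact DFunLike.congr_fun (hd.symm_comp_deriv hq) w
  have h6 : proj G α (s.lift (κ q)) = q := s.proj_lift_redChart hinv hq
  rw [h5] at h4
  rw [h6] at h4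
  refine h4.trans ?_
  simp only [Function.comp_apply, tangentMapWithin]
  rw [mfderivWithin_of_isOpen κ.open_source hq, mfderivWithin_of_isOpen s.isOpen_base hb]
  rfl

end ReducedManifold

/-! ### The reduced form is a contact form. -/

section Contact

variable {E F : Type*} [NormedAddCommGroup E] [NormedSpace ℝ E] [FiniteDimensional ℝ E]
  [NormedAddCommGroup F] [NormedSpace ℝ F] [FiniteDimensional ℝ F]
  {G : Type*} [Group G] [TopologicalSpace G] [ChartedSpace F G] [LieGroup 𝓘(ℝ, F) ∞ G]
  {X : Type*} [TopologicalSpace X] [ChartedSpace E X] [IsManifold 𝓘(ℝ, E) ∞ X] [MulAction G X]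
  [hGX : ContMDiffSMul 𝓘(ℝ, F) 𝓘(ℝ, E) ∞ G X] {α : OneForm E X}

theorem SliceChart.vel_lift_zero {x : zeroLevel (F := F) G α} (s : SliceChart F G α (x : X))
    (v : ReducedModel E F) :
    vel (fun k => (s.lift k : X)) 0 v = vel (E := E) s.chart.symm 0 (0, v, 0) := by
  have h1 : (fun k => (s.lift k : X)) =ᶠ[𝓝 0] s.chart.symm ∘
      fun k => ((0 : F), k, (0 : F →L[ℝ] ℝ)) := by
    filter_upwards [s.isOpen_base.mem_nhds s.zero_mem_base] with k hk
    exact s.coe_lift hk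
  have h2 : MDifferentiableAt 𝓘(ℝ, SliceModel E F) 𝓘(ℝ, E) s.chart.symm
      ((0 : F), (0 : ReducedModel E F), (0 : F →L[ℝ] ℝ)) :=
    (s.contMDiffOn_symm.contMDiffAt (s.chart.open_target.mem_nhds
      (s.mem_target s.zero_mem_base))).mdifferentiableAt (by simp)
  have h3 : HasFDerivAt (fun k : ReducedModel E F => ((0 : F), k, (0 : F →L[ℝ] ℝ)))
      ((0 : ReducedModel E F →L[ℝ] F).prod
        ((ContinuousLinearMap.id ℝ (ReducedModel E F)).prod 0)) 0 :=
    (hasFDerivAt_const 0 _).prodMk ((hasFDerivAt_id _).prodMk (hasFDerivAt_const 0 _))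
  rw [vel_congr h1, vel_comp (f := fun k => ((0 : F), k, (0 : F →L[ℝ] ℝ))) h2
    h3.differentiableAt, h3.fderiv]
  rfl

variable [ChartedSpace (ReducedModel E F) (ReducedSpace (F := F) G α)]
  [IsManifold 𝓘(ℝ, ReducedModel E F) ∞ (ReducedSpace (F := F) G α)]
  (hinv : α.IsInvariant G) (S : ∀ x : zeroLevel (F := F) G α, SliceChart F G α (x : X))
  (hchart : ∀ q : ReducedSpace (F := F) G α,
    chartAt (ReducedModel E F) q = (S q.out).redChart hinv)
  (hat : ∀ x, (S x).redChart hinv ∈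
    IsManifold.maximalAtlas 𝓘(ℝ, ReducedModel E F) ∞ (ReducedSpace (F := F) G α))

include hchart in
theorem extChartAt_reducedSpace (q : ReducedSpace (F := F) G α) :
    ⇑(extChartAt 𝓘(ℝ, ReducedModel E F) q) = (S q.out).redChart hinv := by
  rw [← hchart]; rfl

include hchart in
theorem extChartAt_symm_reducedSpace (q : ReducedSpace (F := F) G α) :
    ⇑(extChartAt 𝓘(ℝ, ReducedModel E F) q).symm = ((S q.out).redChart hinv).symm := by
  rw [← hchart]; rfl

include hat in
theorem redForm_ev_lift {x : zeroLevel (F := F) G α} (s : SliceChart F G α (x : X))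
    {k : ReducedModel E F} (hk : k ∈ s.base) (v : ReducedModel E F) :
    (redForm hinv S).ev (proj G α (s.lift k)) (vel (fun k => proj G α (s.lift k)) k v) =
      α.ev (s.lift k : X) (vel (fun k => (s.lift k : X)) k v) :=
  redForm_ev_proj hinv S hat (s.contMDiffOn_lift.contMDiffAt (s.isOpen_base.mem_nhds hk)) v

-- Tangent spaces and `d` refer to preferred charts, so here `hchart` fixes these to be slice
-- charts. In such a chart `proj ∘ lift` is the identity, so the value is that of `α` along the
-- slice.
include hat hchart in
theorem redForm_ev_eq (q : ReducedSpace (F := F) G α) (v : ReducedModel E F) :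
    (redForm hinv S).ev q v = α.ev (q.out : X) (vel (E := E) (S q.out).chart.symm 0 (0, v, 0)) := by
  set s := S q.out with hs
  have h1 := redForm_ev_lift hinv S hat s s.zero_mem_base v
  have hq : proj G α (s.lift 0) = q := by rw [s.lift_zero]; exact Quotient.out_eq q
  have h2 : vel (E := ReducedModel E F) (fun k => proj G α (s.lift k)) 0 v = v := by
    rw [vel_eq_fderiv (P := fun k => proj G α (s.lift k)) hq ((contMDiffAt_proj hinv S hat
      (s.contMDiffOn_lift.contMDiffAt
      (s.isOpen_base.mem_nhds s.zero_mem_base))).mdifferentiableAt (by simp)),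
      extChartAt_reducedSpace hinv S hchart]
    have h3 : (fun k => s.redChart hinv (proj G α (s.lift k))) =ᶠ[𝓝 0] id := by
      filter_upwards [s.isOpen_base.mem_nhds s.zero_mem_base] with k hk
      rw [s.redChart_proj hinv (s.lift_mem_source hk), s.chart_lift hk]
      rfl
    rw [h3.fderiv_eq, fderiv_id]
    rfl
  rw [h2, hq, s.vel_lift_zero, s.lift_zero] at h1
  exact h1

-- In the chart at `q` the reduced form is the pull-back of `α` by the section `lift`, so the
-- formula is naturality of `d`.
include hat hchart in
theorem redForm_d_eq (hα : α.IsSmooth) (q : ReducedSpace (F := F) G α) (v w : ReducedModel E F) :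
    (redForm hinv S).d q v w = α.d (q.out : X) (vel (E := E) (S q.out).chart.symm 0 (0, v, 0))
      (vel (E := E) (S q.out).chart.symm 0 (0, w, 0)) := by
  set s := S q.out with hs
  obtain ⟨x, hx⟩ : ∃ x : X, x = (q.out : X) := ⟨_, rfl⟩
  set h : ReducedModel E F → E := fun k => extChartAt 𝓘(ℝ, E) x (s.lift k : X) with hh
  have hbn := s.isOpen_base.mem_nhds s.zero_mem_base
  have hl : ContMDiffAt 𝓘(ℝ, ReducedModel E F) 𝓘(ℝ, E) ∞ (fun k => (s.lift k : X)) 0 :=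
    s.contMDiffOn_lift.contMDiffAt hbn
  have hl0 : (s.lift 0 : X) = x := by rw [s.lift_zero, hx]
  have hsrc : (chartAt E x).source ∈ 𝓝 (s.lift 0 : X) :=
    (chartAt E x).open_source.mem_nhds (by rw [hl0]; exact mem_chart_source E x)
  have h1 : ContDiffAt ℝ ∞ h 0 := by
    have h2 := (contMDiffAt_extChartAt (I := 𝓘(ℝ, E)) (n := ∞) (x := x))
    rw [← hl0] at h2
    exact contMDiffAt_iff_contDiffAt.1 (by rw [hh, ← hl0]; exact h2.comp 0 hl)
  have hq0 : extChartAt 𝓘(ℝ, ReducedModel E F) q q = 0 := by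
    rw [extChartAt_reducedSpace hinv S hchart]
    have := s.redChart_proj_self hinv
    rwa [show proj G α q.out = q from Quotient.out_eq q] at this
  have h3 : (redForm hinv S).inChart q =ᶠ[𝓝 0] fun k => (α.inChart x (h k)).comp (fderiv ℝ h k) := by
    filter_upwards [hbn, hl.continuousAt hsrc] with k hk hk'
    refine ContinuousLinearMap.ext fun u => ?_
    have h4 := redForm_ev_lift hinv S hat s hk u
    rw [α.ev_vel x ((s.contMDiffOn_lift.contMDiffAt (s.isOpen_base.mem_nhds hk)).mdifferentiableAt
      (by simp)) hk'] at h4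
    refine Eq.trans ?_ h4
    have h5 : (redForm hinv S).inChart q k u =
        (redForm hinv S).ev ((extChartAt 𝓘(ℝ, ReducedModel E F) q).symm k)
          (vel (extChartAt 𝓘(ℝ, ReducedModel E F) q).symm k u) := rfl
    rw [h5, extChartAt_symm_reducedSpace hinv S hchart]
    rfl
  have h0 : h 0 = extChartAt 𝓘(ℝ, E) x x := by rw [hh]; simp only [hl0]
  have h5 : DifferentiableAt ℝ (α.inChart x) (h 0) := by
    rw [h0]
    exact ((α.contDiffOn_inChart hα x).contDiffAt ((isOpen_extChartAt_target x).mem_nhds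
      (mem_extChartAt_target x))).differentiableAt (by simp)
  have h6 := fderiv_pullback_antisymm h5 (h1.of_le (by exact WithTop.coe_le_coe.2 le_top)) v w
  have h7 : ∀ u, fderiv ℝ h 0 u = vel (E := E) s.chart.symm 0 (0, u, 0) := fun u => by
    rw [← s.vel_lift_zero, vel_eq_fderiv (P := fun k => (s.lift k : X)) hl0 (hl.mdifferentiableAt (by simp))]
  rw [← h3.fderiv_eq, h7, h7, h0] at h6
  have h8 : (redForm hinv S).d q v w = fderiv ℝ ((redForm hinv S).inChart q)
      (extChartAt 𝓘(ℝ, ReducedModel E F) q q) v w - fderiv ℝ ((redForm hinv S).inChart q)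
      (extChartAt 𝓘(ℝ, ReducedModel E F) q q) w v := rfl
  rw [h8, hq0]
  rw [hx] at h6
  exact h6

include hat hchart in
theorem redForm_isContact (hα : α.IsSmooth) : (redForm hinv S).IsContact where
  smooth := redForm_isSmooth hinv S hat hα
  ne_zero q hq := by
    obtain ⟨v, hv⟩ := (S q.out).exists_ne_zero
    rw [← redForm_ev_eq hinv S hchart hat] at hv
    refine hv ?_
    rw [OneForm.ev, hq]
    rfl
  nondegenerate q v hv hvw := (S q.out).nondegenerate v
    ((redForm_ev_eq hinv S hchart hat q v).symm.trans hv) fun w hw =>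
    (redForm_d_eq hinv S hchart hat hα q v w).symm.trans
      (hvw w ((redForm_ev_eq hinv S hchart hat q w).trans hw))

include hat in
theorem redForm_isReduction (hα : α.IsSmooth) :
    IsReduction G α (reducedDim E F) (redForm hinv S) where
  smooth_iff_plot := contMDiffOn_iff_isReducedPlotOn hinv S hat
  smooth_form := redForm_isSmooth hinv S hat hα
  pullback_eq _ _ _ hU hP _ hu v :=
    redForm_ev_proj hinv S hat (hP.contMDiffAt (hU.mem_nhds hu)) v

end Contact

/-! ### Existence of the reduction. -/

section Existence

variable {E F : Type*} [NormedAddCommGroup E] [NormedSpace ℝ E] [FiniteDimensional ℝ E]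
  [NormedAddCommGroup F] [NormedSpace ℝ F] [FiniteDimensional ℝ F]
  {G : Type*} [Group G] [TopologicalSpace G] [ChartedSpace F G] [LieGroup 𝓘(ℝ, F) ∞ G]
  {X : Type*} [TopologicalSpace X] [ChartedSpace E X] [IsManifold 𝓘(ℝ, E) ∞ X] [MulAction G X]
  [hGX : ContMDiffSMul 𝓘(ℝ, F) 𝓘(ℝ, E) ∞ G X] {α : OneForm E X}

theorem exists_reduction (hinv : α.IsInvariant G)
    (S : ∀ x : zeroLevel (F := F) G α, SliceChart F G α (x : X)) (hα : α.IsSmooth) :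
    ∃ (k : ℕ) (_ : ChartedSpace (EuclideanSpace ℝ (Fin k)) (ReducedSpace (F := F) G α))
      (_ : IsManifold 𝓘(ℝ, EuclideanSpace ℝ (Fin k)) ∞ (ReducedSpace (F := F) G α))
      (β : OneForm (EuclideanSpace ℝ (Fin k)) (ReducedSpace (F := F) G α)),
      IsReduction G α k β ∧ β.IsContact := by
  let _ := reducedChartedSpace hinv S
  have _ := isManifold_reducedChartedSpace hinv S
  have hat : ∀ x, (S x).redChart hinv ∈
      IsManifold.maximalAtlas 𝓘(ℝ, ReducedModel E F) ∞ (ReducedSpace (F := F) G α) :=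
    fun x => IsManifold.subset_maximalAtlas ⟨x, rfl⟩
  exact ⟨reducedDim E F, inferInstance, inferInstance, redForm hinv S,
    redForm_isReduction hinv S hat hα, redForm_isContact hinv S (fun _ => rfl) hat hα⟩

end Existence

/-! ### Slicing a submanifold transversally. -/

section Straightening

variable {E A K Z : Type*} [NormedAddCommGroup E] [NormedSpace ℝ E] [FiniteDimensional ℝ E]
  [NormedAddCommGroup A] [NormedSpace ℝ A] [FiniteDimensional ℝ A]
  [NormedAddCommGroup K] [NormedSpace ℝ K] [FiniteDimensional ℝ K]
  [NormedAddCommGroup Z] [NormedSpace ℝ Z]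

/-- Let a coordinate system with values in `A × K × Z` map (an open part of) a linear subspace `V`
to a subset of `A × K × 0` that contains the `A`-axis. Then the slice of the image of `V` by the
`K`-axis is a submanifold. -/
theorem exists_straightening {Ψ : OpenPartialHomeomorph E (A × K × Z)} {a : E} {V : Submodule ℝ E}
    (hΨ : ContDiffOn ℝ ∞ Ψ Ψ.source) (hΨ' : ContDiffOn ℝ ∞ Ψ.symm Ψ.target) (ha : a ∈ Ψ.source)
    (hΨa : Ψ a = 0) (haV : a ∈ V) (hlevel : ∀ v ∈ V, v ∈ Ψ.source → (Ψ v).2.2 = 0)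
    (hfiber : ∀ᶠ f in 𝓝 (0 : A), Ψ.symm (f, 0, 0) ∈ V) :
    ∃ H : OpenPartialHomeomorph K K, 0 ∈ H.source ∧ ContDiffOn ℝ ∞ H H.source ∧
      ContDiffOn ℝ ∞ H.symm H.target ∧ ∃ T : Submodule ℝ K,
        Module.finrank ℝ V = Module.finrank ℝ A + Module.finrank ℝ T ∧
        ∀ k ∈ H.source, (0, k, 0) ∈ Ψ.target ∧ (Ψ.symm (0, k, 0) ∈ V ↔ H k ∈ T) := by
  have h0 : (0 : A × K × Z) ∈ Ψ.target := hΨa ▸ Ψ.map_source ha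
  have hΨ0 : Ψ.symm 0 = a := by rw [← hΨa, Ψ.left_inv ha]
  obtain ⟨D, hD⟩ : ∃ D, HasFDerivAt Ψ D a :=
    ⟨_, ((hΨ.contDiffAt (Ψ.open_source.mem_nhds ha)).differentiableAt (by simp)).hasFDerivAt⟩
  obtain ⟨D', hD'⟩ : ∃ D', HasFDerivAt Ψ.symm D' 0 :=
    ⟨_, ((hΨ'.contDiffAt (Ψ.open_target.mem_nhds h0)).differentiableAt (by simp)).hasFDerivAt⟩
  have hDD' : ∀ w, D (D' w) = w := fun w => by
    have h1 : HasFDerivAt (Ψ ∘ Ψ.symm) (D.comp D') 0 :=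
      HasFDerivAt.comp (g := Ψ) 0 (by rw [hΨ0]; exact hD) hD'
    have h2 : (Ψ ∘ Ψ.symm) =ᶠ[𝓝 0] id := by
      filter_upwards [Ψ.open_target.mem_nhds h0] with w hw using Ψ.right_inv hw
    exact DFunLike.congr_fun (h1.unique ((hasFDerivAt_id _).congr_of_eventuallyEq h2)) w
  have hD'D : ∀ v, D' (D v) = v := fun v => by
    have h1 : HasFDerivAt (Ψ.symm ∘ Ψ) (D'.comp D) a :=
      HasFDerivAt.comp (g := Ψ.symm) a (by rw [hΨa]; exact hD') hD
    have h2 : (Ψ.symm ∘ Ψ) =ᶠ[𝓝 a] id := by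
      filter_upwards [Ψ.open_source.mem_nhds ha] with w hw using Ψ.left_inv hw
    exact DFunLike.congr_fun (h1.unique ((hasFDerivAt_id _).congr_of_eventuallyEq h2)) v
  set b : V := ⟨a, haV⟩ with hb
  have hU : IsOpen ((↑) ⁻¹' Ψ.source : Set V) := Ψ.open_source.preimage continuous_subtype_val
  have hDV : HasFDerivAt (fun v : V => Ψ v) (D.comp V.subtypeL) b :=
    HasFDerivAt.comp (g := Ψ) b hD V.subtypeL.hasFDerivAt
  have hDlevel : ∀ v : V, (D v).2.2 = 0 := fun v => by
    have h1 : (fun v : V => (Ψ v).2.2) =ᶠ[𝓝 b] fun _ => 0 := by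
      filter_upwards [hU.mem_nhds ha] with v hv using hlevel v v.2 hv
    exact DFunLike.congr_fun
      (hDV.snd.snd.unique ((hasFDerivAt_const 0 _).congr_of_eventuallyEq h1)) v
  -- The `A`-axis is carried into `V` near `0`; composing with a projection onto `V` shows that its
  -- derivative also lands in `V`.
  have hD'fiber : ∀ f : A, D' (f, 0, 0) ∈ V := fun f => by
    obtain ⟨p, hp⟩ := Submodule.ClosedComplemented.of_finiteDimensional V
    have h1 : HasFDerivAt (fun f : A => Ψ.symm (f, 0, 0))
        (D'.comp (ContinuousLinearMap.inl ℝ A (K × Z))) 0 :=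
      HasFDerivAt.comp (g := Ψ.symm) 0 hD' (ContinuousLinearMap.inl ℝ A (K × Z)).hasFDerivAt
    have h2 : (fun f : A => ((p (Ψ.symm (f, 0, 0)) : V) : E)) =ᶠ[𝓝 0]
        fun f : A => Ψ.symm (f, 0, 0) := by
      filter_upwards [hfiber] with f hf
      exact congrArg Subtype.val (hp ⟨_, hf⟩)
    have h3 : HasFDerivAt (fun f : A => ((p (Ψ.symm (f, 0, 0)) : V) : E))
        ((V.subtypeL.comp p).comp (D'.comp (ContinuousLinearMap.inl ℝ A (K × Z)))) 0 :=
      HasFDerivAt.comp (g := V.subtypeL.comp p) 0 (V.subtypeL.comp p).hasFDerivAt h1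
    have h4 := DFunLike.congr_fun ((h1.congr_of_eventuallyEq h2).unique h3) f
    have h5 : D' (f, 0, 0) = ((p (D' (f, 0, 0)) : V) : E) := h4
    rw [h5]
    exact (p _).2
  set i : K →L[ℝ] E := D'.comp
    ((ContinuousLinearMap.inr ℝ A (K × Z)).comp (ContinuousLinearMap.inl ℝ K Z)) with hi
  have hik : ∀ k, i k = D' (0, k, 0) := fun k => rfl
  -- With `hDlevel` and `hD'fiber`, the image of `V` under `D` is `A × T × 0`.
  set T : Submodule ℝ K := V.comap (i : K →ₗ[ℝ] E) with hT
  have hTmem : ∀ k, k ∈ T ↔ D' (0, k, 0) ∈ V := fun k => Iff.rfl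
  obtain ⟨q, hq⟩ := Submodule.ClosedComplemented.of_finiteDimensional T
  set M : (A × K × Z) →L[ℝ] A × T := (ContinuousLinearMap.fst ℝ A (K × Z)).prod
    (q.comp ((ContinuousLinearMap.fst ℝ K Z).comp (ContinuousLinearMap.snd ℝ A (K × Z)))) with hM
  have hMw : ∀ w, M w = (w.1, q w.2.1) := fun w => rfl
  have hρ' : HasFDerivAt (fun v : V => M (Ψ v)) (M.comp (D.comp V.subtypeL)) b :=
    HasFDerivAt.comp (g := M) b M.hasFDerivAt hDV
  have hinj : Function.Injective (M.comp (D.comp V.subtypeL)) := by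
    rw [injective_iff_map_eq_zero]
    intro v hv
    obtain ⟨h1, h2⟩ := Prod.ext_iff.1 hv
    change (D v).1 = 0 at h1
    change q (D v).2.1 = 0 at h2
    have h3 : D v = (0, (D v).2.1, 0) := Prod.ext h1 (Prod.ext rfl (hDlevel v))
    have h4 : (D v).2.1 ∈ T := by rw [hTmem, ← h3, hD'D]; exact v.2
    have h5 := hq ⟨_, h4⟩
    have h6 : (D v).2.1 = 0 := by
      have := congrArg Subtype.val (h5.symm.trans h2)
      exact this
    rw [h6] at h3
    have h7 : (v : E) = 0 := by rw [← hD'D v, h3]; exact map_zero D'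
    exact Subtype.ext h7
  have hsurj : Function.Surjective (M.comp (D.comp V.subtypeL)) := by
    rintro ⟨f, t⟩
    have h1 : D' (f, (t : K), 0) ∈ V := by
      have h2 : ((f, (t : K), 0) : A × K × Z) = (f, 0, 0) + (0, (t : K), 0) := by simp
      rw [h2, map_add]
      exact V.add_mem (hD'fiber f) ((hTmem _).1 t.2)
    refine ⟨⟨_, h1⟩, ?_⟩
    change M (D (D' _)) = _
    rw [hDD', hMw]
    exact Prod.ext rfl (hq t)
  set R : V ≃L[ℝ] A × T :=
    (LinearEquiv.ofBijective (M.comp (D.comp V.subtypeL)).toLinearMap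
      ⟨hinj, hsurj⟩).toContinuousLinearEquiv with hR
  have hRe : (R : V →L[ℝ] A × T) = M.comp (D.comp V.subtypeL) := by ext1; rfl
  have hRsymm : ∀ t : T, ((R.symm (0, t) : V) : E) = D' (0, t, 0) := fun t => by
    have h1 : R ⟨D' (0, (t : K), 0), (hTmem _).1 t.2⟩ = (0, t) := by
      change M (D (D' _)) = _
      rw [hDD', hMw]
      exact Prod.ext rfl (hq t)
    rw [← h1, R.symm_apply_apply]
  have hρ : ContDiffOn ℝ ∞ (fun v : V => M (Ψ v)) ((↑) ⁻¹' Ψ.source : Set V) :=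
    M.contDiff.comp_contDiffOn (hΨ.comp V.subtypeL.contDiff.contDiffOn fun v hv => hv)
  obtain ⟨ρ, hbρ, hρU, hρe, -, hρs⟩ := exists_localDiffeo hU (a := b) ha hρ (f' := R)
    (by rw [hRe]; exact hρ')
  have hρb : ρ b = 0 := by
    rw [hρe, show Ψ (b : E) = 0 from hΨa, map_zero]
  have h0ρ : (0 : A × T) ∈ ρ.target := hρb ▸ ρ.map_source hbρ
  have hρ0 : ρ.symm 0 = b := by rw [← hρb, ρ.left_inv hbρ]
  -- Working with an open set of `E`, and not of `V`, lets the neighbourhood `W` contain points that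
  -- are not in the slice.
  obtain ⟨O, hO, hOρ⟩ := isOpen_induced_iff.1 ρ.open_source
  set jK : K →L[ℝ] A × K × Z :=
    (ContinuousLinearMap.inr ℝ A (K × Z)).comp (ContinuousLinearMap.inl ℝ K Z) with hjK
  have hjKk : ∀ k, jK k = (0, k, 0) := fun k => rfl
  set jT : K →L[ℝ] A × T := (ContinuousLinearMap.inr ℝ A T).comp q with hjT
  have hjTk : ∀ k, jT k = (0, q k) := fun k => rfl
  set W : Set K := jT ⁻¹' ρ.target ∩ jK ⁻¹' (Ψ.target ∩ Ψ.symm ⁻¹' O) with hW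
  have hWo : IsOpen W := (ρ.open_target.preimage jT.continuous).inter
    ((Ψ.isOpen_inter_preimage_symm hO).preimage jK.continuous)
  have hW0 : (0 : K) ∈ W := by
    refine ⟨by rw [mem_preimage, map_zero]; exact h0ρ, ?_⟩
    rw [mem_preimage, map_zero]
    refine ⟨h0, ?_⟩
    rw [mem_preimage, hΨ0]
    change b ∈ (↑) ⁻¹' O
    rw [hOρ]
    exact hbρ
  -- In the coordinates `ρ` the slice is parametrized by `T`; `c k` is its point whose projection to
  -- `T` is that of `k`. Thus near `0` the slice is the set where `c k = k`, a graph over `T`.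
  set c : K → K := fun k => (Ψ (ρ.symm (jT k))).2.1 with hc
  have hρc : ∀ k ∈ W, Ψ (ρ.symm (jT k)) = (0, c k, 0) ∧ q (c k) = q k := fun k hk => by
    have h1 := ρ.right_inv hk.1
    rw [hρe, hMw, hjTk] at h1
    obtain ⟨h2, h3⟩ := Prod.ext_iff.1 h1
    exact ⟨Prod.ext h2 (Prod.ext rfl (hlevel _ (ρ.symm _).2 (hρU (ρ.map_target hk.1)))), h3⟩
  have hcs : ContDiffOn ℝ ∞ c W := by
    have h1 : ContDiffOn ℝ ∞ (fun k => ((ρ.symm (jT k) : V) : E)) W :=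
      V.subtypeL.contDiff.comp_contDiffOn (hρs.comp jT.contDiff.contDiffOn fun k hk => hk.1)
    exact (hΨ.comp h1 fun k hk => hρU (ρ.map_target hk.1)).snd.fst
  have hcd : HasFDerivAt c (T.subtypeL.comp q) 0 := by
    have h1 : HasFDerivAt ρ.symm (R.symm : A × T →L[ℝ] V) 0 := by
      refine ρ.hasFDerivAt_symm h0ρ ?_
      rw [hρ0, hRe]
      exact hρ'.congr_of_eventuallyEq (Eventually.of_forall hρe)
    have h2 : HasFDerivAt (fun k => ρ.symm (jT k)) ((R.symm : A × T →L[ℝ] V).comp jT) 0 :=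
      HasFDerivAt.comp (g := ρ.symm) 0 (by rw [map_zero]; exact h1) jT.hasFDerivAt
    have h3 : HasFDerivAt (fun k => Ψ (ρ.symm (jT k)))
        ((D.comp V.subtypeL).comp ((R.symm : A × T →L[ℝ] V).comp jT)) 0 :=
      HasFDerivAt.comp (g := fun v : V => Ψ v) 0 (by rw [map_zero, hρ0]; exact hDV) h2
    refine h3.snd.fst.congr_fderiv (ContinuousLinearMap.ext fun k => ?_)
    change (D ((R.symm (0, q k) : V) : E)).2.1 = q k
    rw [hRsymm, hDD']
  -- The shear `k ↦ q k + (k - c k)` flattens the graph: `c` has derivative `q` at `0`, so the shear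
  -- is tangent to the identity.
  have hH : HasFDerivAt (fun k => (q k : K) + k - c k)
      ((ContinuousLinearEquiv.refl ℝ K : K ≃L[ℝ] K) : K →L[ℝ] K) 0 := by
    refine (((T.subtypeL.comp q).hasFDerivAt.add (hasFDerivAt_id 0)).sub hcd).congr_fderiv ?_
    ext k
    simp
  have hHs : ContDiffOn ℝ ∞ (fun k => (q k : K) + k - c k) W :=
    ((T.subtypeL.comp q).contDiff.contDiffOn.add contDiffOn_id).sub hcs
  obtain ⟨H, hH0, hHW, hHe, hHs1, hHs2⟩ := exists_localDiffeo hWo hW0 hHs hH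
  refine ⟨H, hH0, hHs1, hHs2, T, ?_, fun k hk => ?_⟩
  · rw [R.toLinearEquiv.finrank_eq, Module.finrank_prod]
  · have hkW := hHW hk
    obtain ⟨h1, h2⟩ := hρc k hkW
    have hΨk : Ψ (Ψ.symm ((0 : A), k, (0 : Z))) = (0, k, 0) := Ψ.right_inv hkW.2.1
    rw [hHe]
    -- Since `q (c k) = q k`, the difference `k - c k` lies in the kernel of the projection onto
    -- `T`, and belongs to `T` only if it is zero.
    have h3 : (q k : K) + k - c k ∈ T ↔ c k = k := by
      rw [add_sub_assoc, T.add_mem_iff_right (q k).2]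
      refine ⟨fun h => ?_, fun h => by rw [h, sub_self]; exact T.zero_mem⟩
      have h4 := hq ⟨_, h⟩
      change q (k - c k) = _ at h4
      rw [map_sub, h2, sub_self] at h4
      exact (sub_eq_zero.1 (congrArg Subtype.val h4).symm).symm
    rw [h3]
    refine ⟨hkW.2.1, ?_, ?_⟩
    · intro h
      have h5 : (⟨_, h⟩ : V) ∈ ρ.source := by
        rw [← hOρ]
        exact hkW.2.2
      have h6 : ρ ⟨_, h⟩ = jT k := by
        rw [hρe]
        change M (Ψ (Ψ.symm _)) = _
        rw [hΨk]
        rfl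
      change (Ψ (ρ.symm (jT k))).2.1 = k
      rw [← h6, ρ.left_inv h5]
      change (Ψ (Ψ.symm _)).2.1 = k
      rw [hΨk]
    · intro h
      rw [h] at h1
      rw [← h1, Ψ.left_inv (hρU (ρ.map_target hkW.1))]
      exact (ρ.symm (jT k)).2

end Straightening

/-- The velocity at `t = 0` sits over `Circle.exp 0 • x`; it has to be carried to the equal point
`x`. -/
theorem OneForm.ReebGeneratesFreeCircleAction.exists_reeb {E : Type*} [NormedAddCommGroup E]
    [NormedSpace ℝ E] {X : Type*} [TopologicalSpace X] [ChartedSpace E X] {α : OneForm E X}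
    (h : α.ReebGeneratesFreeCircleAction) (x : X) :
    ∃ R : E, α.ev x R = 1 ∧ ∀ w : E, α.d x R w = 0 := by
  obtain ⟨_, -, -, h⟩ := h
  have h1 : ∀ y, y = x → (∃ R : TangentSpace 𝓘(ℝ, E) y, α y R = 1 ∧ ∀ w, α.d y R w = 0) →
      ∃ R : E, α.ev x R = 1 ∧ ∀ w : E, α.d x R w = 0 := by
    rintro _ rfl h
    exact h
  exact h1 _ (by rw [Circle.exp_zero, one_smul]) ⟨_, h x⟩

/-! ### Uniqueness of the smooth structure. -/

section Uniqueness

variable {E F : Type*} [NormedAddCommGroup E] [NormedSpace ℝ E] [FiniteDimensional ℝ E]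
  [NormedAddCommGroup F] [NormedSpace ℝ F] [FiniteDimensional ℝ F]
  {G : Type*} [Group G] [TopologicalSpace G] [ChartedSpace F G] [LieGroup 𝓘(ℝ, F) ∞ G]
  {X : Type*} [TopologicalSpace X] [ChartedSpace E X] [IsManifold 𝓘(ℝ, E) ∞ X] [MulAction G X]
  [hGX : ContMDiffSMul 𝓘(ℝ, F) 𝓘(ℝ, E) ∞ G X] {α : OneForm E X}
  {k : ℕ} [ChartedSpace (EuclideanSpace ℝ (Fin k)) (ReducedSpace (F := F) G α)]
  [IsManifold 𝓘(ℝ, EuclideanSpace ℝ (Fin k)) ∞ (ReducedSpace (F := F) G α)]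
  {β : OneForm (EuclideanSpace ℝ (Fin k)) (ReducedSpace (F := F) G α)}

/-- The inverse chart is a plot, with `lift` as its lift, and plots are smooth for any reduction. -/
theorem IsReduction.contMDiffOn_redChart_symm (hβ : IsReduction G α k β) (hinv : α.IsInvariant G)
    {x : zeroLevel (F := F) G α} (s : SliceChart F G α (x : X)) :
    ContMDiffOn 𝓘(ℝ, ReducedModel E F) 𝓘(ℝ, EuclideanSpace ℝ (Fin k)) ∞ (s.redChart hinv).symm
      (s.redChart hinv).target :=
  (hβ.smooth_iff_plot _ (fun u => proj G α (s.lift u)) _ s.isOpen_base).2 fun _ hu =>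
    ⟨s.base, s.isOpen_base, hu, Subset.rfl, s.lift, s.contMDiffOn_lift, fun _ _ => rfl⟩

/-- The inverse of a chart `e` of the given structure is smooth, hence a plot, and lifts locally to
the zero level. The lift followed by projection and the slice chart is smooth, and precomposing with
`e` recovers the slice chart. -/
theorem IsReduction.contMDiffOn_redChart (hβ : IsReduction G α k β) (hinv : α.IsInvariant G)
    {x : zeroLevel (F := F) G α} (s : SliceChart F G α (x : X)) :
    ContMDiffOn 𝓘(ℝ, EuclideanSpace ℝ (Fin k)) 𝓘(ℝ, ReducedModel E F) ∞ (s.redChart hinv)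
      (s.redChart hinv).source := by
  intro q hq
  set e := chartAt (EuclideanSpace ℝ (Fin k)) q with he
  have hqe : q ∈ e.source := mem_chart_source _ q
  have h1 : ContMDiffOn 𝓘(ℝ, EuclideanSpace ℝ (Fin k)) 𝓘(ℝ, EuclideanSpace ℝ (Fin k)) ∞ e.symm
      e.target := contMDiffOn_chart_symm
  obtain ⟨V, hV, hqV, -, P, hP, hPe⟩ :=
    (hβ.smooth_iff_plot _ _ _ e.open_target).1 h1 (e q) (e.map_source hqe)
  have hPq : proj G α (P (e q)) = q := by rw [hPe _ hqV, e.left_inv hqe]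
  have h2 := s.contMDiffAt_redChart_proj hinv (hP.contMDiffAt (hV.mem_nhds hqV))
    (by rw [hPq]; exact hq)
  have h3 : ContMDiffAt 𝓘(ℝ, EuclideanSpace ℝ (Fin k)) 𝓘(ℝ, EuclideanSpace ℝ (Fin k)) ∞ e q :=
    (contMDiffOn_chart (I := 𝓘(ℝ, EuclideanSpace ℝ (Fin k)))).contMDiffAt
      (e.open_source.mem_nhds hqe)
  refine ((h2.contMDiffAt.comp q h3).congr_of_eventuallyEq ?_).contMDiffWithinAt
  filter_upwards [e.open_source.mem_nhds hqe,
    e.continuousAt hqe (hV.mem_nhds hqV)] with r hr hrV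
  rw [Function.comp_apply, hPe _ hrV, e.left_inv hr]

/-- A slice chart is a diffeomorphism for the given structure, so its derivative at one point
identifies the model spaces. -/
theorem IsReduction.eq_reducedDim (hβ : IsReduction G α k β) (hinv : α.IsInvariant G)
    {x : zeroLevel (F := F) G α} (s : SliceChart F G α (x : X)) : k = reducedDim E F := by
  have hd : (s.redChart hinv).MDifferentiable 𝓘(ℝ, EuclideanSpace ℝ (Fin k))
      𝓘(ℝ, ReducedModel E F) :=
    ⟨(hβ.contMDiffOn_redChart hinv s).mdifferentiableOn (by simp),
      (hβ.contMDiffOn_redChart_symm hinv s).mdifferentiableOn (by simp)⟩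
  have h1 : EuclideanSpace ℝ (Fin k) ≃L[ℝ] ReducedModel E F :=
    hd.mfderiv (s.proj_self_mem_source hinv)
  simpa [ReducedModel] using h1.toLinearEquiv.finrank_eq

end Uniqueness

/-! ### Uniqueness of the reduced form. -/

section ReducedForm

variable {E F : Type*} [NormedAddCommGroup E] [NormedSpace ℝ E] [FiniteDimensional ℝ E]
  [NormedAddCommGroup F] [NormedSpace ℝ F] [FiniteDimensional ℝ F]
  {G : Type*} [Group G] [TopologicalSpace G] [ChartedSpace F G] [LieGroup 𝓘(ℝ, F) ∞ G]
  {X : Type*} [TopologicalSpace X] [ChartedSpace E X] [IsManifold 𝓘(ℝ, E) ∞ X] [MulAction G X]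
  [hGX : ContMDiffSMul 𝓘(ℝ, F) 𝓘(ℝ, E) ∞ G X] {α : OneForm E X}
  [ChartedSpace (ReducedModel E F) (ReducedSpace (F := F) G α)]
  [IsManifold 𝓘(ℝ, ReducedModel E F) ∞ (ReducedSpace (F := F) G α)]
  {β : OneForm (ReducedModel E F) (ReducedSpace (F := F) G α)}

theorem IsReduction.redChart_mem_maximalAtlas (hβ : IsReduction G α (reducedDim E F) β)
    (hinv : α.IsInvariant G) {x : zeroLevel (F := F) G α} (s : SliceChart F G α (x : X)) :
    s.redChart hinv ∈
      IsManifold.maximalAtlas 𝓘(ℝ, ReducedModel E F) ∞ (ReducedSpace (F := F) G α) :=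
  (s.redChart hinv).mem_maximalAtlas_of_contMDiffOn (hβ.contMDiffOn_redChart hinv s)
    (hβ.contMDiffOn_redChart_symm hinv s)

/-- Both forms have the same pull-back along `lift`, and `proj ∘ lift` is a diffeomorphism onto its
image, so every tangent vector is tested. -/
theorem IsReduction.eq_redForm (hβ : IsReduction G α (reducedDim E F) β)
    (hinv : α.IsInvariant G) (S : ∀ x : zeroLevel (F := F) G α, SliceChart F G α (x : X)) :
    β = redForm hinv S := by
  funext q
  refine ContinuousLinearMap.ext fun w => ?_
  set s := S q.out with hs
  set κ := s.redChart hinv with hκ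
  have hq : q ∈ κ.source := mem_redChart_out_source hinv S q
  have hb : κ q ∈ s.base := s.redChart_mem_base hinv hq
  have hat : ∀ x, (S x).redChart hinv ∈
      IsManifold.maximalAtlas 𝓘(ℝ, ReducedModel E F) ∞ (ReducedSpace (F := F) G α) :=
    fun x => hβ.redChart_mem_maximalAtlas hinv (S x)
  set v : ReducedModel E F :=
    mfderiv 𝓘(ℝ, ReducedModel E F) 𝓘(ℝ, ReducedModel E F) κ q w with hv
  have h1 : β.ev (proj G α (s.lift (κ q))) (vel (fun k => proj G α (s.lift k)) (κ q) v) =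
      α.ev (s.lift (κ q) : X) (vel (fun k => (s.lift k : X)) (κ q) v) :=
    hβ.pullback_eq _ s.lift s.base s.isOpen_base s.contMDiffOn_lift (κ q) hb v
  have h2 := redForm_ev_proj hinv S hat (P := s.lift) (u := κ q)
    (s.contMDiffOn_lift.contMDiffAt (s.isOpen_base.mem_nhds hb)) v
  have h5 : vel (E := ReducedModel E F) (fun k => proj G α (s.lift k)) (κ q) v = w := by
    have hd : κ.MDifferentiable 𝓘(ℝ, ReducedModel E F) 𝓘(ℝ, ReducedModel E F) :=
      ⟨(hβ.contMDiffOn_redChart hinv s).mdifferentiableOn (by simp),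
        (hβ.contMDiffOn_redChart_symm hinv s).mdifferentiableOn (by simp)⟩
    exact DFunLike.congr_fun (hd.symm_comp_deriv hq) w
  have h6 : proj G α (s.lift (κ q)) = q := s.proj_lift_redChart hinv hq
  rw [h5, h6] at h1 h2
  exact h1.trans h2.symm

end ReducedForm

/-! ### Legendrian submanifolds upstairs and downstairs. -/

section Legendrian

variable {E F : Type*} [NormedAddCommGroup E] [NormedSpace ℝ E] [FiniteDimensional ℝ E]
  [NormedAddCommGroup F] [NormedSpace ℝ F] [FiniteDimensional ℝ F]
  {G : Type*} [Group G] [TopologicalSpace G] [ChartedSpace F G]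
  {X : Type*} [TopologicalSpace X] [ChartedSpace E X] [MulAction G X]
  {α : OneForm E X}

theorem coe_mem_liftSet {M : Set (ReducedSpace (F := F) G α)} {c : zeroLevel (F := F) G α} :
    (c : X) ∈ liftSet G α M ↔ proj G α c ∈ M :=
  ⟨fun ⟨_, h, hc⟩ => Subtype.ext hc ▸ h, fun h => ⟨c, h, rfl⟩⟩

theorem liftSet_subset_zeroLevel (M : Set (ReducedSpace (F := F) G α)) :
    liftSet G α M ⊆ zeroLevel (F := F) G α := by
  rintro _ ⟨c, -, rfl⟩
  exact c.2

theorem injective_liftSet : Function.Injective (liftSet (F := F) G α) := fun _ _ h =>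
  proj_surjective.preimage_injective (Subtype.val_injective.image_injective h)

theorem smul_mem_liftSet [LieGroup 𝓘(ℝ, F) ∞ G] [IsManifold 𝓘(ℝ, E) ∞ X]
    [hGX : ContMDiffSMul 𝓘(ℝ, F) 𝓘(ℝ, E) ∞ G X] (hinv : α.IsInvariant G)
    {M : Set (ReducedSpace (F := F) G α)} (g : G) {x : X} (hx : x ∈ liftSet G α M) :
    g • x ∈ liftSet G α M := by
  obtain ⟨c, hc, rfl⟩ := hx
  refine ⟨⟨g • (c : X), hinv.smul_mem_zeroLevel g c.2⟩, ?_, rfl⟩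
  have h : proj G α c = proj G α ⟨g • (c : X), hinv.smul_mem_zeroLevel g c.2⟩ :=
    proj_eq_iff.2 ⟨g, rfl⟩
  rwa [mem_preimage, ← h]

theorem proj_mem_image_iff {L : Set X} (hLG : ∀ g : G, ∀ x ∈ L, g • x ∈ L)
    {c : zeroLevel (F := F) G α} : proj G α c ∈ proj G α '' (Subtype.val ⁻¹' L) ↔ (c : X) ∈ L := by
  constructor
  · rintro ⟨d, hd, h⟩
    obtain ⟨g, hg⟩ := proj_eq_iff.1 h
    exact hg ▸ hLG g _ hd
  · exact fun h => ⟨c, h, rfl⟩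

theorem liftSet_image {L : Set X} (hLG : ∀ g : G, ∀ x ∈ L, g • x ∈ L)
    (hL : L ⊆ zeroLevel (F := F) G α) : liftSet (F := F) G α (proj G α '' (Subtype.val ⁻¹' L)) = L := by
  ext x
  constructor
  · rintro ⟨c, hc, rfl⟩
    exact (proj_mem_image_iff hLG).1 hc
  · exact fun hx => ⟨⟨x, hL hx⟩, (proj_mem_image_iff hLG).2 hx, rfl⟩

variable [LieGroup 𝓘(ℝ, F) ∞ G] [IsManifold 𝓘(ℝ, E) ∞ X]
  [hGX : ContMDiffSMul 𝓘(ℝ, F) 𝓘(ℝ, E) ∞ G X]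

/-- An invariant submanifold on which the `1`-form vanishes lies in the zero level of the moment
map. -/
theorem OneForm.IsLegendrian.subset_zeroLevel {L : Set X} (hL : α.IsLegendrian L)
    (hLG : ∀ g : G, ∀ x ∈ L, g • x ∈ L) : L ⊆ zeroLevel (F := F) G α := by
  intro x hx
  refine ContinuousLinearMap.ext fun (Z : F) => ?_
  have hl : ContDiff ℝ ∞ fun t : ℝ => t • Z := by fun_prop
  -- Invariance keeps the curve `groupParam G (t • Z) • x` in `L`. Its velocity at `0` is the
  -- infinitesimal action of `Z`, so the vanishing of the form on it is the vanishing of the moment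
  -- map at `Z`.
  set U : Set ℝ := (fun t : ℝ => t • Z) ⁻¹' groupParamDomain F G with hU
  have hUo : IsOpen U := isOpen_groupParamDomain.preimage hl.continuous
  have h0 : (0 : ℝ) ∈ U := by
    rw [hU, mem_preimage, zero_smul]
    exact zero_mem_groupParamDomain
  have h1 : ContMDiffOn 𝓘(ℝ, ℝ) 𝓘(ℝ, E) ∞ (fun t : ℝ => groupParam G (t • Z) • x) U :=
    (contMDiff_orbitMap G X x).comp_contMDiffOn
      (contMDiffOn_groupParam.comp hl.contMDiff.contMDiffOn fun t ht => ht)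
  have h2 : α.ev (groupParam G ((0 : ℝ) • Z) • x)
      (vel (fun t : ℝ => groupParam G (t • Z) • x) 0 1) = 0 :=
    hL.vanishes _ U hUo h1 (fun t _ => hLG _ _ hx) 0 h0
  have h3 : MDifferentiableAt 𝓘(ℝ, F) 𝓘(ℝ, E) (fun f : F => groupParam G f • x) ((0 : ℝ) • Z) :=
    mdifferentiableAt_smul_const (mdifferentiableAt_groupParam h0) x
  have h4 := vel_comp (f := fun t : ℝ => t • Z) (z := 0) h3 (by fun_prop) 1
  have h5 : fderiv ℝ (fun t : ℝ => t • Z) 0 1 = Z := by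
    have : HasFDerivAt (fun t : ℝ => t • Z) ((1 : ℝ →L[ℝ] ℝ).smulRight Z) 0 :=
      ((1 : ℝ →L[ℝ] ℝ).smulRight Z).hasFDerivAt
    rw [this.fderiv]
    simp
  rw [h5, zero_smul] at h4
  have h6 : vel (E := E) (fun t : ℝ => groupParam G (t • Z) • x) 0 1 =
      vel (fun f : F => groupParam G f • x) 0 Z := h4
  rw [h6, zero_smul, groupParam_zero, one_smul] at h2
  exact (momentMap_eq α x Z).trans h2

variable [ChartedSpace (ReducedModel E F) (ReducedSpace (F := F) G α)]
  [IsManifold 𝓘(ℝ, ReducedModel E F) ∞ (ReducedSpace (F := F) G α)]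
  (hinv : α.IsInvariant G) (S : ∀ x : zeroLevel (F := F) G α, SliceChart F G α (x : X))
  (hat : ∀ x, (S x).redChart hinv ∈
    IsManifold.maximalAtlas 𝓘(ℝ, ReducedModel E F) ∞ (ReducedSpace (F := F) G α))

theorem finrank_prod_submodule {A B C : Type*} [AddCommGroup A] [Module ℝ A]
    [AddCommGroup B] [Module ℝ B] [AddCommGroup C] [Module ℝ C] [FiniteDimensional ℝ A]
    [FiniteDimensional ℝ B] (V : Submodule ℝ B) :
    Module.finrank ℝ ((⊤ : Submodule ℝ A).prod (V.prod (⊥ : Submodule ℝ C))) =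
      Module.finrank ℝ A + Module.finrank ℝ V := by
  rw [← Module.finrank_prod]
  refine LinearEquiv.finrank_eq
    { toFun := fun w => (w.1.1, ⟨w.1.2.1, w.2.2.1⟩)
      invFun := fun w => ⟨(w.1, w.2, 0), trivial, w.2.2, rfl⟩
      map_add' := fun _ _ => rfl
      map_smul' := fun _ _ => rfl
      left_inv := fun w => Subtype.ext (Prod.ext rfl (Prod.ext rfl
        ((Submodule.mem_bot ℝ).1 w.2.2.2).symm))
      right_inv := fun _ => rfl }

-- In a slice chart the lift is cut out by moment coordinate `0` and reduced coordinate in `M`.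
-- Straightening `M` in the reduced coordinate alone turns it into the linear subspace `F × V × 0`.
include hat in
theorem isSubmanifoldAt_liftSet (hdim : Module.finrank ℝ E =
      2 * Module.finrank ℝ F + reducedDim E F) {M : Set (ReducedSpace (F := F) G α)}
    {c : zeroLevel (F := F) G α} {d : ℕ}
    (hM : IsSubmanifoldAt (ReducedModel E F) d M (proj G α c)) :
    IsSubmanifoldAt E (Module.finrank ℝ F + d) (liftSet G α M) (c : X) := by
  obtain ⟨e, he, hce, V, hV, hVM⟩ := hM
  set s := S c with hs
  set κ := s.redChart hinv with hκ
  set δ := κ.symm.trans e with hδ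
  have hδs : ContDiffOn ℝ ∞ δ δ.source := contMDiffOn_iff_contDiffOn.1 <|
    (contMDiffOn_of_mem_maximalAtlas he).comp
      ((contMDiffOn_symm_of_mem_maximalAtlas (hat c)).mono fun _ h => h.1) fun _ h => h.2
  have hδs' : ContDiffOn ℝ ∞ δ.symm δ.target := contMDiffOn_iff_contDiffOn.1 <|
    (contMDiffOn_of_mem_maximalAtlas (hat c)).comp
      ((contMDiffOn_symm_of_mem_maximalAtlas he).mono fun _ h => h.1) fun _ h => h.2
  let Φ : OpenPartialHomeomorph (SliceModel E F) (SliceModel E F) :=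
    (OpenPartialHomeomorph.refl F).prod (δ.prod (OpenPartialHomeomorph.refl (F →L[ℝ] ℝ)))
  have hΦs : ContDiffOn ℝ ∞ Φ Φ.source := contDiffOn_fst.prodMk
    ((hδs.comp (contDiff_fst.comp contDiff_snd).contDiffOn fun _ h => h.2.1).prodMk
      (contDiff_snd.comp contDiff_snd).contDiffOn)
  have hΦs' : ContDiffOn ℝ ∞ Φ.symm Φ.target := contDiffOn_fst.prodMk
    ((hδs'.comp (contDiff_fst.comp contDiff_snd).contDiffOn fun _ h => h.2.1).prodMk
      (contDiff_snd.comp contDiff_snd).contDiffOn)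
  -- Any linear isomorphism serves: it only returns the coordinates to the model space `E` of the
  -- atlas.
  let Λ : SliceModel E F ≃L[ℝ] E := ContinuousLinearEquiv.ofFinrankEq (by
    have h1 : Module.finrank ℝ (F →L[ℝ] ℝ) = Module.finrank ℝ F := by
      rw [(LinearMap.toContinuousLinearMap (𝕜 := ℝ) (E := F) (F' := ℝ)).symm.finrank_eq]
      exact Subspace.dual_finrank_eq
    rw [Module.finrank_prod, Module.finrank_prod, h1, hdim]
    simp only [ReducedModel, finrank_euclideanSpace, Fintype.card_fin]
    omega)
  let ψ : OpenPartialHomeomorph X E :=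
    s.chart.trans (Φ.trans Λ.toHomeomorph.toOpenPartialHomeomorph)
  refine ⟨ψ, ψ.mem_maximalAtlas_of_contMDiffOn ?_ ?_, ?_,
    ((⊤ : Submodule ℝ F).prod (V.prod ⊥)).map (Λ : SliceModel E F →ₗ[ℝ] E), ?_, fun y hy => ?_⟩
  · exact Λ.contDiff.contMDiff.comp_contMDiffOn (hΦs.contMDiffOn.comp
      (s.contMDiffOn.mono fun _ h => h.1) fun _ h => h.2.1)
  · exact s.contMDiffOn_symm.comp (hΦs'.contMDiffOn.comp
      (Λ.symm.contDiff.contMDiff.contMDiffOn) fun _ h => h.1.2) fun _ h => h.2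
  · have h1 : s.chart c ∈ Φ.source := by
      rw [s.chart_self]
      refine ⟨trivial, ⟨s.zero_mem_base, ?_⟩, trivial⟩
      change proj G α (s.lift 0) ∈ e.source
      rwa [s.lift_zero]
    exact ⟨s.mem_source, h1, trivial⟩
  · rw [← hV, ← finrank_prod_submodule (A := F) (C := F →L[ℝ] ℝ) V]
    exact Λ.toLinearEquiv.finrank_map_eq _
  · have hys : y ∈ s.chart.source := hy.1
    have hye : proj G α (s.lift (s.chart y).2.1) ∈ e.source := hy.2.1.2.1.2
    have h1 : ψ y ∈ ((⊤ : Submodule ℝ F).prod (V.prod ⊥)).map (Λ : SliceModel E F →ₗ[ℝ] E) ↔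
        e (proj G α (s.lift (s.chart y).2.1)) ∈ V ∧ (s.chart y).2.2 = 0 := by
      constructor
      · rintro ⟨w, hw, hwy⟩
        have h2 : w = Φ (s.chart y) := Λ.injective hwy
        rw [h2] at hw
        exact ⟨hw.2.1, (Submodule.mem_bot ℝ).1 hw.2.2⟩
      · rintro ⟨h2, h3⟩
        exact ⟨Φ (s.chart y), ⟨trivial, h2, (Submodule.mem_bot ℝ).2 h3⟩, rfl⟩
    rw [h1, ← s.mem_zeroLevel_iff y hys, ← hVM _ hye]
    constructor
    · intro h
      have hyC := liftSet_subset_zeroLevel M h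
      rw [s.proj_lift (y := ⟨y, hyC⟩) hys]
      exact ⟨coe_mem_liftSet.1 h, hyC⟩
    · rintro ⟨h, hyC⟩
      rw [s.proj_lift (y := ⟨y, hyC⟩) hys] at h
      exact coe_mem_liftSet.2 h

-- Dimensions match because `2 (dim F + d) + 1 = 2 dim F + (2 d + 1)`. A curve in the lift projects
-- to a curve in `M`, and the pull-back formula compares the two forms.
open Classical in
include hat in
theorem isLegendrian_liftSet (hdim : ∀ x ∈ zeroLevel (F := F) G α, Module.finrank ℝ E =
      2 * Module.finrank ℝ F + reducedDim E F) {M : Set (ReducedSpace (F := F) G α)}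
    (hM : (redForm hinv S).IsLegendrian M) : α.IsLegendrian (liftSet G α M) where
  submanifold := by
    rintro _ ⟨c, hc, rfl⟩
    obtain ⟨d, hd, h⟩ := hM.submanifold _ hc
    refine ⟨_, ?_, isSubmanifoldAt_liftSet hinv S hat (hdim c c.2) h⟩
    simp only [ReducedModel, finrank_euclideanSpace, Fintype.card_fin] at hd
    rw [hdim c c.2]
    omega
  vanishes γ U hU hγ hγM t ht := by
    have hC : ∀ u ∈ U, γ u ∈ zeroLevel (F := F) G α := fun u hu =>
      liftSet_subset_zeroLevel M (hγM hu)
    -- Outside `U` the curve may leave the level; the constant `γ t` fills in there.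
    set c : ℝ → zeroLevel (F := F) G α := fun u =>
      if h : γ u ∈ zeroLevel (F := F) G α then ⟨γ u, h⟩ else ⟨γ t, hC t ht⟩ with hc
    have hcγ : ∀ u ∈ U, (c u : X) = γ u := fun u hu => by simp [hc, hC u hu]
    have hcs : ContMDiffOn 𝓘(ℝ, ℝ) 𝓘(ℝ, E) ∞ (fun u => (c u : X)) U := hγ.congr hcγ
    have h1 := hM.vanishes (fun u => proj G α (c u)) U hU (fun u hu =>
      (contMDiffAt_proj hinv S hat (hcs.contMDiffAt (hU.mem_nhds hu))).contMDiffWithinAt)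
      (fun u hu => coe_mem_liftSet.1 (by rw [hcγ u hu]; exact hγM hu)) t ht
    have h2 := redForm_ev_proj hinv S hat (hcs.contMDiffAt (hU.mem_nhds ht)) 1
    have h3 : (fun u => (c u : X)) =ᶠ[𝓝 t] γ := by
      filter_upwards [hU.mem_nhds ht] with u hu using hcγ u hu
    have h4 := h2.symm.trans h1
    rw [vel_congr h3, hcγ t ht] at h4
    exact h4

-- In slice coordinates `L` has zero moment and contains the orbit axis through `c`, so
-- `exists_straightening` applies to its trace on the reduced coordinates. By invariance that trace
-- is the image of `L` in the quotient chart.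
include hat in
theorem isSubmanifoldAt_image {L : Set X} (hLG : ∀ g : G, ∀ x ∈ L, g • x ∈ L)
    (hLC : L ⊆ zeroLevel (F := F) G α) {c : zeroLevel (F := F) G α} (hc : (c : X) ∈ L) {d : ℕ}
    (hL : IsSubmanifoldAt E d L (c : X)) :
    ∃ d', d = Module.finrank ℝ F + d' ∧
      IsSubmanifoldAt (ReducedModel E F) d' (proj G α '' (Subtype.val ⁻¹' L)) (proj G α c) := by
  obtain ⟨e, he, hce, V, hV, hVL⟩ := hL
  set s := S c with hs
  set κ := s.redChart hinv with hκ
  have hsc : c.1 ∈ s.chart.source := s.mem_source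
  let Ψ : OpenPartialHomeomorph E (SliceModel E F) := e.symm.trans s.chart
  have ha : e c ∈ Ψ.source := by
    refine ⟨e.map_source hce, ?_⟩
    change e.symm (e c) ∈ s.chart.source
    rwa [e.left_inv hce]
  have hΨa : Ψ (e c) = 0 := by
    change s.chart (e.symm (e c)) = 0
    rw [e.left_inv hce, s.chart_self]
  have hΨs : ContDiffOn ℝ ∞ Ψ Ψ.source := contMDiffOn_iff_contDiffOn.1 <|
    s.contMDiffOn.comp ((contMDiffOn_symm_of_mem_maximalAtlas he).mono fun _ h => h.1)
      fun _ h => h.2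
  have hΨs' : ContDiffOn ℝ ∞ Ψ.symm Ψ.target := contMDiffOn_iff_contDiffOn.1 <|
    (contMDiffOn_of_mem_maximalAtlas he).comp (s.contMDiffOn_symm.mono fun _ h => h.1)
      fun _ h => h.2
  have hlevel : ∀ v ∈ V, v ∈ Ψ.source → (Ψ v).2.2 = 0 := fun v hv hvs => by
    refine (s.mem_zeroLevel_iff (e.symm v) hvs.2).1 (hLC ?_)
    rwa [hVL _ (e.map_target hvs.1), e.right_inv hvs.1]
  have hmem : ∀ p ∈ Ψ.target, s.chart.symm p ∈ s.chart.source ∧ s.chart.symm p ∈ e.source ∧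
      s.chart (s.chart.symm p) = p := fun p hp =>
    ⟨s.chart.map_target hp.1, hp.2, s.chart.right_inv hp.1⟩
  -- Points of this axis lie in the level and share the reduced coordinate of `c`, so they are in
  -- its orbit, which `L` contains.
  have hfiber : ∀ᶠ f in 𝓝 (0 : F), Ψ.symm (f, 0, 0) ∈ V := by
    have h1 : ContinuousAt (fun f : F => ((f, 0, 0) : SliceModel E F)) 0 := by fun_prop
    have h0 : (0 : SliceModel E F) ∈ Ψ.target := hΨa ▸ Ψ.map_source ha
    filter_upwards [h1 (Ψ.open_target.mem_nhds h0)] with f hf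
    obtain ⟨h2, h3, h4⟩ := hmem _ hf
    have h5 : s.chart.symm (f, 0, 0) ∈ zeroLevel (F := F) G α := by
      rw [s.mem_zeroLevel_iff _ h2, h4]
    obtain ⟨g, hg⟩ := (s.orbit_iff _ hsc _ h2 c.2 h5).2 (by rw [h4, s.chart_self]; rfl)
    exact (hVL _ h3).1 (hg ▸ hLG g _ hc)
  obtain ⟨H, hH0, hHs, hHs', T, hT, hHT⟩ :=
    exists_straightening hΨs hΨs' ha hΨa ((hVL _ hce).1 hc) hlevel hfiber
  refine ⟨Module.finrank ℝ T, hV ▸ hT, κ.trans H, ?_, ?_, T, rfl, fun q hq => ?_⟩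
  · refine (κ.trans H).mem_maximalAtlas_of_contMDiffOn ?_ ?_
    · exact hHs.contMDiffOn.comp
        ((contMDiffOn_of_mem_maximalAtlas (hat c)).mono fun _ h => h.1) fun _ h => h.2
    · exact (contMDiffOn_symm_of_mem_maximalAtlas (hat c)).comp
        (hHs'.contMDiffOn.mono fun _ h => h.1) fun _ h => h.2
  · refine ⟨s.proj_self_mem_source hinv, ?_⟩
    change κ (proj G α c) ∈ H.source
    rwa [s.redChart_proj_self]
  · have hb : κ q ∈ s.base := s.redChart_mem_base hinv hq.1
    obtain ⟨h1, h2⟩ := hHT (κ q) hq.2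
    obtain ⟨h3, h4, h5⟩ := hmem _ h1
    refine Iff.trans ?_ h2
    change _ ↔ e (s.chart.symm (0, κ q, 0)) ∈ V
    rw [← hVL _ h4, ← s.coe_lift hb, ← proj_mem_image_iff (F := F) (α := α) hLG,
      s.proj_lift_redChart hinv hq.1]

-- A curve in the image lifts locally, through a section `lift`, to a curve that lies in `L` by
-- invariance; there `α` vanishes.
include hat in
theorem isLegendrian_image (hdim : ∀ x ∈ zeroLevel (F := F) G α, Module.finrank ℝ E =
      2 * Module.finrank ℝ F + reducedDim E F) {L : Set X} (hL : α.IsLegendrian L)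
    (hLG : ∀ g : G, ∀ x ∈ L, g • x ∈ L) :
    (redForm hinv S).IsLegendrian (proj G α '' (Subtype.val ⁻¹' L)) where
  submanifold := by
    rintro _ ⟨c, hc, rfl⟩
    obtain ⟨d, hd, h⟩ := hL.submanifold _ hc
    obtain ⟨d', hd', h'⟩ :=
      isSubmanifoldAt_image hinv S hat hLG (hL.subset_zeroLevel hLG) hc h
    refine ⟨d', ?_, h'⟩
    simp only [ReducedModel, finrank_euclideanSpace, Fintype.card_fin]
    rw [hdim c c.2] at hd
    omega
  vanishes γ U hU hγ hγM t ht := by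
    obtain ⟨x, hx⟩ := proj_surjective (γ t)
    set s := S x with hs
    have hts : γ t ∈ (s.redChart hinv).source := hx ▸ s.proj_self_mem_source hinv
    set V := U ∩ γ ⁻¹' (s.redChart hinv).source with hV
    have hVo : IsOpen V :=
      hγ.continuousOn.isOpen_inter_preimage hU (s.redChart hinv).open_source
    have htV : t ∈ V := ⟨ht, hts⟩
    set c : ℝ → zeroLevel (F := F) G α := fun u => s.lift (s.redChart hinv (γ u)) with hc
    have hcγ : ∀ u ∈ V, proj G α (c u) = γ u := fun u hu => s.proj_lift_redChart hinv hu.2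
    have hcs : ContMDiffOn 𝓘(ℝ, ℝ) 𝓘(ℝ, E) ∞ (fun u => (c u : X)) V :=
      s.contMDiffOn_lift.comp ((contMDiffOn_of_mem_maximalAtlas (hat x)).comp
        (hγ.mono inter_subset_left) fun v hv => hv.2) fun v hv => s.redChart_mem_base hinv hv.2
    have h1 := hL.vanishes (fun u => (c u : X)) V hVo hcs
      (fun u hu => (proj_mem_image_iff hLG).1 (by rw [hcγ u hu]; exact hγM hu.1)) t htV
    have h2 := redForm_ev_proj hinv S hat (hcs.contMDiffAt (hVo.mem_nhds htV)) 1
    have h3 : (fun u => proj G α (c u)) =ᶠ[𝓝 t] γ := by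
      filter_upwards [hVo.mem_nhds htV] with u hu using hcγ u hu
    have h4 := h2.trans h1
    rw [vel_congr h3, hcγ t htV] at h4
    exact h4

include hat in
theorem bijOn_liftSet (hdim : ∀ x ∈ zeroLevel (F := F) G α, Module.finrank ℝ E =
      2 * Module.finrank ℝ F + reducedDim E F) :
    BijOn (liftSet G α) {M | (redForm hinv S).IsLegendrian M}
      {L : Set X | α.IsLegendrian L ∧ ∀ g : G, ∀ x ∈ L, g • x ∈ L} :=
  ⟨fun _ hM => ⟨isLegendrian_liftSet hinv S hat hdim hM,
      fun g _ hx => smul_mem_liftSet hinv g hx⟩,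
    injective_liftSet.injOn,
    fun _ hL => ⟨_, isLegendrian_image hinv S hat hdim hL.1 hL.2,
      liftSet_image hL.2 (hL.1.subset_zeroLevel hL.2)⟩⟩

end Legendrian

end PrequantumReduction

end

/-! ### The reduction theorem. -/

theorem mainTheorem11
    {E F : Type*} [NormedAddCommGroup E] [NormedSpace ℝ E] [FiniteDimensional ℝ E]
    [NormedAddCommGroup F] [NormedSpace ℝ F] [FiniteDimensional ℝ F]
    (G : Type*) [Group G] [TopologicalSpace G] [ChartedSpace F G] [LieGroup 𝓘(ℝ, F) ∞ G]
    {X : Type*} [TopologicalSpace X] [T2Space X] [ChartedSpace E X] [IsManifold 𝓘(ℝ, E) ∞ X]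
    [MulAction G X] (α : PrequantumReduction.OneForm E X)
    (hα : PrequantumReduction.IsPrequantumSpace (F := F) G α)
    (hfree : PrequantumReduction.ActsFreelyOnZeroLevel (F := F) G α)
    (hproper : PrequantumReduction.ActsProperlyOnZeroLevel (F := F) G α) :
    -- the reduced space is a manifold carrying a reduced 1-form, which is a contact form
    (T2Space (PrequantumReduction.ReducedSpace (F := F) G α) ∧
      (SecondCountableTopology X →
        SecondCountableTopology (PrequantumReduction.ReducedSpace (F := F) G α)) ∧
      ∃ (k : ℕ) (_ : ChartedSpace (EuclideanSpace ℝ (Fin k))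
          (PrequantumReduction.ReducedSpace (F := F) G α))
        (_ : IsManifold 𝓘(ℝ, EuclideanSpace ℝ (Fin k)) ∞
          (PrequantumReduction.ReducedSpace (F := F) G α))
        (β : PrequantumReduction.OneForm (EuclideanSpace ℝ (Fin k))
          (PrequantumReduction.ReducedSpace (F := F) G α)),
        PrequantumReduction.IsReduction G α k β ∧ β.IsContact) ∧
    -- for this structure, `M ↦ π⁻¹(M)` is a bijection between Legendrian submanifolds
    ∀ (k : ℕ) [ChartedSpace (EuclideanSpace ℝ (Fin k))
        (PrequantumReduction.ReducedSpace (F := F) G α)]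
      [IsManifold 𝓘(ℝ, EuclideanSpace ℝ (Fin k)) ∞
        (PrequantumReduction.ReducedSpace (F := F) G α)]
      (β : PrequantumReduction.OneForm (EuclideanSpace ℝ (Fin k))
        (PrequantumReduction.ReducedSpace (F := F) G α)),
      PrequantumReduction.IsReduction G α k β →
      Set.BijOn (PrequantumReduction.liftSet G α)
        {M : Set (PrequantumReduction.ReducedSpace (F := F) G α) | β.IsLegendrian M}
        {L : Set X | α.IsLegendrian L ∧ ∀ g : G, ∀ x ∈ L, g • x ∈ L} := by
  have hGX := hα.smooth_action
  have hinv : α.IsInvariant G := hα.invariant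
  have hR := hα.reeb.exists_reeb
  have S : ∀ x : PrequantumReduction.zeroLevel (F := F) G α,
      PrequantumReduction.SliceChart F G α (x : X) := fun x => Classical.choice
    (PrequantumReduction.nonempty_sliceChart hα.contact hinv hR hproper x.2 (hfree x x.2))
  refine ⟨⟨PrequantumReduction.t2Space_reducedSpace hα.contact.smooth hinv hproper,
    fun _ => PrequantumReduction.secondCountableTopology_reducedSpace hinv,
    PrequantumReduction.exists_reduction hinv S hα.contact.smooth⟩, fun k _ _ β hβ => ?_⟩
  -- An empty level does not determine `k`. In that case the empty set is the only Legendrian on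
  -- either side, since an invariant one lies in the level.
  rcases isEmpty_or_nonempty (PrequantumReduction.zeroLevel (F := F) G α) with hC | ⟨⟨x⟩⟩
  · have hC' : PrequantumReduction.zeroLevel (F := F) G α = ∅ := isEmpty_coe_sort.1 hC
    have hQ : IsEmpty (PrequantumReduction.ReducedSpace (F := F) G α) :=
      ⟨fun q => hC.elim q.out⟩
    refine ⟨fun M _ => ?_, PrequantumReduction.injective_liftSet.injOn, fun L hL => ?_⟩
    · have hM : PrequantumReduction.liftSet G α M = ∅ :=
        subset_empty_iff.1 (hC' ▸ PrequantumReduction.liftSet_subset_zeroLevel M)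
      rw [hM]
      exact ⟨⟨fun _ h => h.elim, fun _ _ _ _ h t ht => (h ht).elim⟩, fun _ _ h => h.elim⟩
    · have hLC := hL.1.subset_zeroLevel (F := F) hL.2
      exact ⟨_, ⟨fun q => hQ.elim q, fun γ _ _ _ _ t _ => hQ.elim (γ t)⟩,
        PrequantumReduction.liftSet_image hL.2 hLC⟩
  -- A point of the level fixes the dimension; uniqueness then replaces `β` by the constructed form,
  -- while the given manifold structure is kept.
  · obtain rfl := hβ.eq_reducedDim hinv (S x)
    rw [hβ.eq_redForm hinv S]
    exact PrequantumReduction.bijOn_liftSet hinv S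
      (fun y => hβ.redChart_mem_maximalAtlas hinv (S y)) fun y hy =>
        PrequantumReduction.finrank_eq_of_zeroLevel hα.contact hinv hR hy (hfree y hy)
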